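/- Let $M$ be an oriented (Hausdorff, $\sigma$-compact) smooth $n$-manifold, possibly with boundary, and let $(E,\rho,\langle\cdot,\cdot\rangle_E,[\cdot,\cdot]_E)$ be a Courant algebroid over $M$: $E\to M$ is a smooth vector bundle of finite rank, $\rho:E\to TM$ a bundle map, $\langle\cdot,\cdot\rangle_E$ a (possibly indefinite) fibre-wise metric of constant signature $(p,q)$ with $p\neq 1$ and $q\neq 1$, and $[\cdot,\cdot]_E$ an $\mathbb R$-bilinear bracket on $\Gamma(E)$ such that, for all sections and all $f\in C^\infty(M)$: $[\psi,f\psi']=f[\psi,\psi']+(\rho(\psi)f)\psi'$; $\rho(\psi)\langle\psi',\psi''\rangle=\langle[\psi,\psi'],\psi''\rangle+\langle\psi',[\psi,\psi'']\rangle$; $[\psi,[\psi',\psi'']]=[[\psi,\psi'],\psi'']+[\psi',[\psi,\psi'']]$; $\langle[\psi,\psi],\psi'\rangle=\tfrac12\rho(\psi')\langle\psi,\psi\rangle$. A generalized metric is a maximal positive definite smooth subbundle $V_+\subseteq E$; put $V_-=V_+^\perp$, so $E=V_+\oplus V_-$, and $\mathbf G(\psi,\psi')=\langle\psi_+,\psi'_+\rangle-\langle\psi_-,\psi'_-\rangle$.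 A Courant algebroid connection is an $\mathbb R$-bilinear map $\nabla:\Gamma(E)\times\Gamma(E)\to\Gamma(E)$ with $\nabla_{f\psi}\psi'=f\nabla_\psi\psi'$, $\nabla_\psi(f\psi')=f\nabla_\psi\psi'+(\rho(\psi)f)\psi'$ and $\rho(\psi)\langle\psi',\psi''\rangle=\langle\nabla_\psi\psi',\psi''\rangle+\langle\psi',\nabla_\psi\psi''\rangle$. Its torsion is $T_\nabla(\psi,\psi',\psi'')=\langle\nabla_\psi\psi'-\nabla_{\psi'}\psi-[\psi,\psi'],\psi''\rangle+\langle\nabla_{\psi''}\psi,\psi'\rangle$ and its divergence is $\mathrm{Div}_\nabla(\psi)=\mathrm{Tr}(\nabla_{(\cdot)}\psi)$. With $R^0_\nabla(\phi',\phi,\psi,\psi')=\langle\nabla_\psi\nabla_{\psi'}\phi-\nabla_{\psi'}\nabla_\psi\phi-\nabla_{[\psi,\psi']}\phi,\phi'\rangle$ and $\langle\mathbf K(\psi,\psi'),\phi\rangle=\langle\nabla_\phi\psi,\psi'\rangle$, its curvature is $R_\nabla(\phi',\phi,\psi,\psi')=\tfrac12\{R^0_\nabla(\phi',\phi,\psi,\psi')+R^0_\nabla(\psi',\psi,\phi,\phi')+\langle\mathbf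 K(\psi,\psi'),\mathbf K(\phi,\phi')\rangle\}$, its Ricci tensor $\mathrm{Ric}_\nabla(\psi,\psi')$ is the trace of $R_\nabla(\cdot,\psi,\cdot,\psi')$ with respect to $\langle\cdot,\cdot\rangle_E$, and for a fibre-wise metric $\mathbf g$ its scalar curvature is $\mathcal R^{\mathbf g}_\nabla=\mathrm{Tr}_{\mathbf g}(\mathrm{Ric}_\nabla)$. For a generalized metric $V_+$ and a volume form $\omega$ (a nowhere vanishing smooth $n$-form), $\mathrm{LC}(E,V_+,\mathrm{Div}_\omega)$ is the set of connections $\nabla$ with $\nabla_\psi\Gamma(V_+)\subseteq\Gamma(V_+)$ for all $\psi$, $T_\nabla=0$, and $\mathcal L_{\rho(\psi)}\omega=\mathrm{Div}_\nabla(\psi)\,\omega$ for all $\psi$. Let $\mathcal R_E$ be the canonical function on $M$ equal to the scalar curvature of $\langle\cdot,\cdot\rangle_E$ for any element of $\mathrm{LC}(E,V_+,\mathrm{Div}_\omega)$, for any $V_+$ and $\omega$. The generalized Einstein--Hilbert action is $S_{EH}[V_+,\omega]=\int_M\{\mathcal R^{\mathbf G}_\nabla+\mathcal R_E\}\,\omega$,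 where $\nabla$ is an arbitrary element of $\mathrm{LC}(E,V_+,\mathrm{Div}_\omega)$ (so $\nabla$ changes with $(V_+,\omega)$). The fields $(V_+,\omega)$ extremalize $S_{EH}$ if, for every compact $K$ in the interior of $M$, every bundle map $\varphi:V_+\to V_-$ and every $f\in C^\infty(M)$, both vanishing outside $K$, the action over $K$ satisfies $\frac{d}{d\epsilon}\big|_{\epsilon=0}S_{EH}[\mathrm{gr}(\epsilon\varphi),e^{\epsilon f}\omega]=0$, where $\mathrm{gr}(\epsilon\varphi)=\{v+\epsilon\varphi(v):v\in V_+\}$. Then for every generalized metric $V_+$, every volume form $\omega$ and every $\nabla\in\mathrm{LC}(E,V_+,\mathrm{Div}_\omega)$: $(V_+,\omega)$ extremalize $S_{EH}$ if and only if (i) $\nabla$ is Ricci compatible with $V_+$, that is, $\mathrm{Ric}_\nabla(\Gamma(V_+),\Gamma(V_-))=0$, and (ii) $\mathcal R^{\mathbf G}_\nabla+\mathcal R_E=0$. Both conditions are equations for $(V_+,\omega)$ only: the restriction of $\mathrm{Ric}_\nabla$ to $\Gamma(V_+)\times\Gamma(V_-)$ and the function $\mathcal R^{\mathbf G}_\nabla$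 are the same for all $\nabla\in\mathrm{LC}(E,V_+,\mathrm{Div}_\omega)$. -/

import Mathlib

open Bundle Manifold MeasureTheory Topology Module
open scoped ContDiff

noncomputable section

/-! ## Smooth sections, vector fields, top-degree forms -/

/-- Multiplication of a smooth section by a smooth function. -/
def smulSection {n : ℕ} {H : Type*} [TopologicalSpace H]
    {I : ModelWithCorners ℝ (EuclideanSpace ℝ (Fin n)) H}
    {M : Type*} [TopologicalSpace M] [ChartedSpace H M]
    {F : Type*} [NormedAddCommGroup F] [NormedSpace ℝ F]
    {E : M → Type*} [TopologicalSpace (TotalSpace F E)] [∀ x, TopologicalSpace (E x)]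
    [∀ x, AddCommGroup (E x)] [∀ x, Module ℝ (E x)] [FiberBundle F E] [VectorBundle ℝ F E]
    (f : C^∞⟮I, M; 𝓘(ℝ, ℝ), ℝ⟯) (ψ : Cₛ^∞⟮I; F, E⟯) : Cₛ^∞⟮I; F, E⟯ :=
  ⟨fun x => f x • ψ x, f.contMDiff.smul_section ψ.contMDiff⟩

/-- Every fibre has a basis consisting of values of global smooth sections. -/
theorem exists_sections_basis {n : ℕ} {H : Type*} [TopologicalSpace H]
    (I : ModelWithCorners ℝ (EuclideanSpace ℝ (Fin n)) H)
    {M : Type*} [TopologicalSpace M] [ChartedSpace H M] [IsManifold I ∞ M] [T2Space M]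
    (F : Type*) [NormedAddCommGroup F] [NormedSpace ℝ F] [FiniteDimensional ℝ F]
    (E : M → Type*) [TopologicalSpace (TotalSpace F E)] [∀ x, TopologicalSpace (E x)]
    [∀ x, AddCommGroup (E x)] [∀ x, Module ℝ (E x)] [FiberBundle F E] [VectorBundle ℝ F E]
    [ContMDiffVectorBundle ∞ F E I] (x : M) :
    ∃ s : Fin (finrank ℝ F) → Cₛ^∞⟮I; F, E⟯,
      ∃ b : Basis (Fin (finrank ℝ F)) ℝ (E x), ∀ i, b i = s i x := by
  classical
  set e := trivializationAt F E x with he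
  have hx : x ∈ e.baseSet := FiberBundle.mem_baseSet_trivializationAt' x
  obtain ⟨f, hf⟩ : ∃ f : SmoothBumpFunction I x, tsupport f ⊆ e.baseSet := by
    obtain ⟨f, -, hf⟩ := (SmoothBumpFunction.nhds_basis_tsupport (I := I) x).mem_iff.1
      (e.open_baseSet.mem_nhds hx)
    exact ⟨f, hf⟩
  set b := finBasis ℝ F
  refine ⟨fun i => ⟨(f : M → ℝ) • e.localFrame b i, ?_⟩, e.basisAt b hx, fun i => ?_⟩
  · exact ContMDiffOn.smul_section_of_tsupport (f.contMDiff.contMDiffOn) e.open_baseSet hf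
      (e.contMDiffOn_localFrame_baseSet ∞ b i)
  · have h1 : f x = 1 := f.eq_one
    change _ = f x • e.localFrame b i x
    rw [h1, one_smul, e.localFrame_apply_of_mem_baseSet b hx]

section Manifold

variable {n : ℕ} {H : Type*} [TopologicalSpace H]
  (I : ModelWithCorners ℝ (EuclideanSpace ℝ (Fin n)) H)
  {M : Type*} [TopologicalSpace M] [ChartedSpace H M] [IsManifold I ∞ M]

/-- Smooth vector fields on `M`. -/
abbrev SmoothVectorField {n : ℕ} {H : Type*} [TopologicalSpace H]
    (I : ModelWithCorners ℝ (EuclideanSpace ℝ (Fin n)) H)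
    (M : Type*) [TopologicalSpace M] [ChartedSpace H M] [IsManifold I ∞ M] : Type _ :=
  Cₛ^∞⟮I; EuclideanSpace ℝ (Fin n), (TangentSpace I : M → Type _)⟯

/-- Families of alternating forms of top degree on the tangent spaces. -/
abbrev TopForm {n : ℕ} {H : Type*} [TopologicalSpace H]
    (I : ModelWithCorners ℝ (EuclideanSpace ℝ (Fin n)) H)
    (M : Type*) [TopologicalSpace M] [ChartedSpace H M] : Type _ :=
  ∀ x : M, (TangentSpace I x) [⋀^Fin n]→ₗ[ℝ] ℝ

/-- A volume form: a smooth, nowhere vanishing form of top degree. -/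
structure IsVolumeForm (vol : TopForm I M) : Prop where
  smooth : ∀ X : Fin n → SmoothVectorField I M,
    ContMDiff I 𝓘(ℝ, ℝ) ∞ (fun x => vol x (fun i => X i x))
  ne_zero : ∀ x, vol x ≠ 0

/-- The Lie derivative of a top-degree form along `X`, evaluated on vector fields `Y₁, …, Yₙ`:
`(L_X vol)(Y₁, …, Yₙ) = X (vol(Y₁, …, Yₙ)) - ∑ i, vol(Y₁, …, [X, Yᵢ], …, Yₙ)`. -/
def lieDerivTopForm (X : SmoothVectorField I M) (vol : TopForm I M)
    (Y : Fin n → SmoothVectorField I M) (x : M) : ℝ :=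
  mvfderiv I (fun y => vol y (fun i => Y i y)) x (X x) -
    ∑ i, vol x (Function.update (fun j => Y j x) i
      (VectorField.mlieBracket I (fun y => X y) (fun y => Y i y) x))

/-- The coefficient `vol(∂₁, …, ∂ₙ)` of a top-degree form in the preferred chart at `c`, as a function
of the chart coordinate `y`. -/
def chartCoeff (vol : TopForm I M) (c : M) (y : EuclideanSpace ℝ (Fin n)) : ℝ :=
  vol ((extChartAt I c).symm y) (fun i =>
    mfderivWithin 𝓘(ℝ, EuclideanSpace ℝ (Fin n)) I (extChartAt I c).symm (Set.range I) y
      (EuclideanSpace.single i (1 : ℝ) : EuclideanSpace ℝ (Fin n)))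

/-- The measure `|vol|` on the domain of the preferred chart at `c`: the image of
`|vol(∂₁, …, ∂ₙ)| dy` under the inverse of the chart. -/
def chartMeasure [MeasurableSpace M] (vol : TopForm I M) (c : M) : Measure M :=
  (((volume : Measure (EuclideanSpace ℝ (Fin n))).restrict (extChartAt I c).target).withDensity
    (fun y => ENNReal.ofReal |chartCoeff I vol c y|)).map (extChartAt I c).symm

/-- A smooth partition of unity subordinate to the domains of the preferred charts. -/
def chartPartition (M : Type*) [TopologicalSpace M] [ChartedSpace H M] [IsManifold I ∞ M]
    [T2Space M] [SigmaCompactSpace M] : SmoothPartitionOfUnity M I M Set.univ :=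
  (SmoothPartitionOfUnity.exists_isSubordinate_chartAt_source I M).choose

/-- The measure `|vol|` on `M` defined by a top-degree form `vol`, glued from the chart measures by a
partition of unity. -/
def formMeasure [T2Space M] [SigmaCompactSpace M] [MeasurableSpace M] (vol : TopForm I M) :
    Measure M :=
  Measure.sum fun c : M =>
    (chartMeasure I vol c).withDensity (fun x => ENNReal.ofReal (chartPartition I M c x))

/-- The quotient `α / o` of two top-degree forms (for `o` a volume form): the function `h` with
`α = h • o`. -/
def formRatio (α o : TopForm I M) (x : M) : ℝ :=
  α x (fun i => (EuclideanSpace.single i (1 : ℝ) : EuclideanSpace ℝ (Fin n))) /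
    o x (fun i => (EuclideanSpace.single i (1 : ℝ) : EuclideanSpace ℝ (Fin n)))

/-- The integral over `K ⊆ M` of a top-degree form `α`, for the orientation of `M` in which the
volume form `o` is positive: writing `α = h • o`, this is the integral of `h` against `|o|`. It
depends on `o` only through the orientation that `o` defines. -/
def integralTopForm [T2Space M] [SigmaCompactSpace M] [MeasurableSpace M]
    (o : TopForm I M) (K : Set M) (α : TopForm I M) : ℝ :=
  ∫ x in K, formRatio I α o x ∂(formMeasure I o)

end Manifold

/-! ## Courant algebroids -/

/-- A Courant algebroid structure on the smooth vector bundle `E` over `M`. -/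
structure CourantAlgebroid {n : ℕ} {H : Type*} [TopologicalSpace H]
    (I : ModelWithCorners ℝ (EuclideanSpace ℝ (Fin n)) H)
    {M : Type*} [TopologicalSpace M] [ChartedSpace H M] [IsManifold I ∞ M]
    (F : Type*) [NormedAddCommGroup F] [NormedSpace ℝ F]
    (E : M → Type*) [TopologicalSpace (TotalSpace F E)] [∀ x, TopologicalSpace (E x)]
    [∀ x, AddCommGroup (E x)] [∀ x, Module ℝ (E x)] [FiberBundle F E] [VectorBundle ℝ F E] where
  /-- the anchor `ρ : E → TM` -/
  anchor : ∀ x, E x →ₗ[ℝ] TangentSpace I x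
  anchor_smooth : ∀ ψ : Cₛ^∞⟮I; F, E⟯,
    ContMDiff I (I.prod 𝓘(ℝ, EuclideanSpace ℝ (Fin n))) ∞
      (fun x => TotalSpace.mk' (EuclideanSpace ℝ (Fin n)) x (anchor x (ψ x)))
  /-- the fibre-wise metric `⟨·,·⟩` -/
  metric : ∀ x, LinearMap.BilinForm ℝ (E x)
  metric_symm : ∀ x, (metric x).IsSymm
  metric_nondegenerate : ∀ x, (metric x).Nondegenerate
  metric_smooth : ∀ ψ ψ' : Cₛ^∞⟮I; F, E⟯,
    ContMDiff I 𝓘(ℝ, ℝ) ∞ (fun x => metric x (ψ x) (ψ' x))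
  /-- the bracket `[·,·]` -/
  bracket : Cₛ^∞⟮I; F, E⟯ →ₗ[ℝ] Cₛ^∞⟮I; F, E⟯ →ₗ[ℝ] Cₛ^∞⟮I; F, E⟯
  bracket_smul : ∀ (f : C^∞⟮I, M; 𝓘(ℝ, ℝ), ℝ⟯) (ψ ψ' : Cₛ^∞⟮I; F, E⟯) (x : M),
    bracket ψ (smulSection f ψ') x =
      f x • bracket ψ ψ' x + (mvfderiv I f x (anchor x (ψ x))) • ψ' x
  bracket_metric : ∀ (ψ ψ' ψ'' : Cₛ^∞⟮I; F, E⟯) (x : M),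
    mvfderiv I (fun y => metric y (ψ' y) (ψ'' y)) x (anchor x (ψ x)) =
      metric x (bracket ψ ψ' x) (ψ'' x) + metric x (ψ' x) (bracket ψ ψ'' x)
  jacobi : ∀ ψ ψ' ψ'' : Cₛ^∞⟮I; F, E⟯,
    bracket ψ (bracket ψ' ψ'') = bracket (bracket ψ ψ') ψ'' + bracket ψ' (bracket ψ ψ'')
  bracket_self : ∀ (ψ ψ' : Cₛ^∞⟮I; F, E⟯) (x : M),
    metric x (bracket ψ ψ x) (ψ' x) =
      (1 / 2) * mvfderiv I (fun y => metric y (ψ y) (ψ y)) x (anchor x (ψ' x))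

namespace CourantAlgebroid

variable {n : ℕ} {H : Type*} [TopologicalSpace H]
  {I : ModelWithCorners ℝ (EuclideanSpace ℝ (Fin n)) H}
  {M : Type*} [TopologicalSpace M] [ChartedSpace H M] [IsManifold I ∞ M]
  {F : Type*} [NormedAddCommGroup F] [NormedSpace ℝ F]
  {E : M → Type*} [TopologicalSpace (TotalSpace F E)] [∀ x, TopologicalSpace (E x)]
  [∀ x, AddCommGroup (E x)] [∀ x, Module ℝ (E x)] [FiberBundle F E] [VectorBundle ℝ F E]
  (C : CourantAlgebroid I F E)

/-- The vector field `ρ(ψ)`. -/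
def anchorField (ψ : Cₛ^∞⟮I; F, E⟯) : SmoothVectorField I M :=
  ⟨fun x => C.anchor x (ψ x), C.anchor_smooth ψ⟩

/-- `⟨·,·⟩` has constant signature `(p, q)`: each fibre is an orthogonal direct sum of a positive
definite subspace of dimension `p` and a negative definite subspace of dimension `q`. -/
def HasSignature (p q : ℕ) : Prop :=
  ∀ x, ∃ P N : Submodule ℝ (E x), IsCompl P N ∧
    (∀ v ∈ P, ∀ w ∈ N, C.metric x v w = 0) ∧
    (∀ v ∈ P, v ≠ 0 → 0 < C.metric x v v) ∧ (∀ w ∈ N, w ≠ 0 → C.metric x w w < 0) ∧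
    finrank ℝ P = p ∧ finrank ℝ N = q

/-! ### Generalized metrics -/

/-- The orthogonal complement `V₋` of `V₊`. -/
def perp (V : ∀ x, Submodule ℝ (E x)) (x : M) : Submodule ℝ (E x) :=
  (C.metric x).orthogonal (V x)

/-- A generalized metric: a smooth subbundle `V₊ ⊆ E` (locally spanned by pointwise linearly
independent smooth sections) whose fibres are maximal positive definite subspaces. -/
structure IsGeneralizedMetric (V : ∀ x, Submodule ℝ (E x)) : Prop where
  smooth : ∀ x, ∃ (k : ℕ) (s : Fin k → Cₛ^∞⟮I; F, E⟯), ∀ᶠ y in 𝓝 x,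
    LinearIndependent ℝ (fun i => s i y) ∧ Submodule.span ℝ (Set.range fun i => s i y) = V y
  pos : ∀ x, ∀ v ∈ V x, v ≠ 0 → 0 < C.metric x v v
  maximal : ∀ x (W : Submodule ℝ (E x)), (∀ v ∈ W, v ≠ 0 → 0 < C.metric x v v) →
    V x ≤ W → W = V x

open scoped Classical in
/-- The component `v₊` of `v` with respect to `E = V₊ ⊕ V₋` (zero if this is not a direct sum
decomposition, which does not happen for a generalized metric). -/
def plusPart (V : ∀ x, Submodule ℝ (E x)) (x : M) : E x →ₗ[ℝ] E x :=
  if h : IsCompl (V x) (C.perp V x) then (V x).projection (C.perp V x) h else 0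

/-- The fibre-wise metric `𝐆(v, w) = ⟨v₊, w₊⟩ - ⟨v₋, w₋⟩` induced by `V₊`. -/
def genMetric (V : ∀ x, Submodule ℝ (E x)) (x : M) : LinearMap.BilinForm ℝ (E x) :=
  (C.metric x).compl₁₂ (C.plusPart V x) (C.plusPart V x) -
    (C.metric x).compl₁₂ (LinearMap.id - C.plusPart V x) (LinearMap.id - C.plusPart V x)

/-- A Courant algebroid connection on `E`. -/
structure Connection where
  /-- `∇(ψ, ψ') = ∇_ψ ψ'` -/
  cov : Cₛ^∞⟮I; F, E⟯ →ₗ[ℝ] Cₛ^∞⟮I; F, E⟯ →ₗ[ℝ] Cₛ^∞⟮I; F, E⟯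
  smul_left : ∀ (f : C^∞⟮I, M; 𝓘(ℝ, ℝ), ℝ⟯) (ψ ψ' : Cₛ^∞⟮I; F, E⟯),
    cov (smulSection f ψ) ψ' = smulSection f (cov ψ ψ')
  smul_right : ∀ (f : C^∞⟮I, M; 𝓘(ℝ, ℝ), ℝ⟯) (ψ ψ' : Cₛ^∞⟮I; F, E⟯) (x : M),
    cov ψ (smulSection f ψ') x =
      f x • cov ψ ψ' x + (mvfderiv I f x (C.anchor x (ψ x))) • ψ' x
  metric_compat : ∀ (ψ ψ' ψ'' : Cₛ^∞⟮I; F, E⟯) (x : M),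
    mvfderiv I (fun y => C.metric y (ψ' y) (ψ'' y)) x (C.anchor x (ψ x)) =
      C.metric x (cov ψ ψ' x) (ψ'' x) + C.metric x (ψ' x) (cov ψ ψ'' x)

/-! ### Frames and traces -/

section Frame

variable [T2Space M] [FiniteDimensional ℝ F] [ContMDiffVectorBundle ∞ F E I]

variable (I F E) in
/-- Global smooth sections whose values at `x` form a basis of `E x`. -/
def frame (x : M) : Fin (finrank ℝ F) → Cₛ^∞⟮I; F, E⟯ :=
  (exists_sections_basis I F E x).choose

variable (I F E) in
/-- The basis of `E x` given by the values of `frame` at `x`. -/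
def frameBasis (x : M) : Basis (Fin (finrank ℝ F)) ℝ (E x) :=
  (exists_sections_basis I F E x).choose_spec.choose

theorem frameBasis_apply (x : M) (i : Fin (finrank ℝ F)) :
    frameBasis I F E x i = frame I F E x i x :=
  (exists_sections_basis I F E x).choose_spec.choose_spec i

variable (I F) in
/-- The inverse Gram matrix `g^{ij}` at `x` of a fibre-wise metric `g`, in the basis
`frameBasis`. -/
def gramInv (g : ∀ x, LinearMap.BilinForm ℝ (E x)) (x : M) :
    Matrix (Fin (finrank ℝ F)) (Fin (finrank ℝ F)) ℝ :=
  (Matrix.of fun i j => g x (frameBasis I F E x i) (frameBasis I F E x j))⁻¹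

namespace Connection

variable {C} (D : C.Connection)

/-- The torsion `T_∇(ψ, ψ', ψ'')`. -/
def torsion (ψ ψ' ψ'' : Cₛ^∞⟮I; F, E⟯) (x : M) : ℝ :=
  C.metric x ((D.cov ψ ψ' - D.cov ψ' ψ - C.bracket ψ ψ') x) (ψ'' x) +
    C.metric x (D.cov ψ'' ψ x) (ψ' x)

/-- The divergence `Div_∇(ψ) = Tr(∇(·, ψ))`. -/
def divergence (ψ : Cₛ^∞⟮I; F, E⟯) (x : M) : ℝ :=
  ∑ i, (frameBasis I F E x).coord i (D.cov (frame I F E x i) ψ x)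

/-- `R⁰_∇(φ', φ, ψ, ψ') = ⟨∇_ψ ∇_ψ' φ - ∇_ψ' ∇_ψ φ - ∇_[ψ,ψ'] φ, φ'⟩`. -/
def curvatureZero (φ' φ ψ ψ' : Cₛ^∞⟮I; F, E⟯) (x : M) : ℝ :=
  C.metric x
    ((D.cov ψ (D.cov ψ' φ) - D.cov ψ' (D.cov ψ φ) - D.cov (C.bracket ψ ψ') φ) x) (φ' x)

/-- The value at `x` of `𝐊(ψ, ψ')`, the section with `⟨𝐊(ψ, ψ'), φ⟩ = ⟨∇_φ ψ, ψ'⟩` for all `φ`. -/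
def vecK (ψ ψ' : Cₛ^∞⟮I; F, E⟯) (x : M) : E x :=
  ∑ i, ∑ j, (gramInv I F C.metric x i j *
    C.metric x (D.cov (frame I F E x i) ψ x) (ψ' x)) • frameBasis I F E x j

/-- The curvature tensor `R_∇(φ', φ, ψ, ψ')`. -/
def curvature (φ' φ ψ ψ' : Cₛ^∞⟮I; F, E⟯) (x : M) : ℝ :=
  (1 / 2) * (D.curvatureZero φ' φ ψ ψ' x + D.curvatureZero ψ' ψ φ φ' x +
    C.metric x (D.vecK ψ ψ' x) (D.vecK φ φ' x))

/-- The Ricci tensor `Ric_∇(ψ, ψ')`, the trace over `⟨·,·⟩` of `R_∇(·, ψ, ·, ψ')`. -/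
def ricci (ψ ψ' : Cₛ^∞⟮I; F, E⟯) (x : M) : ℝ :=
  ∑ i, ∑ j, gramInv I F C.metric x i j *
    D.curvature (frame I F E x i) ψ (frame I F E x j) ψ' x

/-- The scalar curvature `ℛ^g_∇ = Tr_g(Ric_∇)` with respect to a fibre-wise metric `g`. -/
def scalarCurvature (g : ∀ x, LinearMap.BilinForm ℝ (E x)) (x : M) : ℝ :=
  ∑ i, ∑ j, gramInv I F g x i j * D.ricci (frame I F E x i) (frame I F E x j) x

/-- `∇` is Levi-Civita with respect to `V₊` with divergence `Div_vol`, i.e. `∇ ∈ LC(E, V₊, Div_vol)`: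
it preserves `V₊`, has zero torsion, and `L_{ρ(ψ)} vol = Div_∇(ψ) vol` for all `ψ`. -/
structure IsLeviCivita (V : ∀ x, Submodule ℝ (E x)) (vol : TopForm I M) : Prop where
  metric_compatible : ∀ ψ ψ' : Cₛ^∞⟮I; F, E⟯, (∀ x, ψ' x ∈ V x) → ∀ x, D.cov ψ ψ' x ∈ V x
  torsion_free : ∀ (ψ ψ' ψ'' : Cₛ^∞⟮I; F, E⟯) (x : M), D.torsion ψ ψ' ψ'' x = 0
  divergence_eq : ∀ (ψ : Cₛ^∞⟮I; F, E⟯) (Y : Fin n → SmoothVectorField I M) (x : M),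
    lieDerivTopForm I (C.anchorField ψ) vol Y x = D.divergence ψ x * vol x (fun i => Y i x)

/-- `∇` is Ricci compatible with `V₊`: `Ric_∇(Γ(V₊), Γ(V₋)) = 0`. -/
def IsRicciCompatible (V : ∀ x, Submodule ℝ (E x)) : Prop :=
  ∀ ψ ψ' : Cₛ^∞⟮I; F, E⟯, (∀ x, ψ x ∈ V x) → (∀ x, ψ' x ∈ C.perp V x) →
    ∀ x, D.ricci ψ ψ' x = 0

end Connection

/-! ### The Einstein-Hilbert action -/

open scoped Classical in
/-- The canonical scalar function `ℛ_E`: the scalar curvature `Tr_{⟨·,·⟩}(Ric_∇)` of any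
`∇ ∈ LC(E, V₊, Div_vol)`, for any generalized metric `V₊` and any volume form `vol`. (The value `0` is
only used when there is no such `∇` at all.) -/
def canonicalScalar (x : M) : ℝ :=
  if h : ∃ D : C.Connection, ∃ (V : ∀ x, Submodule ℝ (E x)) (vol : TopForm I M),
      C.IsGeneralizedMetric V ∧ IsVolumeForm I vol ∧ D.IsLeviCivita V vol
  then h.choose.scalarCurvature C.metric x else 0

open scoped Classical in
/-- The function `ℛ^𝐆_∇ + ℛ_E` for an arbitrary `∇ ∈ LC(E, V₊, Div_vol)`. (The value `0` is only
used when there is no such `∇`.) -/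
def ehScalar (V : ∀ x, Submodule ℝ (E x)) (vol : TopForm I M) (x : M) : ℝ :=
  if h : ∃ D : C.Connection, D.IsLeviCivita V vol
  then h.choose.scalarCurvature (C.genMetric V) x + C.canonicalScalar x else 0

variable [SigmaCompactSpace M] [MeasurableSpace M]

/-- The generalized Einstein-Hilbert action over `K ⊆ M`, `∫_K (ℛ^𝐆_∇ + ℛ_E) vol` with an arbitrary
`∇ ∈ LC(E, V₊, Div_vol)`, for the orientation of `M` in which `o` is positive. -/
def ehAction (o : TopForm I M) (K : Set M) (V : ∀ x, Submodule ℝ (E x)) (vol : TopForm I M) : ℝ :=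
  integralTopForm I o K (fun x => C.ehScalar V vol x • vol x)

/-- A smooth vector bundle map `V₊ → V₋`. -/
structure IsVariation (V : ∀ x, Submodule ℝ (E x)) (φ : ∀ x, V x →ₗ[ℝ] E x) : Prop where
  mem_perp : ∀ x (v : V x), φ x v ∈ C.perp V x
  smooth : ∀ (ψ : Cₛ^∞⟮I; F, E⟯) (hψ : ∀ x, ψ x ∈ V x),
    ContMDiff I (I.prod 𝓘(ℝ, F)) ∞ (fun x => TotalSpace.mk' F x (φ x ⟨ψ x, hψ x⟩))

/-- The graph `{v + φ(v) | v ∈ V₊}` of a bundle map defined on `V₊`. -/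
def graph (V : ∀ x, Submodule ℝ (E x)) (φ : ∀ x, V x →ₗ[ℝ] E x) (x : M) : Submodule ℝ (E x) :=
  LinearMap.range ((V x).subtype + φ x)

/-- `(V₊, vol)` extremalizes the Einstein-Hilbert action: for every bundle map `φ : V₊ → V₋` and every
smooth function `f` that vanish outside a compact subset `K` of the interior of `M`, the derivative
at `ε = 0` of the action of the varied fields `(graph (ε φ), exp (ε f) vol)` is zero. Since the fields
are varied inside `K` only, the action is taken over `K` (over all of `M` it need not converge). -/
def IsExtremal (o : TopForm I M) (V : ∀ x, Submodule ℝ (E x)) (vol : TopForm I M) : Prop :=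
  ∀ K : Set M, IsCompact K → K ⊆ I.interior M →
    ∀ φ : ∀ x, V x →ₗ[ℝ] E x, C.IsVariation V φ → (∀ x ∉ K, φ x = 0) →
    ∀ f : C^∞⟮I, M; 𝓘(ℝ, ℝ), ℝ⟯, (∀ x ∉ K, f x = 0) →
      HasDerivAt (fun ε : ℝ => C.ehAction o K
        (graph V (fun x => ε • φ x)) (fun x => Real.exp (ε * f x) • vol x)) 0 0

end Frame

end CourantAlgebroid

end

set_option linter.unusedSectionVars false

noncomputable section

/-! ## Linear algebra in a fibre -/

section Matrix

variable {𝔼 : Type*} [NormedAddCommGroup 𝔼] [NormedSpace ℝ 𝔼] {𝔥 : Type*} [TopologicalSpace 𝔥]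
  {J : ModelWithCorners ℝ 𝔼 𝔥} {N : Type*} [TopologicalSpace N] [ChartedSpace 𝔥 N]

theorem contMDiffAt_matrix_det {m : Type*} [Fintype m] [DecidableEq m] {A : N → Matrix m m ℝ} {q : N}
    (hA : ∀ i j, ContMDiffAt J 𝓘(ℝ, ℝ) ∞ (fun p => A p i j) q) :
    ContMDiffAt J 𝓘(ℝ, ℝ) ∞ (fun p => (A p).det) q := by
  simp only [Matrix.det_apply']
  refine ContMDiffAt.sum fun σ _ => ContMDiffAt.mul contMDiffAt_const ?_
  exact contMDiffAt_finsetProd fun i _ => hA _ _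

theorem contMDiffAt_matrix_inv {m : Type*} [Fintype m] [DecidableEq m] {A : N → Matrix m m ℝ} {q : N}
    (hA : ∀ i j, ContMDiffAt J 𝓘(ℝ, ℝ) ∞ (fun p => A p i j) q) (hq : (A q).det ≠ 0) (i j : m) :
    ContMDiffAt J 𝓘(ℝ, ℝ) ∞ (fun p => (A p)⁻¹ i j) q := by
  have h : ∀ p, (A p)⁻¹ i j = ((A p).det)⁻¹ * (Matrix.updateRow (A p) j (Pi.single i 1)).det := by
    intro p
    rw [Matrix.inv_def, Matrix.smul_apply, Ring.inverse_eq_inv', Matrix.adjugate_apply, smul_eq_mul]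
  simp only [h]
  refine ContMDiffAt.mul ((contMDiffAt_matrix_det hA).inv₀ hq) (contMDiffAt_matrix_det fun k l => ?_)
  by_cases hk : k = j
  · subst hk
    simp only [Matrix.updateRow_self]
    exact contMDiffAt_const
  · simp only [Matrix.updateRow_ne hk]
    exact hA _ _

end Matrix

section Cutoff

variable {n : ℕ} {H : Type*} [TopologicalSpace H]
  {I : ModelWithCorners ℝ (EuclideanSpace ℝ (Fin n)) H}
  {M : Type*} [TopologicalSpace M] [ChartedSpace H M] [IsManifold I ∞ M] [T2Space M]

/-- A smooth function equal to `1` near `x` and supported in a given neighbourhood of `x`. -/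
theorem exists_cutoff (I : ModelWithCorners ℝ (EuclideanSpace ℝ (Fin n)) H) [IsManifold I ∞ M]
    {x : M} {U : Set M} (hU : U ∈ 𝓝 x) :
    ∃ χ : C^∞⟮I, M; 𝓘(ℝ, ℝ), ℝ⟯, tsupport χ ⊆ U ∧ (∀ᶠ y in 𝓝 x, χ y = 1) ∧
      HasCompactSupport χ ∧ ∀ y, 0 ≤ χ y := by
  obtain ⟨f, -, hf⟩ := (SmoothBumpFunction.nhds_basis_tsupport (I := I) x).mem_iff.1 hU
  exact ⟨⟨f, f.contMDiff⟩, hf, f.eventuallyEq_one, f.hasCompactSupport, fun y => f.nonneg⟩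

theorem exists_smooth_extension {x : M} {u : M → ℝ}
    (hu : ∀ᶠ y in 𝓝 x, ContMDiffAt I 𝓘(ℝ, ℝ) ∞ u y) :
    ∃ f : C^∞⟮I, M; 𝓘(ℝ, ℝ), ℝ⟯, ∀ᶠ y in 𝓝 x, f y = u y := by
  obtain ⟨χ, h1, h2, -, -⟩ := exists_cutoff I hu
  refine ⟨⟨fun y => χ y * u y, fun y => ?_⟩, ?_⟩
  · by_cases hy : y ∈ tsupport χ
    · exact (χ.contMDiff y).mul (h1 hy)
    · refine (contMDiffAt_const (c := (0 : ℝ))).congr_of_eventuallyEq ?_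
      filter_upwards [(isClosed_tsupport χ).isOpen_compl.mem_nhds hy] with z hz
      rw [image_eq_zero_of_notMem_tsupport hz, zero_mul]
  · filter_upwards [h2] with y hy
    change χ y * u y = u y
    rw [hy, one_mul]

end Cutoff

namespace CourantAlgebroid

variable {n : ℕ} {H : Type*} [TopologicalSpace H]
  {I : ModelWithCorners ℝ (EuclideanSpace ℝ (Fin n)) H}
  {M : Type*} [TopologicalSpace M] [ChartedSpace H M] [IsManifold I ∞ M]
  {F : Type*} [NormedAddCommGroup F] [NormedSpace ℝ F]
  {E : M → Type*} [TopologicalSpace (TotalSpace F E)] [∀ x, TopologicalSpace (E x)]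
  [∀ x, AddCommGroup (E x)] [∀ x, Module ℝ (E x)] [FiberBundle F E] [VectorBundle ℝ F E]

section Basic

variable (C : CourantAlgebroid I F E)

theorem metric_comm (x : M) (v w : E x) : C.metric x v w = C.metric x w v :=
  (C.metric_symm x).eq v w

theorem metric_ext {x : M} {v w : E x} (h : ∀ u, C.metric x v u = C.metric x w u) : v = w := by
  have := (C.metric_nondegenerate x).1 (v - w) fun u => by
    rw [map_sub, LinearMap.sub_apply, h, sub_self]
  exact sub_eq_zero.1 this

end Basic

variable [T2Space M] [FiniteDimensional ℝ F] [ContMDiffVectorBundle ∞ F E I]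
variable (C : CourantAlgebroid I F E)

/-- The basis of `E x` dual to `frameBasis` with respect to the metric. -/
def dualFrame (x : M) (i : Fin (finrank ℝ F)) : E x :=
  LinearMap.BilinForm.dualBasis (C.metric x) (C.metric_nondegenerate x) (frameBasis I F E x) i

theorem metric_dualFrame_left (x : M) (i j) :
    C.metric x (C.dualFrame x i) (frameBasis I F E x j) = if j = i then 1 else 0 :=
  LinearMap.BilinForm.apply_dualBasis_left _ _ _ _

theorem metric_dualFrame_right (x : M) (i j) :
    C.metric x (frameBasis I F E x j) (C.dualFrame x i) = if j = i then 1 else 0 := by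
  rw [metric_comm, metric_dualFrame_left]

theorem sum_dualFrame_frame (x : M) (v : E x) :
    ∑ i, C.metric x v (C.dualFrame x i) • frameBasis I F E x i = v := by
  conv_rhs => rw [← (frameBasis I F E x).sum_repr v]
  refine Finset.sum_congr rfl fun i _ => ?_
  congr 1
  conv_lhs => rw [← (frameBasis I F E x).sum_repr v]
  simp only [map_sum, LinearMap.sum_apply, map_smul, LinearMap.smul_apply,
    metric_dualFrame_right, smul_eq_mul, mul_ite, mul_one, mul_zero, Finset.sum_ite_eq',
    Finset.mem_univ, if_true]

theorem sum_frame_dualFrame (x : M) (v : E x) :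
    ∑ i, C.metric x v (frameBasis I F E x i) • C.dualFrame x i = v := by
  have := (LinearMap.BilinForm.dualBasis (C.metric x) (C.metric_nondegenerate x)
    (frameBasis I F E x)).sum_repr v
  simpa [LinearMap.BilinForm.dualBasis_repr_apply, dualFrame] using this

theorem coord_eq (x : M) (i) (v : E x) :
    (frameBasis I F E x).coord i v = C.metric x v (C.dualFrame x i) := by
  conv_lhs => rw [← C.sum_dualFrame_frame x v]
  simp [Finsupp.single_apply]

theorem gramInv_sum {P : Type*} [AddCommGroup P] [Module ℝ P]
    (g : ∀ x, LinearMap.BilinForm ℝ (E x)) (x : M) (d : Fin (finrank ℝ F) → E x)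
    (hd : ∀ i j, g x (d i) (frameBasis I F E x j) = if j = i then 1 else 0)
    (B : E x →ₗ[ℝ] P) (i) :
    ∑ j, gramInv I F g x i j • B (frameBasis I F E x j) = B (d i) := by
  have h : gramInv I F g x = Matrix.of fun i j => (frameBasis I F E x).repr (d i) j := by
    refine Matrix.inv_eq_left_inv ?_
    ext i j
    rw [Matrix.mul_apply, Matrix.one_apply]
    have := hd i j
    rw [← (frameBasis I F E x).sum_repr (d i)] at this
    simp only [map_sum, LinearMap.sum_apply, map_smul, LinearMap.smul_apply, smul_eq_mul] at this
    simp only [Matrix.of_apply, this, eq_comm]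
  rw [h]
  conv_rhs => rw [← (frameBasis I F E x).sum_repr (d i)]
  simp only [map_sum, map_smul, Matrix.of_apply]

theorem gramInv_metric_sum {P : Type*} [AddCommGroup P] [Module ℝ P] (x : M) (B : E x →ₗ[ℝ] P) (i) :
    ∑ j, gramInv I F C.metric x i j • B (frameBasis I F E x j) = B (C.dualFrame x i) :=
  gramInv_sum C.metric x _ (C.metric_dualFrame_left x) B i

/-- The trace of a bilinear form with respect to the metric. -/
def tr (x : M) (B : E x →ₗ[ℝ] E x →ₗ[ℝ] ℝ) : ℝ :=
  ∑ i, B (frameBasis I F E x i) (C.dualFrame x i)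

theorem tr_eq_sum {ι : Type*} [Fintype ι] {x : M} {s t : ι → E x}
    (h : ∀ v, ∑ i, C.metric x v (t i) • s i = v) (B : E x →ₗ[ℝ] E x →ₗ[ℝ] ℝ) :
    C.tr x B = ∑ i, B (s i) (t i) := by
  have h1 : ∀ i, B (s i) (t i) =
      ∑ j, C.metric x (frameBasis I F E x j) (t i) * B (s i) (C.dualFrame x j) := by
    intro i
    conv_lhs => rw [← C.sum_frame_dualFrame x (t i)]
    simp [C.metric_comm x (t i)]
  simp only [h1]
  rw [Finset.sum_comm, tr]
  refine Finset.sum_congr rfl fun j _ => ?_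
  conv_lhs => rw [← h (frameBasis I F E x j)]
  simp

theorem tr_flip (x : M) (B : E x →ₗ[ℝ] E x →ₗ[ℝ] ℝ) : C.tr x B.flip = C.tr x B := by
  rw [C.tr_eq_sum (C.sum_frame_dualFrame x) B, tr]
  rfl

/-! ## Extension of vectors to sections and tensoriality -/

/-- A section with prescribed value at `x`, depending linearly on that value. -/
def ext (x : M) : E x →ₗ[ℝ] Cₛ^∞⟮I; F, E⟯ :=
  (frameBasis I F E x).constr ℝ (frame I F E x)

@[simp] theorem ext_frameBasis (x : M) (i) :
    ext (I := I) (F := F) x (frameBasis I F E x i) = frame I F E x i := by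
  simp [ext]

variable (I F) in
/-- Evaluation of sections at a point. -/
def evalAt (x : M) : Cₛ^∞⟮I; F, E⟯ →ₗ[ℝ] E x where
  toFun ψ := ψ x
  map_add' _ _ := rfl
  map_smul' _ _ := rfl

@[simp] theorem section_add_apply (ψ ψ' : Cₛ^∞⟮I; F, E⟯) (x : M) : (ψ + ψ') x = ψ x + ψ' x := rfl
@[simp] theorem section_sub_apply (ψ ψ' : Cₛ^∞⟮I; F, E⟯) (x : M) : (ψ - ψ') x = ψ x - ψ' x := rfl
@[simp] theorem section_smul_apply (c : ℝ) (ψ : Cₛ^∞⟮I; F, E⟯) (x : M) : (c • ψ) x = c • ψ x := rfl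
@[simp] theorem smulSection_apply (f : C^∞⟮I, M; 𝓘(ℝ, ℝ), ℝ⟯) (ψ : Cₛ^∞⟮I; F, E⟯) (x : M) :
    smulSection f ψ x = f x • ψ x := rfl
@[simp] theorem section_sum_apply {ι : Type*} (s : Finset ι) (ψ : ι → Cₛ^∞⟮I; F, E⟯) (x : M) :
    (∑ i ∈ s, ψ i) x = ∑ i ∈ s, ψ i x :=
  map_sum (evalAt I F x) ψ s

@[simp] theorem ext_apply (x : M) (v : E x) : ext (I := I) (F := F) x v x = v := by
  have : (evalAt I F x) ∘ₗ ext (I := I) (F := F) x = LinearMap.id :=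
    (frameBasis I F E x).ext fun i => by
      change (ext (I := I) (F := F) x (frameBasis I F E x i)) x = _
      rw [ext_frameBasis, ← frameBasis_apply]; rfl
  exact LinearMap.congr_fun this v

/-- Near each point there are global sections forming a frame together with its dual frame. -/
theorem exists_dual_sections (x : M) :
    ∃ s t : Fin (finrank ℝ F) → Cₛ^∞⟮I; F, E⟯, ∀ᶠ y in 𝓝 x,
      (∀ v : E y, ∑ i, C.metric y v (t i y) • s i y = v) ∧
      (∀ v : E y, ∑ i, C.metric y v (s i y) • t i y = v) ∧
      ∀ i j, C.metric y (s i y) (t j y) = if i = j then 1 else 0 := by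
  classical
  set s := frame I F E x
  let A : M → Matrix (Fin (finrank ℝ F)) (Fin (finrank ℝ F)) ℝ :=
    fun y => Matrix.of fun i j => C.metric y (s i y) (s j y)
  have hA : ∀ y i j, ContMDiffAt I 𝓘(ℝ, ℝ) ∞ (fun y => A y i j) y :=
    fun y i j => (C.metric_smooth (s i) (s j)) y
  have hdet : (A x).det ≠ 0 := by
    have hd : Matrix.of (fun i j => (frameBasis I F E x).repr (C.dualFrame x i) j) * A x = 1 := by
      ext i j
      rw [Matrix.mul_apply, Matrix.one_apply]
      have := C.metric_dualFrame_left x i j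
      conv_lhs at this => rw [← (frameBasis I F E x).sum_repr (C.dualFrame x i)]
      simp only [map_sum, LinearMap.sum_apply, map_smul, LinearMap.smul_apply, smul_eq_mul] at this
      simp only [Matrix.of_apply, A, s, ← frameBasis_apply, this, eq_comm]
    intro h0
    have := congrArg Matrix.det hd
    rw [Matrix.det_mul, h0, mul_zero, Matrix.det_one] at this
    exact zero_ne_one this
  have hdet' : ∀ᶠ y in 𝓝 x, (A y).det ≠ 0 :=
    (contMDiffAt_matrix_det (hA x)).continuousAt.eventually_ne hdet
  have hu : ∀ i j, ∃ f : C^∞⟮I, M; 𝓘(ℝ, ℝ), ℝ⟯, ∀ᶠ y in 𝓝 x, f y = (A y)⁻¹ i j := fun i j =>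
    exists_smooth_extension (hdet'.mono fun y hy => contMDiffAt_matrix_inv (hA y) hy i j)
  choose f hf using hu
  refine ⟨s, fun i => ∑ j, smulSection (f i j) (s j), ?_⟩
  filter_upwards [hdet', Filter.eventually_all.2 fun i => Filter.eventually_all.2 (hf i)]
    with y hy hfy
  have ht : ∀ i, (∑ j, smulSection (f i j) (s j)) y = ∑ j, (A y)⁻¹ i j • s j y := by
    intro i; simp [hfy]
  have hAs : ∀ i j, A y i j = A y j i := fun i j => C.metric_comm y _ _
  have hiso : IsUnit (A y).det := isUnit_iff_ne_zero.2 hy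
  have hdual : ∀ i j, C.metric y (s i y) (∑ k, (A y)⁻¹ j k • s k y) = if i = j then 1 else 0 := by
    intro i j
    have := congrFun (congrFun (Matrix.nonsing_inv_mul (A y) hiso) j) i
    rw [Matrix.mul_apply, Matrix.one_apply] at this
    simp only [map_sum, map_smul, smul_eq_mul]
    simp only [eq_comm (a := i)]
    rw [← this]
    refine Finset.sum_congr rfl fun k _ => ?_
    rw [C.metric_comm]; rfl
  simp only [ht]
  have hli : LinearIndependent ℝ fun i => s i y := by
    rw [Fintype.linearIndependent_iff]
    intro c hc j
    have := congrArg (fun v => C.metric y v (∑ k, (A y)⁻¹ j k • s k y)) hc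
    simp only [map_sum (C.metric y), LinearMap.sum_apply, map_smul (C.metric y),
      LinearMap.smul_apply, hdual] at this
    simpa using this
  have hcard : Fintype.card (Fin (finrank ℝ F)) = finrank ℝ (E y) := by
    rw [finrank_eq_card_basis (frameBasis I F E y)]
  have hspan : ⊤ ≤ Submodule.span ℝ (Set.range fun i => s i y) := by
    have : FiniteDimensional ℝ (E y) := (frameBasis I F E y).finiteDimensional_of_finite
    exact (hli.span_eq_top_of_card_eq_finrank' hcard).ge
  set b := Basis.mk hli hspan
  have hb : ∀ i, b i = s i y := fun i => by simp [b]
  have h1 : ∀ v : E y, ∑ i, C.metric y v (∑ j, (A y)⁻¹ i j • s j y) • s i y = v := by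
    intro v
    conv_rhs => rw [← b.sum_repr v]
    refine Finset.sum_congr rfl fun i _ => ?_
    rw [hb]
    congr 1
    conv_lhs => rw [← b.sum_repr v]
    simp only [map_sum (C.metric y), LinearMap.sum_apply, map_smul (C.metric y),
      LinearMap.smul_apply, hb, hdual]
    simp
  refine ⟨h1, fun v => C.metric_ext fun u => ?_, hdual⟩
  conv_rhs => rw [← h1 u]
  simp only [map_sum, LinearMap.sum_apply, map_smul,
      LinearMap.smul_apply, smul_eq_mul]
  refine Finset.sum_congr rfl fun i _ => ?_
  refine (mul_comm _ _).trans (congrArg (· * _) (Finset.sum_congr rfl fun k _ => ?_))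
  exact congrArg (_ * ·) (C.metric_comm y _ _)

/-- A `C^∞`-linear functional with values at `x` only depends on the value of the section at `x`. -/
theorem tensorial (C : CourantAlgebroid I F E) {P : Type*} [AddCommGroup P] [Module ℝ P] {x : M} (L : Cₛ^∞⟮I; F, E⟯ →ₗ[ℝ] P)
    (hL : ∀ (f : C^∞⟮I, M; 𝓘(ℝ, ℝ), ℝ⟯) ψ, L (smulSection f ψ) = f x • L ψ)
    {ψ ψ' : Cₛ^∞⟮I; F, E⟯} (h : ψ x = ψ' x) : L ψ = L ψ' := by
  obtain ⟨s, t, hst⟩ := C.exists_dual_sections x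
  obtain ⟨χ, h1, h2, -, -⟩ := exists_cutoff I hst
  have hx := h2.self_of_nhds
  have key : ∀ ψ : Cₛ^∞⟮I; F, E⟯, L ψ = ∑ i, C.metric x (ψ x) (t i x) • L (s i) := by
    intro ψ
    have : smulSection χ ψ = smulSection χ
        (∑ i, smulSection ⟨fun y => C.metric y (ψ y) (t i y), C.metric_smooth _ _⟩ (s i)) := by
      ext y
      rw [smulSection_apply, smulSection_apply, section_sum_apply]
      by_cases hy : y ∈ tsupport χ
      · congr 1
        exact ((h1 hy).1 (ψ y)).symm
      · rw [image_eq_zero_of_notMem_tsupport hy, zero_smul, zero_smul]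
    have h3 := congrArg L this
    rw [hL, hL, hx, one_smul, one_smul, map_sum] at h3
    rw [h3]
    exact Finset.sum_congr rfl fun i _ => hL _ _
  rw [key, key, h]

end CourantAlgebroid
end

noncomputable section

/-! ## Smooth families of functions -/

section Derivative

variable {𝔼 : Type*} [NormedAddCommGroup 𝔼] [NormedSpace ℝ 𝔼] {𝔥 : Type*} [TopologicalSpace 𝔥]
  {J : ModelWithCorners ℝ 𝔼 𝔥} {N : Type*} [TopologicalSpace N] [ChartedSpace 𝔥 N]
  [IsManifold J ∞ N]
  {𝔽 : Type*} [NormedAddCommGroup 𝔽] [NormedSpace ℝ 𝔽] {𝔨 : Type*} [TopologicalSpace 𝔨]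
  {I : ModelWithCorners ℝ 𝔽 𝔨} {M : Type*} [TopologicalSpace M] [ChartedSpace 𝔨 M]
  [IsManifold I ∞ M]

/-- The derivative along a smooth vector field of a smooth family of functions is again a smooth
family. -/
theorem contMDiffAt_mvfderiv_family {u : N → M → ℝ} {g : N → M} {q : N}
    (hu : ContMDiffAt (J.prod I) 𝓘(ℝ, ℝ) ∞ (Function.uncurry u) (q, g q))
    (hg : ContMDiffAt J I ∞ g q) {X : ∀ x : M, TangentSpace I x}
    (hX : ContMDiffAt I (I.prod 𝓘(ℝ, 𝔽)) ∞ (fun x => TotalSpace.mk' 𝔽 x (X x)) (g q)) :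
    ContMDiffAt J 𝓘(ℝ, ℝ) ∞ (fun p => mvfderiv I (u p) (g p) (X (g p))) q := by
  have : IsManifold I 1 M := .of_le (n := ∞) (by simp)
  have : IsManifold J 1 N := .of_le (n := ∞) (by simp)
  have hX' := (contMDiffAt_section (g q)).1 hX
  have h := ContMDiffAt.mfderiv_apply (m := ∞) (n := ∞) (I := I) (I' := 𝓘(ℝ, ℝ)) (J' := J) (J := J)
    u g id
    (fun p => (trivializationAt 𝔽 (TangentSpace I) (g q) ⟨g p, X (g p)⟩).2) hu hg contMDiffAt_id
    (hX'.comp q hg) (by simp)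
  refine h.congr_of_eventuallyEq ?_
  have hs : ∀ᶠ p in 𝓝 q, g p ∈ (chartAt 𝔨 (g q)).source :=
    hg.continuousAt.eventually ((chartAt 𝔨 (g q)).open_source.mem_nhds (mem_chart_source _ _))
  filter_upwards [hs] with p hp
  simp only [id]
  have hcc : (tangentBundleCore I M).coordChange (achart 𝔨 (g q)) (achart 𝔨 (g p)) (g p)
      ((trivializationAt 𝔽 (TangentSpace I) (g q) ⟨g p, X (g p)⟩).2) = X (g p) := by
    have h1 : (trivializationAt 𝔽 (TangentSpace I) (g q) ⟨g p, X (g p)⟩).2 =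
      (tangentBundleCore I M).coordChange (achart 𝔨 (g p)) (achart 𝔨 (g q)) (g p) (X (g p)) := rfl
    refine (congrArg _ h1).trans (((tangentBundleCore I M).coordChange_comp _ _ _ (g p) ?_ _).trans
      ((tangentBundleCore I M).coordChange_self _ (g p) (by simp) _))
    exact ⟨⟨by simp, by simpa using hp⟩, by simp⟩
  have h3 := inTangentCoordinates_eq (I := I) (I' := 𝓘(ℝ, ℝ)) g (fun x => u x (g x))
    (fun x => mfderiv I 𝓘(ℝ, ℝ) (u x) (g x)) hp (x₀ := q) (x := p) (Set.mem_univ _)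
  refine Eq.symm ((congrArg (fun L : 𝔽 →L[ℝ] ℝ =>
    L (trivializationAt 𝔽 (TangentSpace I) (g q) ⟨g p, X (g p)⟩).2) h3).trans ?_)
  refine (congrArg (fun w => (tangentBundleCore 𝓘(ℝ, ℝ) ℝ).coordChange (achart ℝ (u p (g p)))
    (achart ℝ (u q (g q))) (u p (g p)) (mfderiv I 𝓘(ℝ, ℝ) (u p) (g p) w)) hcc).trans ?_
  exact congrArg (fun L : ℝ →L[ℝ] ℝ => L (mfderiv I 𝓘(ℝ, ℝ) (u p) (g p) (X (g p))))
    (tangentBundleCore_coordChange_model_space _ _ _)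

end Derivative

section Family

variable {n : ℕ} {H : Type*} [TopologicalSpace H]
  (I : ModelWithCorners ℝ (EuclideanSpace ℝ (Fin n)) H)
  {M : Type*} [TopologicalSpace M] [ChartedSpace H M]

/-- A smooth one-parameter family of functions on `M`. -/
def SmoothFamily (u : ℝ → M → ℝ) : Prop :=
  ContMDiff (𝓘(ℝ, ℝ).prod I) 𝓘(ℝ, ℝ) ∞ (fun p : ℝ × M => u p.1 p.2)

variable {I}

namespace SmoothFamily

variable {u v : ℝ → M → ℝ}

theorem congr (hu : SmoothFamily I u) (h : ∀ t x, v t x = u t x) : SmoothFamily I v := by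
  have : v = u := by ext t x; exact h t x
  rwa [this]

theorem add (hu : SmoothFamily I u) (hv : SmoothFamily I v) :
    SmoothFamily I fun t x => u t x + v t x := ContMDiff.add hu hv

theorem sub (hu : SmoothFamily I u) (hv : SmoothFamily I v) :
    SmoothFamily I fun t x => u t x - v t x := ContMDiff.sub hu hv

theorem neg (hu : SmoothFamily I u) : SmoothFamily I fun t x => -u t x := ContMDiff.neg hu

theorem mul (hu : SmoothFamily I u) (hv : SmoothFamily I v) :
    SmoothFamily I fun t x => u t x * v t x := ContMDiff.mul hu hv

theorem const (c : ℝ) : SmoothFamily I (fun _ (_ : M) => c) := contMDiff_const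

theorem const_mul (c : ℝ) (hu : SmoothFamily I u) : SmoothFamily I fun t x => c * u t x :=
  (const c).mul hu

theorem sum {ι : Type*} {s : Finset ι} {w : ι → ℝ → M → ℝ} (hw : ∀ i ∈ s, SmoothFamily I (w i)) :
    SmoothFamily I fun t x => ∑ i ∈ s, w i t x :=
  ContMDiff.sum hw

theorem of_function {f : M → ℝ} (hf : ContMDiff I 𝓘(ℝ, ℝ) ∞ f) : SmoothFamily I fun _ x => f x :=
  hf.comp contMDiff_snd

theorem of_param {f : ℝ → ℝ} (hf : ContDiff ℝ ∞ f) : SmoothFamily I fun t (_ : M) => f t :=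
  hf.contMDiff.comp contMDiff_fst

theorem slice (hu : SmoothFamily I u) (t : ℝ) : ContMDiff I 𝓘(ℝ, ℝ) ∞ (u t) :=
  ContMDiff.comp (I' := 𝓘(ℝ, ℝ).prod I) (g := fun p : ℝ × M => u p.1 p.2) hu (contMDiff_const.prodMk contMDiff_id)

theorem of_eventually (h : ∀ t x, ∃ w : ℝ → M → ℝ,
      ContMDiffAt (𝓘(ℝ, ℝ).prod I) 𝓘(ℝ, ℝ) ∞ (fun p : ℝ × M => w p.1 p.2) (t, x) ∧
      ∀ᶠ y in 𝓝 x, ∀ s, u s y = w s y) : SmoothFamily I u := by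
  rintro ⟨t, x⟩
  obtain ⟨w, hw, h⟩ := h t x
  refine hw.congr_of_eventuallyEq ?_
  have : ∀ᶠ p : ℝ × M in 𝓝 (t, x), ∀ s, u s p.2 = w s p.2 :=
    (continuous_snd.tendsto (t, x)).eventually h
  filter_upwards [this] with p hp using hp p.1

theorem of_local (h : ∀ x, ∃ w : ℝ → M → ℝ, SmoothFamily I w ∧ ∀ᶠ y in 𝓝 x, ∀ s, u s y = w s y) :
    SmoothFamily I u :=
  of_eventually fun t x => by
    obtain ⟨w, hw, h⟩ := h x
    exact ⟨w, hw (t, x), h⟩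

theorem continuous (hu : SmoothFamily I u) : Continuous fun p : ℝ × M => u p.1 p.2 :=
  ContMDiff.continuous hu

theorem contDiff_param (hu : SmoothFamily I u) (x : M) : ContDiff ℝ ∞ fun t => u t x := by
  rw [← contMDiff_iff_contDiff]
  exact ContMDiff.comp (I' := 𝓘(ℝ, ℝ).prod I) (g := fun p : ℝ × M => u p.1 p.2) hu (contMDiff_id.prodMk contMDiff_const)

theorem hasDerivAt (hu : SmoothFamily I u) (t : ℝ) (x : M) :
    HasDerivAt (fun s => u s x) (deriv (fun s => u s x) t) t :=
  ((hu.contDiff_param x).differentiable (by simp) t).hasDerivAt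

variable [IsManifold I ∞ M]

theorem deriv_param (hu : SmoothFamily I u) :
    SmoothFamily I fun t x => deriv (fun s => u s x) t := by
  intro q
  have h1 : ContMDiffAt ((𝓘(ℝ, ℝ).prod I).prod 𝓘(ℝ, ℝ)) 𝓘(ℝ, ℝ) ∞
      (Function.uncurry fun (p : ℝ × M) (s : ℝ) => u s p.2) (q, q.1) :=
    ContMDiff.contMDiffAt (ContMDiff.comp (I' := 𝓘(ℝ, ℝ).prod I) (g := fun p : ℝ × M => u p.1 p.2) hu
      (contMDiff_snd.prodMk (contMDiff_snd.comp contMDiff_fst)))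
  have h2 := contMDiffAt_mvfderiv_family (I := 𝓘(ℝ, ℝ)) (q := q) (g := Prod.fst)
    (X := fun _ => (1 : ℝ)) h1 contMDiffAt_fst (contMDiffAt_vectorSpace_iff_contDiffAt.2 contDiffAt_const)
  refine h2.congr_of_eventuallyEq (Filter.Eventually.of_forall fun p => ?_)
  change deriv (fun s => u s p.2) p.1 = mvfderiv 𝓘(ℝ, ℝ) (fun s => u s p.2) p.1 1
  simp [mvfderiv, mfderiv_eq_fderiv]
  rfl

theorem deriv_field (hu : SmoothFamily I u) (X : SmoothVectorField I M) :
    SmoothFamily I fun t x => mvfderiv I (u t) x (X x) := by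
  intro q
  have h1 : ContMDiffAt ((𝓘(ℝ, ℝ).prod I).prod I) 𝓘(ℝ, ℝ) ∞
      (Function.uncurry fun (p : ℝ × M) (y : M) => u p.1 y) (q, q.2) :=
    ContMDiff.contMDiffAt (ContMDiff.comp (I' := 𝓘(ℝ, ℝ).prod I) (g := fun p : ℝ × M => u p.1 p.2) hu
      ((contMDiff_fst.comp contMDiff_fst).prodMk contMDiff_snd))
  exact contMDiffAt_mvfderiv_family (q := q) (g := Prod.snd) h1 contMDiffAt_snd (X.contMDiff _)

end SmoothFamily

end Family
end

noncomputable section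

namespace CourantAlgebroid

variable {n : ℕ} {H : Type*} [TopologicalSpace H]
  {I : ModelWithCorners ℝ (EuclideanSpace ℝ (Fin n)) H}
  {M : Type*} [TopologicalSpace M] [ChartedSpace H M] [IsManifold I ∞ M]
  {F : Type*} [NormedAddCommGroup F] [NormedSpace ℝ F]
  {E : M → Type*} [TopologicalSpace (TotalSpace F E)] [∀ x, TopologicalSpace (E x)]
  [∀ x, AddCommGroup (E x)] [∀ x, Module ℝ (E x)] [FiberBundle F E] [VectorBundle ℝ F E]
  [T2Space M] [FiniteDimensional ℝ F] [ContMDiffVectorBundle ∞ F E I]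

variable (C : CourantAlgebroid I F E)

/-! ## Derivatives along the anchor -/

/-- The derivative `ρ(ψ) f` at `x`. -/
def der (ψ : Cₛ^∞⟮I; F, E⟯) (f : M → ℝ) (x : M) : ℝ := mvfderiv I f x (C.anchor x (ψ x))

variable {f g : M → ℝ} {x : M} (ψ : Cₛ^∞⟮I; F, E⟯)

theorem mdiff {f : M → ℝ} (hf : ContMDiff I 𝓘(ℝ, ℝ) ∞ f) : MDifferentiableAt I 𝓘(ℝ, ℝ) f x :=
  (hf x).mdifferentiableAt (by simp)

theorem der_contMDiff (hf : ContMDiff I 𝓘(ℝ, ℝ) ∞ f) : ContMDiff I 𝓘(ℝ, ℝ) ∞ (C.der ψ f) :=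
  ((SmoothFamily.of_function hf).deriv_field (C.anchorField ψ)).slice 0

theorem der_family {u : ℝ → M → ℝ} (hu : SmoothFamily I u) :
    SmoothFamily I fun t => C.der ψ (u t) :=
  hu.deriv_field (C.anchorField ψ)

theorem der_add (hf : ContMDiff I 𝓘(ℝ, ℝ) ∞ f) (hg : ContMDiff I 𝓘(ℝ, ℝ) ∞ g) :
    C.der ψ (fun y => f y + g y) x = C.der ψ f x + C.der ψ g x := by
  have := mvfderiv_add (mdiff (x := x) hf) (mdiff hg)
  exact congrArg (fun L => L (C.anchor x (ψ x))) this

theorem der_sub (hf : ContMDiff I 𝓘(ℝ, ℝ) ∞ f) (hg : ContMDiff I 𝓘(ℝ, ℝ) ∞ g) :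
    C.der ψ (fun y => f y - g y) x = C.der ψ f x - C.der ψ g x := by
  have := mvfderiv_sub (mdiff (x := x) hf) (mdiff hg)
  exact congrArg (fun L => L (C.anchor x (ψ x))) this

theorem der_mul (hf : ContMDiff I 𝓘(ℝ, ℝ) ∞ f) (hg : ContMDiff I 𝓘(ℝ, ℝ) ∞ g) :
    C.der ψ (fun y => f y * g y) x = f x * C.der ψ g x + g x * C.der ψ f x := by
  have := mvfderiv_mul (mdiff (x := x) hf) (mdiff hg)
  exact congrArg (fun L => L (C.anchor x (ψ x))) this

theorem der_const (c : ℝ) : C.der ψ (fun _ => c) x = 0 := by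
  have := mvfderiv_const (I := I) c (x := x)
  exact congrArg (fun L => L (C.anchor x (ψ x))) this

theorem der_const_mul (c : ℝ) (hf : ContMDiff I 𝓘(ℝ, ℝ) ∞ f) :
    C.der ψ (fun y => c * f y) x = c * C.der ψ f x := by
  rw [der_mul C ψ contMDiff_const hf, der_const, mul_zero, add_zero]

theorem der_sum {ι : Type*} {s : Finset ι} {f : ι → M → ℝ}
    (hf : ∀ i ∈ s, ContMDiff I 𝓘(ℝ, ℝ) ∞ (f i)) :
    C.der ψ (fun y => ∑ i ∈ s, f i y) x = ∑ i ∈ s, C.der ψ (f i) x := by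
  classical
  induction s using Finset.induction_on with
  | empty => simpa using C.der_const ψ 0
  | insert a s ha ih =>
    simp only [Finset.sum_insert ha]
    rw [der_add C ψ (hf a (by simp)) (ContMDiff.sum fun i hi => hf i (by simp [hi])),
      ih fun i hi => hf i (by simp [hi])]

theorem der_congr (h : f =ᶠ[𝓝 x] g) : C.der ψ f x = C.der ψ g x := by
  have : mvfderiv I f x = mvfderiv I g x := by
    ext v
    change mfderiv I 𝓘(ℝ, ℝ) f x v = mfderiv I 𝓘(ℝ, ℝ) g x v
    rw [h.mfderiv_eq]
    rfl
  exact congrArg (fun L => L (C.anchor x (ψ x))) this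

theorem der_add_left (ψ ψ' : Cₛ^∞⟮I; F, E⟯) (f : M → ℝ) :
    C.der (ψ + ψ') f x = C.der ψ f x + C.der ψ' f x := by
  simp [der]

theorem der_smul_left (c : ℝ) (ψ : Cₛ^∞⟮I; F, E⟯) (f : M → ℝ) :
    C.der (c • ψ) f x = c * C.der ψ f x := by
  simp [der]

theorem der_congr_left {ψ ψ' : Cₛ^∞⟮I; F, E⟯} (h : ψ x = ψ' x) (f : M → ℝ) :
    C.der ψ f x = C.der ψ' f x := by
  simp [der, h]

/-! ## Smooth families of vectors -/

/-- A family of (set-theoretic) sections whose pairings with smooth sections are smooth. -/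
def WeakSmooth (w : ℝ → ∀ x, E x) : Prop :=
  ∀ s : Cₛ^∞⟮I; F, E⟯, SmoothFamily I fun t x => C.metric x (w t x) (s x)

theorem weakSmooth_section (ψ : Cₛ^∞⟮I; F, E⟯) : C.WeakSmooth fun _ x => ψ x :=
  fun s => .of_function (C.metric_smooth ψ s)

variable {C}

theorem WeakSmooth.pair {L : ℝ → ∀ x, E x →ₗ[ℝ] ℝ} {w : ℝ → ∀ x, E x}
    (hw : C.WeakSmooth w)
    (hL : ∀ s : Cₛ^∞⟮I; F, E⟯, SmoothFamily I fun t x => L t x (s x)) :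
    SmoothFamily I fun t x => L t x (w t x) := by
  refine SmoothFamily.of_local fun x => ?_
  obtain ⟨s, t, hst⟩ := C.exists_dual_sections x
  refine ⟨_, SmoothFamily.sum (s := Finset.univ) fun i _ => (hw (t i)).mul (hL (s i)), ?_⟩
  filter_upwards [hst] with y hy r
  conv_lhs => rw [← hy.1 (w r y)]
  rw [map_sum]
  simp

theorem WeakSmooth.metric {w w' : ℝ → ∀ x, E x} (hw : C.WeakSmooth w) (hw' : C.WeakSmooth w') :
    SmoothFamily I fun t x => C.metric x (w t x) (w' t x) :=
  hw'.pair (L := fun t x => C.metric x (w t x)) hw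

theorem WeakSmooth.add {w w' : ℝ → ∀ x, E x} (hw : C.WeakSmooth w) (hw' : C.WeakSmooth w') :
    C.WeakSmooth fun t x => w t x + w' t x :=
  fun s => ((hw s).add (hw' s)).congr fun t x => by simp

theorem WeakSmooth.sub {w w' : ℝ → ∀ x, E x} (hw : C.WeakSmooth w) (hw' : C.WeakSmooth w') :
    C.WeakSmooth fun t x => w t x - w' t x :=
  fun s => ((hw s).sub (hw' s)).congr fun t x => by simp

theorem WeakSmooth.smul {u : ℝ → M → ℝ} {w : ℝ → ∀ x, E x} (hu : SmoothFamily I u)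
    (hw : C.WeakSmooth w) : C.WeakSmooth fun t x => u t x • w t x :=
  fun s => (hu.mul (hw s)).congr fun t x => by simp

/-- Smoothness of a family of endomorphisms. -/
theorem WeakSmooth.endo {T : ℝ → ∀ x, E x →ₗ[ℝ] E x} {w : ℝ → ∀ x, E x} (hw : C.WeakSmooth w)
    (hT : ∀ s : Cₛ^∞⟮I; F, E⟯, C.WeakSmooth fun t x => T t x (s x)) :
    C.WeakSmooth fun t x => T t x (w t x) := fun s =>
  hw.pair (L := fun t x => ((C.metric x).flip (s x)) ∘ₗ T t x) fun s' => hT s' s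

variable (C)

theorem smoothFamily_tr {B : ℝ → ∀ x, E x →ₗ[ℝ] E x →ₗ[ℝ] ℝ}
    (hB : ∀ s s' : Cₛ^∞⟮I; F, E⟯, SmoothFamily I fun t x => B t x (s x) (s' x)) :
    SmoothFamily I fun t x => C.tr x (B t x) := by
  refine SmoothFamily.of_local fun x => ?_
  obtain ⟨s, t, hst⟩ := C.exists_dual_sections x
  refine ⟨_, SmoothFamily.sum (s := Finset.univ) fun i _ => hB (s i) (t i), ?_⟩
  filter_upwards [hst] with y hy r
  exact C.tr_eq_sum hy.1 _

theorem contMDiff_tr {B : ∀ x, E x →ₗ[ℝ] E x →ₗ[ℝ] ℝ}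
    (hB : ∀ s s' : Cₛ^∞⟮I; F, E⟯, ContMDiff I 𝓘(ℝ, ℝ) ∞ fun x => B x (s x) (s' x)) :
    ContMDiff I 𝓘(ℝ, ℝ) ∞ fun x => C.tr x (B x) :=
  (C.smoothFamily_tr (B := fun _ => B) fun s s' => .of_function (hB s s')).slice 0

/-- A section whose pairings with smooth sections are smooth is smooth. -/
def mkSection (w : ∀ x, E x)
    (hw : ∀ s : Cₛ^∞⟮I; F, E⟯, ContMDiff I 𝓘(ℝ, ℝ) ∞ fun x => C.metric x (w x) (s x)) :
    Cₛ^∞⟮I; F, E⟯ where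
  toFun := w
  contMDiff_toFun := by
    intro x
    obtain ⟨s, t, hst⟩ := C.exists_dual_sections x
    let φ : Cₛ^∞⟮I; F, E⟯ := ∑ i, smulSection ⟨_, hw (t i)⟩ (s i)
    refine (φ.contMDiff x).congr_of_eventuallyEq ?_
    filter_upwards [hst] with y hy
    congr 1
    conv_lhs => rw [← hy.1 (w y)]
    rw [section_sum_apply]
    rfl

@[simp] theorem mkSection_apply (w : ∀ x, E x)
    (hw : ∀ s : Cₛ^∞⟮I; F, E⟯, ContMDiff I 𝓘(ℝ, ℝ) ∞ fun x => C.metric x (w x) (s x)) (x : M) :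
    C.mkSection w hw x = w x := rfl

/-- The vector representing a linear form. -/
def sharp (x : M) (ℓ : E x →ₗ[ℝ] ℝ) : E x := ∑ i, ℓ (frameBasis I F E x i) • C.dualFrame x i

theorem metric_sharp (x : M) (ℓ : E x →ₗ[ℝ] ℝ) (v : E x) : C.metric x (C.sharp x ℓ) v = ℓ v := by
  conv_rhs => rw [← C.sum_dualFrame_frame x v]
  simp only [sharp, map_sum, LinearMap.sum_apply, map_smul, LinearMap.smul_apply, smul_eq_mul]
  refine Finset.sum_congr rfl fun i _ => ?_
  rw [C.metric_comm, mul_comm]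

/-! ## Trilinear forms -/

/-- Constructor for trilinear forms. -/
def mkTri {W : Type*} [AddCommGroup W] [Module ℝ W] (f : W → W → W → ℝ)
    (h1 : ∀ a a' b c, f (a + a') b c = f a b c + f a' b c)
    (h2 : ∀ (r : ℝ) a b c, f (r • a) b c = r * f a b c)
    (h3 : ∀ a b b' c, f a (b + b') c = f a b c + f a b' c)
    (h4 : ∀ (r : ℝ) a b c, f a (r • b) c = r * f a b c)
    (h5 : ∀ a b c c', f a b (c + c') = f a b c + f a b c')
    (h6 : ∀ (r : ℝ) a b c, f a b (r • c) = r * f a b c) : W →ₗ[ℝ] W →ₗ[ℝ] W →ₗ[ℝ] ℝ :=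
  LinearMap.mk₂ ℝ (fun a b => { toFun := f a b, map_add' := h5 a b, map_smul' := fun r c => h6 r a b c })
    (fun a a' b => by ext c; exact h1 a a' b c) (fun r a b => by ext c; exact h2 r a b c)
    (fun a b b' => by ext c; exact h3 a b b' c) (fun r a b => by ext c; exact h4 r a b c)

@[simp] theorem mkTri_apply {W : Type*} [AddCommGroup W] [Module ℝ W] (f : W → W → W → ℝ)
    (h1 h2 h3 h4 h5 h6) (a b c : W) : mkTri f h1 h2 h3 h4 h5 h6 a b c = f a b c := rfl

/-- A field of trilinear forms on the fibres. -/
abbrev TriForm (E : M → Type*) [∀ x, AddCommGroup (E x)] [∀ x, Module ℝ (E x)] :=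
  ∀ x, E x →ₗ[ℝ] E x →ₗ[ℝ] E x →ₗ[ℝ] ℝ

variable (I F) in
/-- Smoothness of a family of fields of trilinear forms. -/
def TriSmooth (k : ℝ → TriForm E) : Prop :=
  ∀ a b c : Cₛ^∞⟮I; F, E⟯, SmoothFamily I fun t x => k t x (a x) (b x) (c x)

variable {C}

theorem TriSmooth.apply {k : ℝ → TriForm E} (hk : TriSmooth I F k) {u v w : ℝ → ∀ x, E x}
    (hu : C.WeakSmooth u) (hv : C.WeakSmooth v) (hw : C.WeakSmooth w) :
    SmoothFamily I fun t x => k t x (u t x) (v t x) (w t x) := by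
  refine hw.pair (L := fun t x => k t x (u t x) (v t x)) fun c => ?_
  refine hv.pair (L := fun t x => (k t x (u t x)).flip (c x)) fun b => ?_
  exact hu.pair (L := fun t x => ((k t x).flip (b x)).flip (c x)) fun a => hk a b c

theorem TriSmooth.slice {k : ℝ → TriForm E} (hk : TriSmooth I F k) (t : ℝ)
    (a b c : Cₛ^∞⟮I; F, E⟯) : ContMDiff I 𝓘(ℝ, ℝ) ∞ fun x => k t x (a x) (b x) (c x) :=
  (hk a b c).slice t

end CourantAlgebroid
end

noncomputable section

namespace CourantAlgebroid

variable {n : ℕ} {H : Type*} [TopologicalSpace H]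
  {I : ModelWithCorners ℝ (EuclideanSpace ℝ (Fin n)) H}
  {M : Type*} [TopologicalSpace M] [ChartedSpace H M] [IsManifold I ∞ M]
  {F : Type*} [NormedAddCommGroup F] [NormedSpace ℝ F]
  {E : M → Type*} [TopologicalSpace (TotalSpace F E)] [∀ x, TopologicalSpace (E x)]
  [∀ x, AddCommGroup (E x)] [∀ x, Module ℝ (E x)] [FiberBundle F E] [VectorBundle ℝ F E]
  [T2Space M] [FiniteDimensional ℝ F] [ContMDiffVectorBundle ∞ F E I]

/-! ## The bracket and the anchor -/

section Bracket

variable (C : CourantAlgebroid I F E)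

/-- The function `ρ(ψ) f` as a bundled smooth function. -/
def derMap (ψ : Cₛ^∞⟮I; F, E⟯) (f : C^∞⟮I, M; 𝓘(ℝ, ℝ), ℝ⟯) : C^∞⟮I, M; 𝓘(ℝ, ℝ), ℝ⟯ :=
  ⟨C.der ψ f, C.der_contMDiff ψ f.contMDiff⟩

@[simp] theorem derMap_apply (ψ : Cₛ^∞⟮I; F, E⟯) (f : C^∞⟮I, M; 𝓘(ℝ, ℝ), ℝ⟯) (x : M) :
    C.derMap ψ f x = C.der ψ f x := rfl

theorem bracket_smulSection (f : C^∞⟮I, M; 𝓘(ℝ, ℝ), ℝ⟯) (ψ ψ' : Cₛ^∞⟮I; F, E⟯) :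
    C.bracket ψ (smulSection f ψ') =
      smulSection f (C.bracket ψ ψ') + smulSection (C.derMap ψ f) ψ' := by
  ext x
  exact C.bracket_smul f ψ ψ' x

theorem anchor_bracket (ψ ψ' : Cₛ^∞⟮I; F, E⟯) (f : C^∞⟮I, M; 𝓘(ℝ, ℝ), ℝ⟯) (x : M) :
    C.der (C.bracket ψ ψ') f x = C.der ψ (C.der ψ' f) x - C.der ψ' (C.der ψ f) x := by
  by_cases hE : ∀ v : E x, v = 0
  · simp [der, hE ((C.bracket ψ ψ') x), hE (ψ x), hE (ψ' x)]
  push Not at hE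
  obtain ⟨v, hv⟩ := hE
  set χ := ext (I := I) (F := F) x v
  have h1 := congrArg (fun s => s x) (C.jacobi ψ ψ' (smulSection f χ))
  have h2 := congrArg (fun s => s x) (C.jacobi ψ ψ' χ)
  have hf : ∀ φ φ' : Cₛ^∞⟮I; F, E⟯, C.der φ (C.derMap φ' f) x = C.der φ (C.der φ' f) x :=
    fun _ _ => rfl
  simp only [bracket_smulSection, map_add, section_add_apply, smulSection_apply, derMap_apply,
    hf] at h1 h2
  rw [h2] at h1
  have hχ : χ x = v := ext_apply x v
  rw [hχ] at h1
  have h3 : (C.der (C.bracket ψ ψ') f x - (C.der ψ (C.der ψ' f) x - C.der ψ' (C.der ψ f) x)) • v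
      = 0 := by
    rw [sub_smul, sub_smul]
    rw [← neg_eq_zero, ← sub_eq_zero.2 h1]
    module
  exact sub_eq_zero.1 ((smul_eq_zero.1 h3).resolve_right hv)

theorem bracket_symm (φ φ' χ : Cₛ^∞⟮I; F, E⟯) (x : M) :
    C.metric x ((C.bracket φ φ' + C.bracket φ' φ) x) (χ x) =
      C.der χ (fun y => C.metric y (φ y) (φ' y)) x := by
  have h := C.bracket_self (φ + φ') χ x
  have h1 := C.bracket_self φ χ x
  have h2 := C.bracket_self φ' χ x
  have h3 : C.der χ (fun y => C.metric y ((φ + φ') y) ((φ + φ') y)) x =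
      C.der χ (fun y => C.metric y (φ y) (φ y)) x + 2 * C.der χ (fun y => C.metric y (φ y) (φ' y)) x
        + C.der χ (fun y => C.metric y (φ' y) (φ' y)) x := by
    have hm : ContMDiff I 𝓘(ℝ, ℝ) ∞ fun y => 2 * C.metric y (φ y) (φ' y) :=
      contMDiff_const.mul (C.metric_smooth φ φ')
    have ha : ContMDiff I 𝓘(ℝ, ℝ) ∞ fun y =>
        C.metric y (φ y) (φ y) + 2 * C.metric y (φ y) (φ' y) := (C.metric_smooth φ φ).add hm
    rw [← der_const_mul C χ 2 (C.metric_smooth φ φ'), ← der_add C χ (C.metric_smooth φ φ) hm,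
      ← der_add C χ ha (C.metric_smooth φ' φ')]
    congr 1
    ext y
    simp only [section_add_apply, map_add, LinearMap.add_apply, C.metric_comm y (φ' y) (φ y)]
    ring
  change _ = 1 / 2 * C.der χ _ x at h
  change _ = 1 / 2 * C.der χ _ x at h1
  change _ = 1 / 2 * C.der χ _ x at h2
  rw [h3] at h
  simp only [map_add, section_add_apply, LinearMap.add_apply] at h ⊢
  linarith

end Bracket

/-! ## Tensoriality of the curvature -/

namespace Connection

variable {C : CourantAlgebroid I F E} (D : C.Connection)

theorem der_metric (ψ φ φ' : Cₛ^∞⟮I; F, E⟯) (x : M) :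
    C.der ψ (fun y => C.metric y (φ y) (φ' y)) x =
      C.metric x (D.cov ψ φ x) (φ' x) + C.metric x (φ x) (D.cov ψ φ' x) :=
  D.metric_compat ψ φ φ' x

theorem cov_smulSection (f : C^∞⟮I, M; 𝓘(ℝ, ℝ), ℝ⟯) (ψ ψ' : Cₛ^∞⟮I; F, E⟯) :
    D.cov ψ (smulSection f ψ') = smulSection f (D.cov ψ ψ') + smulSection (C.derMap ψ f) ψ' := by
  ext x
  exact D.smul_right f ψ ψ' x

theorem cov_congr_left {ψ ψ' : Cₛ^∞⟮I; F, E⟯} {x : M} (h : ψ x = ψ' x) (φ : Cₛ^∞⟮I; F, E⟯) :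
    D.cov ψ φ x = D.cov ψ' φ x :=
  C.tensorial ((evalAt I F x) ∘ₗ D.cov.flip φ) (fun f χ => by
    change D.cov (smulSection f χ) φ x = f x • D.cov χ φ x
    rw [D.smul_left]; rfl) h

theorem metric_vecK (ψ ψ' χ : Cₛ^∞⟮I; F, E⟯) (x : M) :
    C.metric x (D.vecK ψ ψ' x) (χ x) = C.metric x (D.cov χ ψ x) (ψ' x) := by
  have h1 : D.vecK ψ ψ' x = ∑ i, C.metric x (D.cov (frame I F E x i) ψ x) (ψ' x) •
      C.dualFrame x i := by
    simp only [vecK, mul_comm (gramInv I F C.metric x _ _), mul_smul, ← Finset.smul_sum]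
    refine Finset.sum_congr rfl fun i _ => ?_
    congr 1
    exact C.gramInv_metric_sum x LinearMap.id i
  have h2 : D.cov χ ψ x =
      ∑ i, C.metric x (χ x) (C.dualFrame x i) • D.cov (frame I F E x i) ψ x := by
    have : χ x = (∑ i, C.metric x (χ x) (C.dualFrame x i) • frame I F E x i) x := by
      rw [section_sum_apply]
      simp only [section_smul_apply, ← frameBasis_apply]
      exact (C.sum_dualFrame_frame x _).symm
    rw [D.cov_congr_left this ψ]
    simp
  rw [h1, h2]
  simp only [map_sum, LinearMap.sum_apply, map_smul, LinearMap.smul_apply, smul_eq_mul]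
  refine Finset.sum_congr rfl fun i _ => ?_
  rw [C.metric_comm x (C.dualFrame x i), mul_comm]

theorem vecK_add_right (ψ φ φ' : Cₛ^∞⟮I; F, E⟯) (x : M) :
    D.vecK ψ (φ + φ') x = D.vecK ψ φ x + D.vecK ψ φ' x := by
  simp only [vecK, section_add_apply, map_add, mul_add, add_smul, Finset.sum_add_distrib]

theorem vecK_smul_right (c : ℝ) (ψ φ : Cₛ^∞⟮I; F, E⟯) (x : M) :
    D.vecK ψ (c • φ) x = c • D.vecK ψ φ x := by
  simp only [vecK, section_smul_apply, map_smul, smul_eq_mul, Finset.smul_sum, smul_smul]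
  refine Finset.sum_congr rfl fun i _ => Finset.sum_congr rfl fun j _ => ?_
  congr 1; ring

theorem vecK_smulSection_right (f : C^∞⟮I, M; 𝓘(ℝ, ℝ), ℝ⟯) (ψ φ : Cₛ^∞⟮I; F, E⟯) (x : M) :
    D.vecK ψ (smulSection f φ) x = f x • D.vecK ψ φ x := by
  simp only [vecK, smulSection_apply, map_smul, smul_eq_mul, Finset.smul_sum, smul_smul]
  refine Finset.sum_congr rfl fun i _ => Finset.sum_congr rfl fun j _ => ?_
  congr 1; ring

theorem vecK_symm (φ φ' : Cₛ^∞⟮I; F, E⟯) (x : M) :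
    D.vecK φ φ' x + D.vecK φ' φ x = (C.bracket φ φ' + C.bracket φ' φ) x := by
  refine C.metric_ext fun u => ?_
  have h := C.bracket_symm φ φ' (ext (I := I) (F := F) x u) x
  rw [D.der_metric, ext_apply] at h
  have h1 := D.metric_vecK φ φ' (ext (I := I) (F := F) x u) x
  have h2 := D.metric_vecK φ' φ (ext (I := I) (F := F) x u) x
  rw [ext_apply] at h1 h2
  rw [map_add, LinearMap.add_apply, h, h1, h2, C.metric_comm x (φ x)]

theorem curvatureZero_eq (φ' φ ψ ψ' : Cₛ^∞⟮I; F, E⟯) (x : M) :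
    D.curvatureZero φ' φ ψ ψ' x = C.metric x (D.cov ψ (D.cov ψ' φ) x) (φ' x) -
      C.metric x (D.cov ψ' (D.cov ψ φ) x) (φ' x) -
      C.metric x (D.cov (C.bracket ψ ψ') φ x) (φ' x) := by
  simp [curvatureZero]

theorem curvatureZero_skew (φ' φ ψ ψ' : Cₛ^∞⟮I; F, E⟯) (x : M) :
    D.curvatureZero φ' φ ψ ψ' x = -D.curvatureZero φ φ' ψ ψ' x := by
  have key : ∀ ψ ψ' : Cₛ^∞⟮I; F, E⟯, C.der ψ (C.der ψ' fun y => C.metric y (φ y) (φ' y)) x =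
      C.metric x (D.cov ψ (D.cov ψ' φ) x) (φ' x) + C.metric x (D.cov ψ' φ x) (D.cov ψ φ' x) +
      (C.metric x (D.cov ψ φ x) (D.cov ψ' φ' x) + C.metric x (φ x) (D.cov ψ (D.cov ψ' φ') x)) := by
    intro ψ ψ'
    rw [funext (D.der_metric ψ' φ φ'), C.der_add ψ (C.metric_smooth _ _) (C.metric_smooth _ _),
      D.der_metric, D.der_metric]
  have h := C.anchor_bracket ψ ψ' ⟨fun y => C.metric y (φ y) (φ' y), C.metric_smooth φ φ'⟩ x
  change C.der _ (fun y => C.metric y (φ y) (φ' y)) x =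
    C.der ψ (C.der ψ' fun y => C.metric y (φ y) (φ' y)) x -
    C.der ψ' (C.der ψ fun y => C.metric y (φ y) (φ' y)) x at h
  rw [key, key, D.der_metric] at h
  rw [curvatureZero_eq, curvatureZero_eq]
  simp only [C.metric_comm x _ (φ x)]
  linarith

theorem curvature_swap (φ' φ ψ ψ' : Cₛ^∞⟮I; F, E⟯) (x : M) :
    D.curvature φ' φ ψ ψ' x = D.curvature ψ' ψ φ φ' x := by
  rw [curvature, curvature, C.metric_comm x (D.vecK ψ ψ' x)]
  ring

theorem curvature_skew (φ' φ ψ ψ' : Cₛ^∞⟮I; F, E⟯) (x : M) :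
    D.curvature φ' φ ψ ψ' x = -D.curvature φ φ' ψ ψ' x := by
  have h1 := D.curvatureZero_skew φ' φ ψ ψ' x
  have h2 : D.curvatureZero ψ' ψ φ φ' x + D.curvatureZero ψ' ψ φ' φ x =
      -C.metric x (D.cov (C.bracket φ φ' + C.bracket φ' φ) ψ x) (ψ' x) := by
    rw [curvatureZero_eq, curvatureZero_eq]
    simp only [map_add, LinearMap.add_apply, section_add_apply]
    ring
  have h3 := D.metric_vecK ψ ψ' (C.bracket φ φ' + C.bracket φ' φ) x
  rw [← D.vecK_symm φ φ' x, map_add] at h3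
  rw [curvature, curvature, h1]
  linarith

theorem curvature_skew_right (φ' φ ψ ψ' : Cₛ^∞⟮I; F, E⟯) (x : M) :
    D.curvature φ' φ ψ ψ' x = -D.curvature φ' φ ψ' ψ x := by
  rw [curvature_swap, curvature_skew, ← curvature_swap]

/-- The curvature as a linear map in its first argument. -/
def curvatureLin (φ ψ ψ' : Cₛ^∞⟮I; F, E⟯) (x : M) : Cₛ^∞⟮I; F, E⟯ →ₗ[ℝ] ℝ where
  toFun φ' := D.curvature φ' φ ψ ψ' x
  map_add' a b := by
    simp only [curvature, curvatureZero_eq, vecK_add_right, map_add, section_add_apply,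
      LinearMap.add_apply]
    ring
  map_smul' c a := by
    simp only [curvature, curvatureZero_eq, vecK_smul_right, map_smul, section_smul_apply,
      LinearMap.smul_apply, smul_eq_mul, RingHom.id_apply]
    ring

theorem curvature_smulSection (f : C^∞⟮I, M; 𝓘(ℝ, ℝ), ℝ⟯) (φ' φ ψ ψ' : Cₛ^∞⟮I; F, E⟯) (x : M) :
    D.curvature (smulSection f φ') φ ψ ψ' x = f x * D.curvature φ' φ ψ ψ' x := by
  simp only [curvature, curvatureZero_eq, vecK_smulSection_right, bracket_smulSection, map_add,
    LinearMap.add_apply, D.smul_left, cov_smulSection, section_add_apply, smulSection_apply,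
    map_smul, LinearMap.smul_apply, smul_eq_mul, derMap_apply]
  ring

theorem curvature_congr {φ' φ ψ ψ' φ₁' φ₁ ψ₁ ψ₁' : Cₛ^∞⟮I; F, E⟯} {x : M} (h1 : φ' x = φ₁' x)
    (h2 : φ x = φ₁ x) (h3 : ψ x = ψ₁ x) (h4 : ψ' x = ψ₁' x) :
    D.curvature φ' φ ψ ψ' x = D.curvature φ₁' φ₁ ψ₁ ψ₁' x := by
  have key : ∀ {a a' : Cₛ^∞⟮I; F, E⟯} (b c d), a x = a' x →
      D.curvature a b c d x = D.curvature a' b c d x := fun b c d h =>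
    C.tensorial (D.curvatureLin b c d x) (fun f a => D.curvature_smulSection f a b c d x) h
  rw [key _ _ _ h1, D.curvature_skew, key _ _ _ h2, ← D.curvature_skew, D.curvature_swap,
    key _ _ _ h4, D.curvature_skew, key _ _ _ h3, ← D.curvature_skew, ← D.curvature_swap]

/-- The bilinear form `(u, v) ↦ R(u, ψ, v, ψ')` at `x`. -/
def curvatureForm (ψ ψ' : Cₛ^∞⟮I; F, E⟯) (x : M) : E x →ₗ[ℝ] E x →ₗ[ℝ] ℝ :=
  LinearMap.mk₂ ℝ
    (fun u v => D.curvature (ext (I := I) (F := F) x u) ψ (ext (I := I) (F := F) x v) ψ' x)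
    (fun a b c => by rw [map_add]; exact map_add (D.curvatureLin _ _ _ x) _ _)
    (fun a b c => by rw [map_smul]; exact map_smul (D.curvatureLin _ _ _ x) _ _)
    (fun a b c => by
      simp only [D.curvature_swap (ext x a), D.curvature_skew ψ']
      rw [map_add]
      refine (congrArg Neg.neg (map_add (D.curvatureLin _ _ _ x) _ _)).trans ?_
      rw [neg_add]; rfl)
    (fun r a b => by
      simp only [D.curvature_swap (ext x a), D.curvature_skew ψ']
      rw [map_smul]
      refine (congrArg Neg.neg (map_smul (D.curvatureLin _ _ _ x) _ _)).trans ?_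
      rw [← smul_neg]; rfl)

theorem curvatureForm_apply (ψ ψ' φ φ' : Cₛ^∞⟮I; F, E⟯) (x : M) :
    D.curvatureForm ψ ψ' x (φ x) (φ' x) = D.curvature φ ψ φ' ψ' x :=
  D.curvature_congr (ext_apply _ _) rfl (ext_apply _ _) rfl

theorem ricci_eq_tr (ψ ψ' : Cₛ^∞⟮I; F, E⟯) (x : M) :
    D.ricci ψ ψ' x = C.tr x (D.curvatureForm ψ ψ' x) := by
  rw [ricci, tr]
  refine Finset.sum_congr rfl fun i _ => ?_
  rw [← C.gramInv_metric_sum]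
  refine Finset.sum_congr rfl fun j _ => ?_
  rw [frameBasis_apply, frameBasis_apply, curvatureForm_apply, smul_eq_mul]

theorem ricci_eq_sum {ι : Type*} [Fintype ι] {s t : ι → Cₛ^∞⟮I; F, E⟯} {x : M}
    (h : ∀ v, ∑ i, C.metric x v (t i x) • s i x = v) (ψ ψ' : Cₛ^∞⟮I; F, E⟯) :
    D.ricci ψ ψ' x = ∑ i, D.curvature (s i) ψ (t i) ψ' x := by
  rw [ricci_eq_tr, C.tr_eq_sum h]
  simp only [curvatureForm_apply]

theorem ricci_symm (ψ ψ' : Cₛ^∞⟮I; F, E⟯) (x : M) : D.ricci ψ ψ' x = D.ricci ψ' ψ x := by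
  rw [ricci_eq_tr, ricci_eq_tr, ← C.tr_flip]
  congr 1
  ext u v
  change D.curvature _ ψ _ ψ' x = D.curvature _ ψ' _ ψ x
  rw [curvature_swap, curvature_skew, curvature_skew_right, neg_neg]

theorem ricci_congr_left {ψ ψ₁ : Cₛ^∞⟮I; F, E⟯} {x : M} (h : ψ x = ψ₁ x) (ψ' : Cₛ^∞⟮I; F, E⟯) :
    D.ricci ψ ψ' x = D.ricci ψ₁ ψ' x := by
  simp only [ricci]
  refine Finset.sum_congr rfl fun i _ => Finset.sum_congr rfl fun j _ => ?_
  rw [D.curvature_congr rfl h rfl rfl]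

theorem ricci_add_left (ψ ψ₁ ψ' : Cₛ^∞⟮I; F, E⟯) (x : M) :
    D.ricci (ψ + ψ₁) ψ' x = D.ricci ψ ψ' x + D.ricci ψ₁ ψ' x := by
  simp only [ricci, D.curvature_skew _ (ψ + ψ₁), D.curvature_skew _ ψ, D.curvature_skew _ ψ₁]
  rw [← Finset.sum_add_distrib]
  refine Finset.sum_congr rfl fun i _ => ?_
  rw [← Finset.sum_add_distrib]
  refine Finset.sum_congr rfl fun j _ => ?_
  rw [← mul_add, ← neg_add]
  congr 2
  exact map_add (D.curvatureLin _ _ _ x) _ _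

theorem ricci_smul_left (c : ℝ) (ψ ψ' : Cₛ^∞⟮I; F, E⟯) (x : M) :
    D.ricci (c • ψ) ψ' x = c * D.ricci ψ ψ' x := by
  simp only [ricci, D.curvature_skew _ (c • ψ), D.curvature_skew _ ψ]
  rw [Finset.mul_sum]
  refine Finset.sum_congr rfl fun i _ => ?_
  rw [Finset.mul_sum]
  refine Finset.sum_congr rfl fun j _ => ?_
  have : D.curvature (c • ψ) (frame I F E x i) (frame I F E x j) ψ' x =
      c * D.curvature ψ (frame I F E x i) (frame I F E x j) ψ' x :=
    map_smul (D.curvatureLin _ _ _ x) _ _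
  rw [this]
  ring

/-- The Ricci tensor as a bilinear form on the fibres. -/
def ricciForm (x : M) : E x →ₗ[ℝ] E x →ₗ[ℝ] ℝ :=
  LinearMap.mk₂ ℝ
    (fun u v => D.ricci (ext (I := I) (F := F) x u) (ext (I := I) (F := F) x v) x)
    (fun a b c => by rw [map_add, ricci_add_left])
    (fun r a b => by rw [map_smul, ricci_smul_left]; rfl)
    (fun a b c => by simp only [D.ricci_symm (ext x a)]; rw [map_add, ricci_add_left])
    (fun r a b => by simp only [D.ricci_symm (ext x a)]; rw [map_smul, ricci_smul_left]; rfl)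

theorem ricciForm_apply (ψ ψ' : Cₛ^∞⟮I; F, E⟯) (x : M) :
    D.ricciForm x (ψ x) (ψ' x) = D.ricci ψ ψ' x := by
  change D.ricci _ _ x = _
  rw [D.ricci_congr_left (ext_apply _ _), D.ricci_symm, D.ricci_congr_left (ext_apply _ _),
    D.ricci_symm]

theorem ricciForm_symm (x : M) (u v : E x) : D.ricciForm x u v = D.ricciForm x v u :=
  D.ricci_symm _ _ x

/-- The divergence as a sum over an arbitrary pair of dual frames. -/
theorem divergence_eq_sum {ι : Type*} [Fintype ι] {s t : ι → Cₛ^∞⟮I; F, E⟯} {x : M}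
    (h : ∀ v, ∑ i, C.metric x v (t i x) • s i x = v) (ψ : Cₛ^∞⟮I; F, E⟯) :
    D.divergence ψ x = ∑ i, C.metric x (D.cov (s i) ψ x) (t i x) := by
  let B : E x →ₗ[ℝ] E x →ₗ[ℝ] ℝ :=
    (C.metric x) ∘ₗ (evalAt I F x) ∘ₗ (D.cov.flip ψ) ∘ₗ ext (I := I) (F := F) x
  have hB : ∀ (φ : Cₛ^∞⟮I; F, E⟯) v, B (φ x) v = C.metric x (D.cov φ ψ x) v := fun φ v => by
    change C.metric x (D.cov (ext x (φ x)) ψ x) v = _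
    rw [D.cov_congr_left (ext_apply x (φ x))]
  have h2 := C.tr_eq_sum h B
  simp only [hB] at h2
  rw [← h2, divergence, tr]
  refine Finset.sum_congr rfl fun i _ => ?_
  rw [C.coord_eq, frameBasis_apply, hB]

/-! ## Smoothness of the Ricci tensor -/

theorem contMDiff_metric_vecK (ψ ψ' φ φ' : Cₛ^∞⟮I; F, E⟯) :
    ContMDiff I 𝓘(ℝ, ℝ) ∞ fun x => C.metric x (D.vecK ψ ψ' x) (D.vecK φ φ' x) := by
  have h : ∀ ψ ψ' : Cₛ^∞⟮I; F, E⟯, C.WeakSmooth fun _ x => D.vecK ψ ψ' x := fun ψ ψ' s =>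
    .of_function (by simp only [metric_vecK]; exact C.metric_smooth _ _)
  exact ((h ψ ψ').metric (h φ φ')).slice 0

theorem contMDiff_curvature (φ' φ ψ ψ' : Cₛ^∞⟮I; F, E⟯) :
    ContMDiff I 𝓘(ℝ, ℝ) ∞ (D.curvature φ' φ ψ ψ') :=
  contMDiff_const.mul (((C.metric_smooth _ _).add (C.metric_smooth _ _)).add
    (D.contMDiff_metric_vecK _ _ _ _))

theorem contMDiff_ricci (ψ ψ' : Cₛ^∞⟮I; F, E⟯) : ContMDiff I 𝓘(ℝ, ℝ) ∞ (D.ricci ψ ψ') := by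
  rw [funext (D.ricci_eq_tr ψ ψ')]
  exact C.contMDiff_tr fun s s' => by
    simp only [curvatureForm_apply]; exact D.contMDiff_curvature _ _ _ _

end Connection

end CourantAlgebroid
end

noncomputable section

namespace CourantAlgebroid

variable {n : ℕ} {H : Type*} [TopologicalSpace H]
  {I : ModelWithCorners ℝ (EuclideanSpace ℝ (Fin n)) H}
  {M : Type*} [TopologicalSpace M] [ChartedSpace H M] [IsManifold I ∞ M]
  {F : Type*} [NormedAddCommGroup F] [NormedSpace ℝ F]
  {E : M → Type*} [TopologicalSpace (TotalSpace F E)] [∀ x, TopologicalSpace (E x)]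
  [∀ x, AddCommGroup (E x)] [∀ x, Module ℝ (E x)] [FiberBundle F E] [VectorBundle ℝ F E]
  [T2Space M] [FiniteDimensional ℝ F] [ContMDiffVectorBundle ∞ F E I]

/-! ## Covariant derivatives of bilinear and trilinear forms -/

variable (I F) in
/-- Smoothness of a field of trilinear forms. -/
def TriForm.Smooth (k : TriForm E) : Prop :=
  ∀ a b c : Cₛ^∞⟮I; F, E⟯, ContMDiff I 𝓘(ℝ, ℝ) ∞ fun x => k x (a x) (b x) (c x)

/-- The trilinear forms with the first two arguments exchanged. -/
def TriForm.swap₁₂ (k : TriForm E) : TriForm E := fun x => (k x).flip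

/-- The trilinear forms with the first and the last argument exchanged. -/
def TriForm.swap₁₃ (k : TriForm E) : TriForm E := fun x =>
  mkTri (fun a b c => k x c b a) (by simp) (by simp) (by simp) (by simp) (by simp) (by simp)

@[simp] theorem TriForm.swap₁₂_apply (k : TriForm E) (x : M) (a b c : E x) :
    k.swap₁₂ x a b c = k x b a c := rfl

@[simp] theorem TriForm.swap₁₃_apply (k : TriForm E) (x : M) (a b c : E x) :
    k.swap₁₃ x a b c = k x c b a := rfl

theorem TriForm.Smooth.swap₁₂ {k : TriForm E} (hk : k.Smooth I F) : k.swap₁₂.Smooth I F :=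
  fun a b c => hk b a c

theorem TriForm.Smooth.swap₁₃ {k : TriForm E} (hk : k.Smooth I F) : k.swap₁₃.Smooth I F :=
  fun a b c => hk c b a

variable {C : CourantAlgebroid I F E}

theorem sum_swap_self_adjoint {x : M} {T : E x →ₗ[ℝ] E x}
    (hT : ∀ u v, C.metric x (T u) v = C.metric x u (T v)) (B : E x →ₗ[ℝ] E x →ₗ[ℝ] ℝ) :
    ∑ i, B (T (C.dualFrame x i)) (frameBasis I F E x i) =
      ∑ i, B (frameBasis I F E x i) (T (C.dualFrame x i)) := by
  have h1 := C.tr_flip x (B ∘ₗ T)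
  have h2 : C.tr x (B ∘ₗ T) = ∑ i, B (frameBasis I F E x i) (T (C.dualFrame x i)) := by
    have e1 : ∀ i, B (T (frameBasis I F E x i)) (C.dualFrame x i) =
        ∑ j, C.metric x (T (frameBasis I F E x i)) (C.dualFrame x j) *
          B (frameBasis I F E x j) (C.dualFrame x i) := fun i => by
      conv_lhs => rw [← C.sum_dualFrame_frame x (T (frameBasis I F E x i))]
      simp only [map_sum, map_smul, LinearMap.sum_apply, LinearMap.smul_apply, smul_eq_mul]
    have e2 : ∀ j, B (frameBasis I F E x j) (T (C.dualFrame x j)) =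
        ∑ i, C.metric x (T (C.dualFrame x j)) (frameBasis I F E x i) *
          B (frameBasis I F E x j) (C.dualFrame x i) := fun i => by
      conv_lhs => rw [← C.sum_frame_dualFrame x (T (C.dualFrame x i))]
      simp only [map_sum, map_smul, smul_eq_mul]
    simp only [tr, LinearMap.comp_apply, e1, e2]
    rw [Finset.sum_comm]
    refine Finset.sum_congr rfl fun j _ => Finset.sum_congr rfl fun i _ => ?_
    rw [hT, C.metric_comm]
  rw [← h2, ← h1]
  rfl

theorem sum_swap (x : M) (B : E x →ₗ[ℝ] E x →ₗ[ℝ] ℝ) :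
    ∑ i, B (C.dualFrame x i) (frameBasis I F E x i) =
      ∑ i, B (frameBasis I F E x i) (C.dualFrame x i) :=
  sum_swap_self_adjoint (T := LinearMap.id) (fun _ _ => rfl) B

namespace Connection

variable (D : C.Connection)

/-- The covariant derivative of a field of bilinear forms. -/
def covBi (B : ∀ x, E x →ₗ[ℝ] E x →ₗ[ℝ] ℝ) (ψ a b : Cₛ^∞⟮I; F, E⟯) (x : M) : ℝ :=
  C.der ψ (fun y => B y (a y) (b y)) x - B x (D.cov ψ a x) (b x) - B x (a x) (D.cov ψ b x)

/-- The covariant derivative as a linear map in the first argument of the bilinear form. -/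
def covBiLin {B : ∀ x, E x →ₗ[ℝ] E x →ₗ[ℝ] ℝ}
    (hB : ∀ a b : Cₛ^∞⟮I; F, E⟯, ContMDiff I 𝓘(ℝ, ℝ) ∞ fun x => B x (a x) (b x))
    (ψ b : Cₛ^∞⟮I; F, E⟯) (x : M) : Cₛ^∞⟮I; F, E⟯ →ₗ[ℝ] ℝ where
  toFun a := D.covBi B ψ a b x
  map_add' a a' := by
    simp only [covBi, map_add, section_add_apply, LinearMap.add_apply,
      C.der_add ψ (hB a b) (hB a' b)]
    ring
  map_smul' r a := by
    simp only [covBi, map_smul, section_smul_apply, LinearMap.smul_apply, smul_eq_mul,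
      C.der_const_mul ψ r (hB a b), RingHom.id_apply]
    ring

theorem covBi_congr_left {B : ∀ x, E x →ₗ[ℝ] E x →ₗ[ℝ] ℝ}
    (hB : ∀ a b : Cₛ^∞⟮I; F, E⟯, ContMDiff I 𝓘(ℝ, ℝ) ∞ fun x => B x (a x) (b x))
    (ψ : Cₛ^∞⟮I; F, E⟯) {a a' : Cₛ^∞⟮I; F, E⟯} (b : Cₛ^∞⟮I; F, E⟯) {x : M} (h : a x = a' x) :
    D.covBi B ψ a b x = D.covBi B ψ a' b x :=
  C.tensorial (D.covBiLin hB ψ b x) (fun f a => by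
    change D.covBi B ψ (smulSection f a) b x = f x • D.covBi B ψ a b x
    simp only [covBi, cov_smulSection, smulSection_apply, section_add_apply, map_smul, map_add,
      LinearMap.smul_apply, LinearMap.add_apply, smul_eq_mul, derMap_apply,
      C.der_mul ψ f.contMDiff (hB a b)]
    ring) h

theorem covBi_flip (B : ∀ x, E x →ₗ[ℝ] E x →ₗ[ℝ] ℝ) (ψ a b : Cₛ^∞⟮I; F, E⟯) (x : M) :
    D.covBi (fun x => (B x).flip) ψ a b x = D.covBi B ψ b a x := by
  simp only [covBi, LinearMap.flip_apply]
  ring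

theorem covBi_congr {B : ∀ x, E x →ₗ[ℝ] E x →ₗ[ℝ] ℝ}
    (hB : ∀ a b : Cₛ^∞⟮I; F, E⟯, ContMDiff I 𝓘(ℝ, ℝ) ∞ fun x => B x (a x) (b x))
    (ψ : Cₛ^∞⟮I; F, E⟯) {a a' b b' : Cₛ^∞⟮I; F, E⟯} {x : M} (h : a x = a' x) (h' : b x = b' x) :
    D.covBi B ψ a b x = D.covBi B ψ a' b' x := by
  rw [D.covBi_congr_left hB ψ b h, ← covBi_flip, D.covBi_congr_left (fun a b => hB b a) ψ a' h',
    covBi_flip]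

/-- The covariant derivative of a bilinear form, as a bilinear form. -/
def covBiForm {B : ∀ x, E x →ₗ[ℝ] E x →ₗ[ℝ] ℝ}
    (hB : ∀ a b : Cₛ^∞⟮I; F, E⟯, ContMDiff I 𝓘(ℝ, ℝ) ∞ fun x => B x (a x) (b x))
    (ψ : Cₛ^∞⟮I; F, E⟯) (x : M) : E x →ₗ[ℝ] E x →ₗ[ℝ] ℝ :=
  LinearMap.mk₂ ℝ
    (fun u v => D.covBi B ψ (ext (I := I) (F := F) x u) (ext (I := I) (F := F) x v) x)
    (fun a b c => by rw [map_add]; exact map_add (D.covBiLin hB ψ _ x) _ _)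
    (fun a b c => by rw [map_smul]; exact map_smul (D.covBiLin hB ψ _ x) _ _)
    (fun a b c => by
      simp only [← D.covBi_flip B ψ _ (ext x a)]
      rw [map_add]; exact map_add (D.covBiLin (fun a b => hB b a) ψ _ x) _ _)
    (fun r a b => by
      simp only [← D.covBi_flip B ψ _ (ext x a)]
      rw [map_smul]; exact map_smul (D.covBiLin (fun a b => hB b a) ψ _ x) _ _)

/-- Taking traces commutes with covariant derivatives. -/
theorem der_tr {B : ∀ x, E x →ₗ[ℝ] E x →ₗ[ℝ] ℝ}
    (hB : ∀ a b : Cₛ^∞⟮I; F, E⟯, ContMDiff I 𝓘(ℝ, ℝ) ∞ fun x => B x (a x) (b x))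
    (ψ : Cₛ^∞⟮I; F, E⟯) (x : M) :
    C.der ψ (fun y => C.tr y (B y)) x =
      ∑ i, D.covBi B ψ (frame I F E x i) (ext x (C.dualFrame x i)) x := by
  have h1 : ∑ i, D.covBi B ψ (frame I F E x i) (ext x (C.dualFrame x i)) x =
      C.tr x (D.covBiForm hB ψ x) := by
    rw [tr]
    refine Finset.sum_congr rfl fun i _ => ?_
    rw [← ext_frameBasis]
    rfl
  obtain ⟨s, t, hst⟩ := C.exists_dual_sections x
  have hx := hst.self_of_nhds
  have h2 : C.der ψ (fun y => C.tr y (B y)) x = ∑ i, C.der ψ (fun y => B y (s i y) (t i y)) x := by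
    rw [← C.der_sum ψ fun i _ => hB (s i) (t i)]
    refine C.der_congr ψ ?_
    filter_upwards [hst] with y hy using C.tr_eq_sum hy.1 _
  have h3 : ∀ i, D.covBiForm hB ψ x (s i x) (t i x) = D.covBi B ψ (s i) (t i) x := fun i =>
    D.covBi_congr hB ψ (ext_apply _ _) (ext_apply _ _)
  rw [h1, h2, C.tr_eq_sum hx.1]
  simp only [h3, covBi, sub_sub]
  rw [Finset.sum_sub_distrib, eq_comm, sub_eq_self, Finset.sum_add_distrib]
  have e1 : ∀ i, B x (D.cov ψ (s i) x) (t i x) =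
      ∑ j, C.metric x (D.cov ψ (s i) x) (t j x) * B x (s j x) (t i x) := fun i => by
    conv_lhs => rw [← hx.1 (D.cov ψ (s i) x)]
    simp only [map_sum, map_smul, LinearMap.sum_apply, LinearMap.smul_apply, smul_eq_mul]
  have e2 : ∀ i, B x (s i x) (D.cov ψ (t i) x) =
      ∑ j, C.metric x (D.cov ψ (t i) x) (s j x) * B x (s i x) (t j x) := fun i => by
    conv_lhs => rw [← hx.2.1 (D.cov ψ (t i) x)]
    simp only [map_sum, map_smul, smul_eq_mul]
  simp only [e1, e2]
  rw [Finset.sum_comm, ← Finset.sum_add_distrib]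
  refine Finset.sum_eq_zero fun i _ => ?_
  rw [← Finset.sum_add_distrib]
  refine Finset.sum_eq_zero fun j _ => ?_
  rw [← add_mul]
  have h4 := D.der_metric ψ (s j) (t i) x
  have h5 : C.der ψ (fun y => C.metric y (s j y) (t i y)) x = 0 := by
    rw [← C.der_const ψ (if j = i then 1 else 0) (x := x)]
    refine C.der_congr ψ ?_
    filter_upwards [hst] with y hy using hy.2.2 j i
  rw [C.metric_comm x (D.cov ψ (t i) x), ← h4, h5, zero_mul]

/-- The covariant derivative of a field of trilinear forms. -/
def covTri (k : TriForm E) (ψ a b c : Cₛ^∞⟮I; F, E⟯) (x : M) : ℝ :=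
  C.der ψ (fun y => k y (a y) (b y) (c y)) x - k x (D.cov ψ a x) (b x) (c x) -
    k x (a x) (D.cov ψ b x) (c x) - k x (a x) (b x) (D.cov ψ c x)

theorem covTri_swap₁₂ (k : TriForm E) (ψ a b c : Cₛ^∞⟮I; F, E⟯) (x : M) :
    D.covTri k.swap₁₂ ψ a b c x = D.covTri k ψ b a c x := by
  simp only [covTri, TriForm.swap₁₂_apply]
  ring

theorem covTri_swap₁₃ (k : TriForm E) (ψ a b c : Cₛ^∞⟮I; F, E⟯) (x : M) :
    D.covTri k.swap₁₃ ψ a b c x = D.covTri k ψ c b a x := by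
  simp only [covTri, TriForm.swap₁₃_apply]
  ring

section

variable {k : TriForm E} (hk : k.Smooth I F)
include hk

theorem covTri_add (ψ a a' b c : Cₛ^∞⟮I; F, E⟯) (x : M) :
    D.covTri k ψ (a + a') b c x = D.covTri k ψ a b c x + D.covTri k ψ a' b c x := by
  simp only [covTri, map_add, section_add_apply, LinearMap.add_apply,
    C.der_add ψ (hk a b c) (hk a' b c)]
  ring

theorem covTri_smul (r : ℝ) (ψ a b c : Cₛ^∞⟮I; F, E⟯) (x : M) :
    D.covTri k ψ (r • a) b c x = r * D.covTri k ψ a b c x := by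
  simp only [covTri, map_smul, section_smul_apply, LinearMap.smul_apply, smul_eq_mul,
    C.der_const_mul ψ r (hk a b c)]
  ring

theorem covTri_congr_first (ψ : Cₛ^∞⟮I; F, E⟯) {a a' : Cₛ^∞⟮I; F, E⟯} (b c : Cₛ^∞⟮I; F, E⟯) {x : M}
    (h : a x = a' x) : D.covTri k ψ a b c x = D.covTri k ψ a' b c x := by
  let L : Cₛ^∞⟮I; F, E⟯ →ₗ[ℝ] ℝ :=
    { toFun := fun a => D.covTri k ψ a b c x
      map_add' := fun a a' => D.covTri_add hk ψ a a' b c x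
      map_smul' := fun r a => D.covTri_smul hk r ψ a b c x }
  refine C.tensorial L (fun f a => ?_) h
  change D.covTri k ψ (smulSection f a) b c x = f x • D.covTri k ψ a b c x
  simp only [covTri, cov_smulSection, smulSection_apply, section_add_apply, map_smul, map_add,
    LinearMap.smul_apply, LinearMap.add_apply, smul_eq_mul, derMap_apply,
    C.der_mul ψ f.contMDiff (hk a b c)]
  ring

theorem covTri_congr {ψ ψ' a a' b b' c c' : Cₛ^∞⟮I; F, E⟯} {x : M} (h0 : ψ x = ψ' x)
    (h1 : a x = a' x) (h2 : b x = b' x) (h3 : c x = c' x) :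
    D.covTri k ψ a b c x = D.covTri k ψ' a' b' c' x := by
  rw [D.covTri_congr_first hk ψ b c h1, ← covTri_swap₁₂, D.covTri_congr_first hk.swap₁₂ ψ a' c h2,
    covTri_swap₁₂, ← covTri_swap₁₃, D.covTri_congr_first hk.swap₁₃ ψ b' a' h3, covTri_swap₁₃]
  simp only [covTri, D.cov_congr_left h0, C.der_congr_left h0]

end

/-- The covariant derivative of a field of trilinear forms, as a quadrilinear form. -/
def covTriForm {k : TriForm E} (hk : k.Smooth I F) (x : M) :
    E x →ₗ[ℝ] E x →ₗ[ℝ] E x →ₗ[ℝ] E x →ₗ[ℝ] ℝ where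
  toFun u := mkTri (fun a b c => D.covTri k (ext x u) (ext x a) (ext x b) (ext x c) x)
    (fun a a' b c => by rw [map_add, D.covTri_add hk])
    (fun r a b c => by rw [map_smul, D.covTri_smul hk])
    (fun a b b' c => by
      simp only [← covTri_swap₁₂ D k _ _ (ext x a)]; rw [map_add, D.covTri_add hk.swap₁₂])
    (fun r a b c => by
      simp only [← covTri_swap₁₂ D k _ _ (ext x a)]; rw [map_smul, D.covTri_smul hk.swap₁₂])
    (fun a b c c' => by
      simp only [← covTri_swap₁₃ D k _ _ _ (ext x a)]; rw [map_add, D.covTri_add hk.swap₁₃])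
    (fun r a b c => by
      simp only [← covTri_swap₁₃ D k _ _ _ (ext x a)]; rw [map_smul, D.covTri_smul hk.swap₁₃])
  map_add' u v := by
    ext a b c
    simp only [mkTri_apply, LinearMap.add_apply, covTri, map_add, section_add_apply,
      C.der_add_left]
    ring
  map_smul' r v := by
    ext a b c
    simp only [mkTri_apply, LinearMap.smul_apply, covTri, map_smul, section_smul_apply,
      C.der_smul_left, smul_eq_mul, RingHom.id_apply]
    ring

theorem covTriForm_apply {k : TriForm E} (hk : k.Smooth I F) (ψ a b c : Cₛ^∞⟮I; F, E⟯) (x : M) :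
    D.covTriForm hk x (ψ x) (a x) (b x) (c x) = D.covTri k ψ a b c x :=
  D.covTri_congr hk (ext_apply _ _) (ext_apply _ _) (ext_apply _ _) (ext_apply _ _)

/-- The covariant derivative of a smooth family of trilinear forms is a smooth family. -/
theorem smoothFamily_covTri {k : ℝ → TriForm E} (hk : TriSmooth I F k) (ψ a b c : Cₛ^∞⟮I; F, E⟯) :
    SmoothFamily I fun t => D.covTri (k t) ψ a b c :=
  (((C.der_family ψ (hk a b c)).sub (hk (D.cov ψ a) b c)).sub (hk a (D.cov ψ b) c)).sub
    (hk a b (D.cov ψ c))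

end Connection

end CourantAlgebroid
end

noncomputable section

namespace CourantAlgebroid

variable {n : ℕ} {H : Type*} [TopologicalSpace H]
  {I : ModelWithCorners ℝ (EuclideanSpace ℝ (Fin n)) H}
  {M : Type*} [TopologicalSpace M] [ChartedSpace H M] [IsManifold I ∞ M]
  {F : Type*} [NormedAddCommGroup F] [NormedSpace ℝ F]
  {E : M → Type*} [TopologicalSpace (TotalSpace F E)] [∀ x, TopologicalSpace (E x)]
  [∀ x, AddCommGroup (E x)] [∀ x, Module ℝ (E x)] [FiberBundle F E] [VectorBundle ℝ F E]
  [T2Space M] [FiniteDimensional ℝ F] [ContMDiffVectorBundle ∞ F E I]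

/-! ## Change of the connection -/

section Tensor

variable (C : CourantAlgebroid I F E)

/-- The vector `K_u v` with `⟨K_u v, w⟩ = k(u, v, w)`. -/
def vec (k : TriForm E) (x : M) (u v : E x) : E x := C.sharp x (k x u v)

/-- The vector `κ(v, w)` with `⟨κ(v, w), u⟩ = k(u, v, w)`. -/
def covec (k : TriForm E) (x : M) (v w : E x) : E x := C.sharp x (((k x).flip v).flip w)

theorem metric_vec (k : TriForm E) (x : M) (u v w : E x) :
    C.metric x (C.vec k x u v) w = k x u v w := C.metric_sharp x _ w

theorem metric_covec (k : TriForm E) (x : M) (u v w : E x) :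
    C.metric x (C.covec k x v w) u = k x u v w := C.metric_sharp x _ u

/-- The part of twice the change of the Ricci tensor that is linear in the tensor `k`, in terms of
the covariant derivative `N` of `k`. -/
def linTerm {x : M} (N : E x →ₗ[ℝ] E x →ₗ[ℝ] E x →ₗ[ℝ] E x →ₗ[ℝ] ℝ) (u v : E x) : ℝ :=
  ∑ i, (N (C.dualFrame x i) v u (frameBasis I F E x i) -
    N v (C.dualFrame x i) u (frameBasis I F E x i) +
    N u (frameBasis I F E x i) (C.dualFrame x i) v -
    N (frameBasis I F E x i) u (C.dualFrame x i) v)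

/-- The part of twice the change of the curvature that is quadratic in the tensor `k`. -/
def quadCurv (k : TriForm E) (x : M) (φ' φ ψ ψ' : E x) : ℝ :=
  -C.metric x (C.vec k x ψ' φ) (C.vec k x ψ φ') + C.metric x (C.vec k x ψ φ) (C.vec k x ψ' φ') -
    C.metric x (C.vec k x φ' ψ) (C.vec k x φ ψ') + C.metric x (C.vec k x φ ψ) (C.vec k x φ' ψ') +
    C.metric x (C.covec k x ψ ψ') (C.covec k x φ φ')

/-- The part of twice the change of the Ricci tensor that is quadratic in the tensor `k`. -/
def quadTerm (k : TriForm E) (x : M) (u v : E x) : ℝ :=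
  ∑ i, C.quadCurv k x (frameBasis I F E x i) u (C.dualFrame x i) v

end Tensor

namespace Connection

variable {C : CourantAlgebroid I F E} {D D' : C.Connection} {k : TriForm E}

/-- `D'` is the connection `D + k`. -/
def IsSum (D' D : C.Connection) (k : TriForm E) : Prop :=
  ∀ (ψ φ χ : Cₛ^∞⟮I; F, E⟯) (x : M), C.metric x (D'.cov ψ φ x) (χ x) =
    C.metric x (D.cov ψ φ x) (χ x) + k x (ψ x) (φ x) (χ x)

theorem IsSum.cov_eq (h : IsSum D' D k) (ψ φ : Cₛ^∞⟮I; F, E⟯) (x : M) :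
    D'.cov ψ φ x = D.cov ψ φ x + C.vec k x (ψ x) (φ x) := by
  refine C.metric_ext fun u => ?_
  have := h ψ φ (ext (I := I) (F := F) x u) x
  rw [ext_apply] at this
  rw [this, map_add, LinearMap.add_apply, metric_vec]

theorem IsSum.smooth (h : IsSum D' D k) : k.Smooth I F := fun ψ φ χ => by
  have : (fun x => k x (ψ x) (φ x) (χ x)) = fun x =>
      C.metric x (D'.cov ψ φ x) (χ x) - C.metric x (D.cov ψ φ x) (χ x) := by
    ext x; rw [h]; ring
  rw [this]
  exact (C.metric_smooth _ _).sub (C.metric_smooth _ _)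

theorem IsSum.skew (h : IsSum D' D k) (x : M) (u v w : E x) : k x u v w = -k x u w v := by
  have h1 := D'.der_metric (ext (I := I) (F := F) x u) (ext x v) (ext x w) x
  have h2 := h (ext (I := I) (F := F) x u) (ext x v) (ext x w) x
  have h3 := h (ext (I := I) (F := F) x u) (ext x w) (ext x v) x
  rw [D.der_metric, C.metric_comm x (ext x v x), C.metric_comm x (ext x v x), h2, h3] at h1
  simp only [ext_apply] at h1
  linarith

theorem IsSum.vecK_eq (h : IsSum D' D k) (ψ ψ' : Cₛ^∞⟮I; F, E⟯) (x : M) :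
    D'.vecK ψ ψ' x = D.vecK ψ ψ' x + C.covec k x (ψ x) (ψ' x) := by
  refine C.metric_ext fun u => ?_
  have h1 := D'.metric_vecK ψ ψ' (ext (I := I) (F := F) x u) x
  have h2 := D.metric_vecK ψ ψ' (ext (I := I) (F := F) x u) x
  rw [h, ext_apply] at h1
  rw [ext_apply] at h2
  rw [h1, map_add, LinearMap.add_apply, h2, metric_covec]

theorem IsSum.torsion_eq (h : IsSum D' D k) (ψ ψ' ψ'' : Cₛ^∞⟮I; F, E⟯) (x : M) :
    D'.torsion ψ ψ' ψ'' x = D.torsion ψ ψ' ψ'' x + (k x (ψ x) (ψ' x) (ψ'' x) -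
      k x (ψ' x) (ψ x) (ψ'' x) + k x (ψ'' x) (ψ x) (ψ' x)) := by
  simp only [torsion, section_sub_apply, map_sub, LinearMap.sub_apply, h _ _ _ x]
  ring

theorem IsSum.divergence_eq (h : IsSum D' D k) (ψ : Cₛ^∞⟮I; F, E⟯) (x : M) :
    D'.divergence ψ x = D.divergence ψ x +
      ∑ i, k x (frameBasis I F E x i) (ψ x) (C.dualFrame x i) := by
  simp only [divergence, C.coord_eq]
  rw [← Finset.sum_add_distrib]
  refine Finset.sum_congr rfl fun i _ => ?_
  rw [h.cov_eq, map_add, LinearMap.add_apply, metric_vec, frameBasis_apply]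

theorem cov_sub_cov (hD : ∀ ψ ψ' ψ'' x, D.torsion ψ ψ' ψ'' x = 0) (ψ ψ' : Cₛ^∞⟮I; F, E⟯) (x : M) :
    D.cov ψ ψ' x - D.cov ψ' ψ x - C.bracket ψ ψ' x = -D.vecK ψ ψ' x := by
  refine C.metric_ext fun u => ?_
  have h1 := hD ψ ψ' (ext x u) x
  have h2 := D.metric_vecK ψ ψ' (ext (I := I) (F := F) x u) x
  simp only [torsion, ext_apply, section_sub_apply] at h1 h2
  rw [map_neg, LinearMap.neg_apply, h2]
  linarith

theorem IsSum.curvatureZero_eq (h : IsSum D' D k) (hD : ∀ ψ ψ' ψ'' x, D.torsion ψ ψ' ψ'' x = 0)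
    (φ' φ ψ ψ' : Cₛ^∞⟮I; F, E⟯) (x : M) :
    D'.curvatureZero φ' φ ψ ψ' x = D.curvatureZero φ' φ ψ ψ' x +
      D.covTri k ψ ψ' φ φ' x - D.covTri k ψ' ψ φ φ' x - k x (D.vecK ψ ψ' x) (φ x) (φ' x) -
      C.metric x (C.vec k x (ψ' x) (φ x)) (C.vec k x (ψ x) (φ' x)) +
      C.metric x (C.vec k x (ψ x) (φ x)) (C.vec k x (ψ' x) (φ' x)) := by
  have key : ∀ ψ ψ' : Cₛ^∞⟮I; F, E⟯, C.metric x (D'.cov ψ (D'.cov ψ' φ) x) (φ' x) =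
      C.metric x (D.cov ψ (D.cov ψ' φ) x) (φ' x) + D.covTri k ψ ψ' φ φ' x +
      k x (D.cov ψ ψ' x) (φ x) (φ' x) + k x (ψ' x) (D.cov ψ φ x) (φ' x) +
      k x (ψ x) (D.cov ψ' φ x) (φ' x) -
      C.metric x (C.vec k x (ψ' x) (φ x)) (C.vec k x (ψ x) (φ' x)) := by
    intro ψ ψ'
    have h1 := D'.der_metric ψ (D'.cov ψ' φ) φ' x
    have h2 := D.der_metric ψ (D.cov ψ' φ) φ' x
    rw [funext (h ψ' φ φ'), C.der_add ψ (C.metric_smooth _ _) (h.smooth _ _ _), h.cov_eq ψ' φ,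
      h.cov_eq ψ φ', h2] at h1
    have h3 : D.covTri k ψ ψ' φ φ' x = _ := rfl
    conv_rhs at h3 => rw [covTri]
    simp only [map_add, LinearMap.add_apply] at h1
    rw [C.metric_comm x (D.cov ψ' φ x) (C.vec k x _ _), metric_vec, metric_vec] at h1
    rw [h3]
    have h4 := h.skew x (ψ x) (φ' x) (D.cov ψ' φ x)
    linarith
  have h5 := cov_sub_cov hD ψ ψ' x
  have h6 : k x (D.cov ψ ψ' x) (φ x) (φ' x) - k x (D.cov ψ' ψ x) (φ x) (φ' x) -
      k x (C.bracket ψ ψ' x) (φ x) (φ' x) = -k x (D.vecK ψ ψ' x) (φ x) (φ' x) := by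
    have := congrArg (fun v => k x v (φ x) (φ' x)) h5
    simpa only [map_sub, map_neg, LinearMap.sub_apply, LinearMap.neg_apply] using this
  rw [Connection.curvatureZero_eq, Connection.curvatureZero_eq, key, key, h]
  linarith

theorem IsSum.curvature_eq (h : IsSum D' D k) (hD : ∀ ψ ψ' ψ'' x, D.torsion ψ ψ' ψ'' x = 0)
    (φ' φ ψ ψ' : Cₛ^∞⟮I; F, E⟯) (x : M) :
    2 * D'.curvature φ' φ ψ ψ' x = 2 * D.curvature φ' φ ψ ψ' x +
      (D.covTri k ψ ψ' φ φ' x - D.covTri k ψ' ψ φ φ' x + D.covTri k φ φ' ψ ψ' x -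
        D.covTri k φ' φ ψ ψ' x) + C.quadCurv k x (φ' x) (φ x) (ψ x) (ψ' x) := by
  rw [curvature, curvature, h.curvatureZero_eq hD, h.curvatureZero_eq hD, h.vecK_eq, h.vecK_eq]
  simp only [map_add, LinearMap.add_apply, metric_covec, quadCurv]
  rw [C.metric_comm x (D.vecK ψ ψ' x) (C.covec k x _ _), metric_covec]
  ring

theorem IsSum.ricci_eq (h : IsSum D' D k) (hD : ∀ ψ ψ' ψ'' x, D.torsion ψ ψ' ψ'' x = 0)
    (x : M) (u v : E x) :
    2 * D'.ricciForm x u v = 2 * D.ricciForm x u v + C.linTerm (D.covTriForm h.smooth x) u v +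
      C.quadTerm k x u v := by
  have hs : ∀ w, ∑ i, C.metric x w (ext (I := I) (F := F) x (C.dualFrame x i) x) •
      ext (I := I) (F := F) x (frameBasis I F E x i) x = w := fun w => by
    simpa only [ext_apply] using C.sum_dualFrame_frame x w
  have h1 := D.ricciForm_apply (ext (I := I) (F := F) x u) (ext (I := I) (F := F) x v) x
  have h2 := D'.ricciForm_apply (ext (I := I) (F := F) x u) (ext (I := I) (F := F) x v) x
  rw [ext_apply, ext_apply] at h1 h2
  rw [h1, h2, D.ricci_eq_sum hs, D'.ricci_eq_sum hs, linTerm, quadTerm, Finset.mul_sum,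
    Finset.mul_sum, ← Finset.sum_add_distrib, ← Finset.sum_add_distrib]
  refine Finset.sum_congr rfl fun i _ => ?_
  rw [h.curvature_eq hD]
  simp only [ext_apply]
  rfl

/-! ## The trace of the linear term is a divergence -/

section Divergence

variable (D) {T : ∀ x, E x →ₗ[ℝ] E x}

variable (C T) in
/-- The bilinear forms whose trace is the one-form `ξ` below. -/
def xiForm (k : TriForm E) (x : M) (c : E x) : E x →ₗ[ℝ] E x →ₗ[ℝ] ℝ :=
  LinearMap.mk₂ ℝ (fun u v => k x (T x v) u c - k x u (T x c) v)
    (by intros; simp; ring) (by intros; simp; ring) (by intros; simp; ring)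
    (by intros; simp; ring)

variable (C T) in
/-- The one-form `ξ(c) = ∑ k(T e^m, e_m, c) - k(e_m, T c, e^m)`. -/
def xi (k : TriForm E) (x : M) : E x →ₗ[ℝ] ℝ where
  toFun c := C.tr x (xiForm T k x c)
  map_add' a b := by
    simp only [tr, ← Finset.sum_add_distrib, xiForm, LinearMap.mk₂_apply, map_add,
      LinearMap.add_apply]
    exact Finset.sum_congr rfl fun i _ => by ring
  map_smul' r b := by
    simp only [tr, smul_eq_mul, Finset.mul_sum, xiForm, LinearMap.mk₂_apply, map_smul,
      LinearMap.smul_apply, RingHom.id_apply]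
    exact Finset.sum_congr rfl fun i _ => by ring

theorem smoothFamily_xi {k : ℝ → TriForm E} (hk : TriSmooth I F k)
    (hT : ∀ s : Cₛ^∞⟮I; F, E⟯, C.WeakSmooth fun _ x => T x (s x)) (c : Cₛ^∞⟮I; F, E⟯) :
    SmoothFamily I fun t x => xi C T (k t) x (c x) :=
  C.smoothFamily_tr (B := fun t x => xiForm T (k t) x (c x)) fun s s' =>
    (hk.apply (hT s') (C.weakSmooth_section s) (C.weakSmooth_section c)).sub
      (hk.apply (C.weakSmooth_section s) (hT c) (C.weakSmooth_section s'))

theorem Smooth.family {k : TriForm E} (hk : k.Smooth I F) : TriSmooth I F fun _ => k :=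
  fun a b c => .of_function (hk a b c)

/-- The section dual to the one-form `ξ`. -/
def xiSection {k : TriForm E} (hk : k.Smooth I F)
    (hT : ∀ s : Cₛ^∞⟮I; F, E⟯, C.WeakSmooth fun _ x => T x (s x)) : Cₛ^∞⟮I; F, E⟯ :=
  C.mkSection (fun x => C.sharp x (xi C T k x)) fun s => by
    simp only [metric_sharp]
    exact (smoothFamily_xi (Smooth.family hk) hT s).slice 0

theorem metric_xiSection {k : TriForm E} (hk : k.Smooth I F)
    (hT : ∀ s : Cₛ^∞⟮I; F, E⟯, C.WeakSmooth fun _ x => T x (s x)) (x : M) (v : E x) :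
    C.metric x (xiSection hk hT x) v = xi C T k x v := C.metric_sharp x _ v

theorem sum_cancel {ι : Type*} [Fintype ι] (a b c a' : ι → ι → ℝ)
    (h1 : ∀ i, ∑ m, a i m = ∑ m, a' i m) (h2 : ∀ i, ∑ m, c i m = ∑ m, b i m) :
    ∑ m, ∑ i, (a i m - c i m - b i m + a' i m) = 2 * ∑ i, ∑ m, (a i m - b m i) := by
  rw [Finset.sum_comm]
  simp only [Finset.sum_add_distrib, Finset.sum_sub_distrib, ← h1, h2]
  rw [Finset.sum_comm (f := fun i m => b m i)]
  ring

theorem sum_linTerm_eq_sum {x : M} (N : E x →ₗ[ℝ] E x →ₗ[ℝ] E x →ₗ[ℝ] E x →ₗ[ℝ] ℝ)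
    (hNskew : ∀ u a b c, N u a b c = -N u a c b) {T : E x →ₗ[ℝ] E x}
    (hT : ∀ u v, C.metric x (T u) v = C.metric x u (T v)) :
    ∑ m, C.linTerm N (frameBasis I F E x m) (T (C.dualFrame x m)) =
      2 * ∑ i, ∑ m, (N (frameBasis I F E x i) (T (C.dualFrame x m)) (frameBasis I F E x m)
        (C.dualFrame x i) - N (frameBasis I F E x i) (frameBasis I F E x m)
        (T (C.dualFrame x i)) (C.dualFrame x m)) := by
  have t1 : ∀ u v : E x, ∑ i, N (C.dualFrame x i) v u (frameBasis I F E x i) =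
      ∑ i, N (frameBasis I F E x i) v u (C.dualFrame x i) := fun u v =>
    sum_swap x (LinearMap.mk₂ ℝ (fun a b => N a v u b) (by simp) (by simp) (by simp) (by simp))
  have t2 : ∀ u v : E x, ∑ i, N v (C.dualFrame x i) u (frameBasis I F E x i) =
      ∑ i, N v (frameBasis I F E x i) u (C.dualFrame x i) := fun u v =>
    sum_swap x (LinearMap.mk₂ ℝ (fun a b => N v a u b) (by simp) (by simp) (by simp) (by simp))
  have t3 : ∀ i, ∑ m, N (frameBasis I F E x i) (T (C.dualFrame x m)) (frameBasis I F E x m)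
        (C.dualFrame x i) =
      ∑ m, N (frameBasis I F E x i) (frameBasis I F E x m) (T (C.dualFrame x m))
        (C.dualFrame x i) := fun i =>
    sum_swap_self_adjoint hT (((N (frameBasis I F E x i)).compr₂
      (LinearMap.applyₗ (C.dualFrame x i))))
  have t4 : ∀ i, ∑ m, N (T (C.dualFrame x m)) (frameBasis I F E x i) (frameBasis I F E x m)
        (C.dualFrame x i) =
      ∑ m, N (frameBasis I F E x m) (frameBasis I F E x i) (T (C.dualFrame x m))
        (C.dualFrame x i) := fun i =>
    sum_swap_self_adjoint hT (LinearMap.mk₂ ℝ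
      (fun a b => N a (frameBasis I F E x i) b (C.dualFrame x i)) (by simp) (by simp) (by simp)
      (by simp))
  have e1 : ∀ m, C.linTerm N (frameBasis I F E x m) (T (C.dualFrame x m)) =
      ∑ i, (N (frameBasis I F E x i) (T (C.dualFrame x m)) (frameBasis I F E x m)
          (C.dualFrame x i) -
        N (T (C.dualFrame x m)) (frameBasis I F E x i) (frameBasis I F E x m)
          (C.dualFrame x i) -
        N (frameBasis I F E x m) (frameBasis I F E x i) (T (C.dualFrame x m))
          (C.dualFrame x i) +
        N (frameBasis I F E x i) (frameBasis I F E x m) (T (C.dualFrame x m))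
          (C.dualFrame x i)) := by
    intro m
    simp only [linTerm, Finset.sum_add_distrib, Finset.sum_sub_distrib, t1, t2]
    simp only [hNskew _ _ (C.dualFrame x _) (T _), Finset.sum_neg_distrib]
    ring
  rw [Finset.sum_congr rfl fun m _ => e1 m]
  obtain ⟨f, hf⟩ : ∃ f : E x → E x → E x → E x → ℝ, ∀ a b c d, N a b c d = f a b c d :=
    ⟨fun a b c d => N a b c d, fun _ _ _ _ => rfl⟩
  simp only [hf] at t3 t4 ⊢
  exact sum_cancel
    (fun i m => f (frameBasis I F E x i) (T (C.dualFrame x m)) (frameBasis I F E x m)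
      (C.dualFrame x i))
    (fun i m => f (frameBasis I F E x m) (frameBasis I F E x i) (T (C.dualFrame x m))
      (C.dualFrame x i))
    (fun i m => f (T (C.dualFrame x m)) (frameBasis I F E x i) (frameBasis I F E x m)
      (C.dualFrame x i))
    (fun i m => f (frameBasis I F E x i) (frameBasis I F E x m) (T (C.dualFrame x m))
      (C.dualFrame x i)) t3 t4

/-- For a connection commuting with `T` and a tensor `k` skew in its last two arguments, the trace of
the linear term against `T` is twice the divergence of the section dual to `ξ`. -/
theorem sum_linTerm_eq (hk : k.Smooth I F) (hskew : ∀ x u v w, k x u v w = -k x u w v)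
    (hT : ∀ s : Cₛ^∞⟮I; F, E⟯, C.WeakSmooth fun _ x => T x (s x))
    (hsa : ∀ x u v, C.metric x (T x u) v = C.metric x u (T x v))
    (hDT : ∀ ψ φ φ' : Cₛ^∞⟮I; F, E⟯, (∀ x, φ' x = T x (φ x)) → ∀ x, D.cov ψ φ' x = T x (D.cov ψ φ x))
    (x : M) :
    ∑ m, C.linTerm (D.covTriForm hk x) (frameBasis I F E x m) (T x (C.dualFrame x m)) =
      2 * D.divergence (xiSection hk hT) x := by
  set N := D.covTriForm hk x with hN
  let Tsec : Cₛ^∞⟮I; F, E⟯ → Cₛ^∞⟮I; F, E⟯ := fun s => C.mkSection (fun x => T x (s x)) fun s' =>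
    (hT s s').slice 0
  have hNskew : ∀ u a b c : E x, N u a b c = -N u a c b := by
    intro u a b c
    have : ∀ ψ a b c : Cₛ^∞⟮I; F, E⟯, D.covTri k ψ a b c x = -D.covTri k ψ a c b x := by
      intro ψ a b c
      have e : (fun y => k y (a y) (b y) (c y)) = fun y => (-1) * k y (a y) (c y) (b y) := by
        ext y; rw [hskew]; ring
      simp only [covTri]
      rw [e, C.der_const_mul ψ _ (hk a c b), hskew x _ (b x) (c x), hskew x _ (D.cov ψ b x) (c x),
        hskew x _ (b x) (D.cov ψ c x)]
      ring
    exact this _ _ _ _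
  have hcov : ∀ u c : Cₛ^∞⟮I; F, E⟯, C.metric x (D.cov u (xiSection hk hT) x) (c x) =
      ∑ m, (N (u x) (T x (C.dualFrame x m)) (frameBasis I F E x m) (c x) -
        N (u x) (frameBasis I F E x m) (T x (c x)) (C.dualFrame x m)) := by
    intro u c
    have hB : ∀ a b : Cₛ^∞⟮I; F, E⟯, ContMDiff I 𝓘(ℝ, ℝ) ∞
        fun y => xiForm T k y (c y) (a y) (b y) := fun a b =>
      (hk (Tsec b) a c).sub (hk a (Tsec c) b)
    have h1 := D.der_metric u (xiSection hk hT) c x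
    have h2 := D.der_tr hB u x
    have h3 : (fun y => C.metric y (xiSection hk hT y) (c y)) =
        fun y => C.tr y (xiForm T k y (c y)) := by
      ext y; rw [metric_xiSection]; rfl
    rw [h3, h2, metric_xiSection] at h1
    rw [eq_comm, ← eq_sub_iff_add_eq] at h1
    rw [h1]
    change _ - C.tr x (xiForm T k x (D.cov u c x)) = _
    rw [tr, ← Finset.sum_sub_distrib]
    refine Finset.sum_congr rfl fun m _ => ?_
    have h4 : ∀ a b : Cₛ^∞⟮I; F, E⟯, D.covBi (fun y => xiForm T k y (c y)) u a b x -
        xiForm T k x (D.cov u c x) (a x) (b x) =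
        D.covTri k u (Tsec b) a c x - D.covTri k u a (Tsec c) b x := by
      intro a b
      have e1 := C.der_sub u (x := x) (hk (Tsec b) a c) (hk a (Tsec c) b)
      have e2 : C.der u (fun y => xiForm T k y (c y) (a y) (b y)) x = _ := e1
      rw [covBi, e2]
      simp only [covTri, xiForm, LinearMap.mk₂_apply, hDT u _ (Tsec _) (fun _ => rfl)]
      simp only [Tsec, mkSection_apply]
      ring
    have h5 := h4 (frame I F E x m) (ext x (C.dualFrame x m))
    rw [← frameBasis_apply, ext_apply] at h5
    rw [h5, ← D.covTriForm_apply hk, ← D.covTriForm_apply hk, ← frameBasis_apply]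
    simp only [Tsec, mkSection_apply, ext_apply, hN]
  have hdiv := D.divergence_eq_sum (s := fun i => ext (I := I) (F := F) x (frameBasis I F E x i))
    (t := fun i => ext (I := I) (F := F) x (C.dualFrame x i)) (x := x)
    (fun w => by simpa only [ext_apply] using C.sum_dualFrame_frame x w) (xiSection hk hT)
  rw [hdiv, Finset.sum_congr rfl fun i _ => hcov _ _]
  simp only [ext_apply]
  exact sum_linTerm_eq_sum N hNskew (hsa x)

end Divergence

end Connection

end CourantAlgebroid
end

noncomputable section

namespace CourantAlgebroid

variable {n : ℕ} {H : Type*} [TopologicalSpace H]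
  {I : ModelWithCorners ℝ (EuclideanSpace ℝ (Fin n)) H}
  {M : Type*} [TopologicalSpace M] [ChartedSpace H M] [IsManifold I ∞ M]
  {F : Type*} [NormedAddCommGroup F] [NormedSpace ℝ F]
  {E : M → Type*} [TopologicalSpace (TotalSpace F E)] [∀ x, TopologicalSpace (E x)]
  [∀ x, AddCommGroup (E x)] [∀ x, Module ℝ (E x)] [FiberBundle F E] [VectorBundle ℝ F E]
  [T2Space M] [FiniteDimensional ℝ F] [ContMDiffVectorBundle ∞ F E I]

/-! ## Splittings -/

/-- A smooth self-adjoint involution `T` with `1`-eigenbundle `V`. -/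
structure IsSplitting (C : CourantAlgebroid I F E) (V : ∀ x, Submodule ℝ (E x))
    (T : ∀ x, E x →ₗ[ℝ] E x) : Prop where
  mem_iff : ∀ x v, v ∈ V x ↔ T x v = v
  invol : ∀ x v, T x (T x v) = v
  symm : ∀ x u v, C.metric x (T x u) v = C.metric x u (T x v)
  smooth : ∀ s : Cₛ^∞⟮I; F, E⟯, C.WeakSmooth fun _ x => T x (s x)

namespace IsSplitting

variable {C : CourantAlgebroid I F E} {V : ∀ x, Submodule ℝ (E x)} {T : ∀ x, E x →ₗ[ℝ] E x}
  (hT : C.IsSplitting V T)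
include hT

theorem mem_perp_iff (x : M) (v : E x) : v ∈ C.perp V x ↔ T x v = -v := by
  constructor
  · intro hv
    refine C.metric_ext fun u => ?_
    have h1 : u + T x u ∈ V x := by rw [hT.mem_iff, map_add, hT.invol, add_comm]
    have h2 : C.metric x (u + T x u) v = 0 := hv _ h1
    rw [hT.symm, map_neg, LinearMap.neg_apply, C.metric_comm x v (T x u), C.metric_comm x v u]
    rw [map_add, LinearMap.add_apply] at h2
    linarith
  · intro hv u hu
    change C.metric x u v = 0
    have h1 := hT.symm x u v
    rw [(hT.mem_iff x u).1 hu, hv, map_neg] at h1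
    linarith

theorem isCompl (x : M) : IsCompl (V x) (C.perp V x) := by
  constructor
  · rw [Submodule.disjoint_def]
    intro v h1 h2
    rw [hT.mem_iff] at h1
    rw [hT.mem_perp_iff, h1] at h2
    have h3 : (2 : ℝ) • v = 0 := by rw [two_smul, add_eq_zero_iff_eq_neg]; exact h2
    exact (smul_eq_zero.1 h3).resolve_left two_ne_zero
  · rw [codisjoint_iff, eq_top_iff]
    intro v _
    refine Submodule.mem_sup.2 ⟨(1 / 2 : ℝ) • (v + T x v), ?_, (1 / 2 : ℝ) • (v - T x v), ?_, ?_⟩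
    · rw [hT.mem_iff, map_smul, map_add, hT.invol, add_comm]
    · rw [hT.mem_perp_iff, map_smul, map_sub, hT.invol, ← smul_neg, neg_sub]
    · module

theorem plusPart_apply (x : M) (v : E x) : C.plusPart V x v = (1 / 2 : ℝ) • (v + T x v) := by
  rw [plusPart, dif_pos (hT.isCompl x)]
  have h1 : (1 / 2 : ℝ) • (v + T x v) ∈ V x := by
    rw [hT.mem_iff, map_smul, map_add, hT.invol, add_comm]
  have h2 : (1 / 2 : ℝ) • (v - T x v) ∈ C.perp V x := by
    rw [hT.mem_perp_iff, map_smul, map_sub, hT.invol, ← smul_neg, neg_sub]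
  have h3 : v = (1 / 2 : ℝ) • (v + T x v) + (1 / 2 : ℝ) • (v - T x v) := by module
  conv_lhs => rw [h3]
  rw [map_add, Submodule.projection_apply_of_mem_left _ h1,
    Submodule.projection_apply_of_mem_right _ h2, add_zero]

theorem genMetric_apply (x : M) (u v : E x) : C.genMetric V x u v = C.metric x (T x u) v := by
  simp only [genMetric, LinearMap.sub_apply, LinearMap.compl₁₂_apply, hT.plusPart_apply,
    LinearMap.id_apply, map_sub, map_smul, map_add, LinearMap.add_apply, LinearMap.smul_apply,
    smul_eq_mul, hT.symm, hT.invol]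
  ring

theorem scalarCurvature_eq (D : C.Connection) (x : M) :
    D.scalarCurvature (C.genMetric V) x =
      ∑ m, D.ricciForm x (frameBasis I F E x m) (T x (C.dualFrame x m)) := by
  rw [Connection.scalarCurvature]
  refine Finset.sum_congr rfl fun i _ => ?_
  rw [← gramInv_sum (C.genMetric V) x (fun i => T x (C.dualFrame x i)) (fun i j => by
    rw [hT.genMetric_apply, hT.invol, metric_dualFrame_left])]
  refine Finset.sum_congr rfl fun j _ => ?_
  rw [frameBasis_apply, frameBasis_apply, Connection.ricciForm_apply, smul_eq_mul]

/-- The involution acting on sections. -/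
def onSection (s : Cₛ^∞⟮I; F, E⟯) : Cₛ^∞⟮I; F, E⟯ :=
  C.mkSection (fun x => T x (s x)) fun s' => (hT.smooth s s').slice 0

@[simp] theorem onSection_apply (s : Cₛ^∞⟮I; F, E⟯) (x : M) : hT.onSection s x = T x (s x) := rfl

/-- A connection preserving `V` commutes with the involution. -/
theorem cov_onSection {D : C.Connection}
    (hD : ∀ ψ ψ' : Cₛ^∞⟮I; F, E⟯, (∀ x, ψ' x ∈ V x) → ∀ x, D.cov ψ ψ' x ∈ V x)
    (ψ φ : Cₛ^∞⟮I; F, E⟯) (x : M) : D.cov ψ (hT.onSection φ) x = T x (D.cov ψ φ x) := by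
  have hplus : ∀ φ : Cₛ^∞⟮I; F, E⟯, ∀ x, (φ + hT.onSection φ) x ∈ V x := fun φ x => by
    rw [hT.mem_iff, section_add_apply, onSection_apply, map_add, hT.invol, add_comm]
  have h1 : D.cov ψ (φ + hT.onSection φ) x ∈ V x := hD _ _ (hplus φ) x
  have h2 : D.cov ψ (φ - hT.onSection φ) x ∈ C.perp V x := by
    intro u hu
    let s : Cₛ^∞⟮I; F, E⟯ := ext (I := I) (F := F) x u
    have h3 : C.der ψ (fun y => C.metric y ((s + hT.onSection s) y) ((φ - hT.onSection φ) y)) x =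
        0 := by
      have : (fun y => C.metric y ((s + hT.onSection s) y) ((φ - hT.onSection φ) y)) =
          fun _ => 0 := by
        ext y
        simp only [section_add_apply, section_sub_apply, onSection_apply, map_add, map_sub,
          LinearMap.add_apply, hT.symm, hT.invol]
        ring
      rw [this, C.der_const]
    rw [D.der_metric] at h3
    have h4 : C.metric x (D.cov ψ (s + hT.onSection s) x) ((φ - hT.onSection φ) x) = 0 := by
      have h6 := (hT.mem_iff x _).1 (hD ψ _ (hplus s) x)
      have h5 := hT.symm x (D.cov ψ (s + hT.onSection s) x) ((φ - hT.onSection φ) x)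
      rw [h6] at h5
      simp only [section_sub_apply, onSection_apply, map_sub, hT.invol] at h5 ⊢
      linarith
    rw [h4, zero_add, section_add_apply, onSection_apply, ext_apply, (hT.mem_iff x u).1 hu,
      map_add, LinearMap.add_apply] at h3
    change C.metric x u _ = 0
    linarith
  rw [hT.mem_iff] at h1
  rw [hT.mem_perp_iff] at h2
  simp only [map_add, map_sub, section_add_apply, section_sub_apply] at h1 h2
  have h3 := congrArg₂ (· + ·) h1 h2
  have h4 : (2 : ℝ) • T x (D.cov ψ φ x) = (2 : ℝ) • D.cov ψ (hT.onSection φ) x := by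
    rw [← sub_eq_zero] at h3 ⊢
    rw [← h3]
    module
  exact (smul_right_injective _ (two_ne_zero (α := ℝ)) h4).symm

end IsSplitting

/-! ## Algebra of the difference of two Levi-Civita connections -/

/-- The algebraic properties of the difference of two Levi-Civita connections. -/
structure IsPure (C : CourantAlgebroid I F E) (T : ∀ x, E x →ₗ[ℝ] E x) (k : TriForm E) : Prop where
  skew : ∀ x a b c, k x a b c = -k x a c b
  cyclic : ∀ x a b c, k x a b c - k x b a c + k x c a b = 0
  left : ∀ x a b c, k x (T x a) b c = k x a (T x b) c
  right : ∀ x a b c, k x a (T x b) c = k x a b (T x c)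
  trace : ∀ x v, ∑ i, k x (frameBasis I F E x i) v (C.dualFrame x i) = 0

namespace IsPure

variable {C : CourantAlgebroid I F E} {V : ∀ x, Submodule ℝ (E x)} {T : ∀ x, E x →ₗ[ℝ] E x}
  {k : TriForm E} (h : C.IsPure T k)
include h

theorem trace' (x : M) (v : E x) : ∑ i, k x (C.dualFrame x i) (frameBasis I F E x i) v = 0 := by
  have h1 : ∑ i, k x (C.dualFrame x i) v (frameBasis I F E x i) =
      ∑ i, k x (frameBasis I F E x i) v (C.dualFrame x i) :=
    sum_swap x (LinearMap.mk₂ ℝ (fun a b => k x a v b) (by simp) (by simp) (by simp) (by simp))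
  simp only [h.skew x _ _ v, Finset.sum_neg_distrib, h1, h.trace, neg_zero]

theorem trace'' (x : M) (v : E x) : ∑ i, k x (frameBasis I F E x i) (C.dualFrame x i) v = 0 := by
  simp only [h.skew x _ _ v, Finset.sum_neg_distrib, h.trace, neg_zero]

theorem xi_eq_zero (x : M) : Connection.xi C T k x = 0 := by
  ext c
  change ∑ m, (k x (T x (C.dualFrame x m)) (frameBasis I F E x m) c -
    k x (frameBasis I F E x m) (T x c) (C.dualFrame x m)) = 0
  simp only [h.left, h.right, Finset.sum_sub_distrib]
  rw [h.trace' x (T x c)]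
  simp only [← h.right, h.trace, sub_zero]

theorem vec_right (x : M) (hT : C.IsSplitting V T) (a b : E x) :
    C.vec k x a (T x b) = T x (C.vec k x a b) :=
  C.metric_ext fun u => by rw [hT.symm, metric_vec, metric_vec, h.right]

theorem vec_left (x : M) (hT : C.IsSplitting V T) (a b : E x) :
    C.vec k x (T x a) b = T x (C.vec k x a b) :=
  C.metric_ext fun u => by rw [hT.symm, metric_vec, metric_vec, h.left, h.right]

theorem covec_right (x : M) (hT : C.IsSplitting V T) (a b : E x) :
    C.covec k x a (T x b) = T x (C.covec k x a b) :=
  C.metric_ext fun u => by rw [hT.symm, metric_covec, metric_covec, h.left, h.right]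

theorem covec_left (x : M) (hT : C.IsSplitting V T) (a b : E x) :
    C.covec k x (T x a) b = T x (C.covec k x a b) :=
  C.metric_ext fun u => by rw [hT.symm, metric_covec, metric_covec, h.left]

theorem sum_vec (x : M) : ∑ i, C.vec k x (C.dualFrame x i) (frameBasis I F E x i) = 0 :=
  C.metric_ext fun u => by
    simp only [map_sum, LinearMap.sum_apply, metric_vec, h.trace', map_zero, LinearMap.zero_apply]

theorem sum_vec' (x : M) : ∑ i, C.vec k x (frameBasis I F E x i) (C.dualFrame x i) = 0 :=
  C.metric_ext fun u => by
    simp only [map_sum, LinearMap.sum_apply, metric_vec, h.trace'', map_zero, LinearMap.zero_apply]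

theorem quadTerm_eq (x : M) (u v : E x) : C.quadTerm k x u v =
    ∑ i, (C.metric x (C.vec k x (C.dualFrame x i) u) (C.vec k x v (frameBasis I F E x i)) +
      C.metric x (C.vec k x u (C.dualFrame x i)) (C.vec k x (frameBasis I F E x i) v) +
      C.metric x (C.covec k x (C.dualFrame x i) v) (C.covec k x u (frameBasis I F E x i))) := by
  have h1 : ∑ i, C.metric x (C.vec k x v u)
      (C.vec k x (C.dualFrame x i) (frameBasis I F E x i)) = 0 := by
    rw [← map_sum, h.sum_vec, map_zero]
  have h2 : ∑ i, C.metric x (C.vec k x (frameBasis I F E x i) (C.dualFrame x i))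
      (C.vec k x u v) = 0 := by
    rw [← LinearMap.sum_apply, ← map_sum, h.sum_vec', map_zero, LinearMap.zero_apply]
  simp only [quadTerm, quadCurv, Finset.sum_add_distrib, Finset.sum_sub_distrib,
    Finset.sum_neg_distrib, h1, h2]
  ring

theorem quadTerm_mixed (x : M) (hT : C.IsSplitting V T) {u v : E x} (hu : T x u = u)
    (hv : T x v = -v) : C.quadTerm k x u v = 0 := by
  rw [h.quadTerm_eq]
  have hTT : ∀ a b, C.metric x (T x a) (T x b) = C.metric x a b := fun a b => by
    rw [hT.symm, hT.invol]
  refine Finset.sum_eq_zero fun i _ => ?_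
  have e1 := hTT (C.vec k x (C.dualFrame x i) u) (C.vec k x v (frameBasis I F E x i))
  have e2 := hTT (C.vec k x u (C.dualFrame x i)) (C.vec k x (frameBasis I F E x i) v)
  have e3 := hTT (C.covec k x (C.dualFrame x i) v) (C.covec k x u (frameBasis I F E x i))
  have hneg : ∀ a, C.vec k x (-v) a = -C.vec k x v a := fun a =>
    C.metric_ext fun w => by simp [metric_vec]
  have hneg' : ∀ a, C.vec k x a (-v) = -C.vec k x a v := fun a =>
    C.metric_ext fun w => by simp [metric_vec]
  have hneg'' : ∀ a, C.covec k x a (-v) = -C.covec k x a v := fun a =>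
    C.metric_ext fun w => by simp [metric_covec]
  rw [← h.vec_right x hT, ← h.vec_left x hT v, hu, hv, hneg, map_neg] at e1
  rw [← h.vec_left x hT, ← h.vec_right x hT _ v, hu, hv, hneg', map_neg] at e2
  rw [← h.covec_right x hT, ← h.covec_left x hT u, hu, hv, hneg'', map_neg,
    LinearMap.neg_apply] at e3
  linarith

theorem sum_quadTerm (x : M) (hT : C.IsSplitting V T) :
    ∑ m, C.quadTerm k x (frameBasis I F E x m) (T x (C.dualFrame x m)) = 0 := by
  set e := frameBasis I F E x
  set d := C.dualFrame x
  have hexp : ∀ a b : E x, C.metric x a b = ∑ j, C.metric x a (e j) * C.metric x b (d j) := by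
    intro a b
    conv_lhs => rw [← C.sum_frame_dualFrame x a]
    simp only [map_sum, map_smul, LinearMap.sum_apply, LinearMap.smul_apply, smul_eq_mul]
    refine Finset.sum_congr rfl fun j _ => ?_
    rw [C.metric_comm x b]
  obtain ⟨f, hf⟩ : ∃ f : E x → E x → E x → ℝ, ∀ a b c, k x a b c = f a b c :=
    ⟨fun a b c => k x a b c, fun _ _ _ => rfl⟩
  obtain ⟨g, hg⟩ : ∃ g : E x → E x → E x → ℝ, ∀ a b c, k x (T x a) b c = g a b c :=
    ⟨fun a b c => k x (T x a) b c, fun _ _ _ => rfl⟩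
  have hgskew : ∀ a b c, g a b c = -g a c b := fun a b c => by rw [← hg, ← hg, h.skew]
  have hfskew : ∀ a b c, f a b c = -f a c b := fun a b c => by rw [← hf, ← hf, h.skew]
  have hgcyc : ∀ a b c, g b a c = g a b c + g c a b := fun a b c => by
    have := h.cyclic x (T x a) b c
    rw [← hg, ← hg, ← hg, h.left x b, h.left x c]
    linarith
  have s1 : ∀ m j, ∑ i, f (d i) (e m) (e j) * g (d m) (e i) (d j) =
      ∑ i, f (e i) (e m) (e j) * g (d m) (d i) (d j) := fun m j => by
    simp only [← hf, ← hg]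
    exact sum_swap x (LinearMap.mk₂ ℝ (fun a b => k x a (e m) (e j) * k x (T x (d m)) b (d j))
      (by intros; simp; ring) (by intros; simp; ring) (by intros; simp; ring)
      (by intros; simp; ring))
  have s2 : ∀ m j, ∑ i, f (e m) (d i) (e j) * g (e i) (d m) (d j) =
      ∑ i, f (e m) (e i) (e j) * g (d i) (d m) (d j) := fun m j => by
    simp only [← hf, ← hg]
    exact sum_swap x (LinearMap.mk₂ ℝ (fun a b => k x (e m) a (e j) * k x (T x b) (d m) (d j))
      (by intros; simp; ring) (by intros; simp; ring) (by intros; simp; ring)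
      (by intros; simp; ring))
  have s3 : ∀ m i, ∑ j, f (d j) (e m) (e i) * g (e j) (d m) (d i) =
      ∑ j, f (e j) (e m) (e i) * g (d j) (d m) (d i) := fun m i => by
    simp only [← hf, ← hg]
    exact sum_swap x (LinearMap.mk₂ ℝ (fun a b => k x a (e m) (e i) * k x (T x b) (d m) (d i))
      (by intros; simp; ring) (by intros; simp; ring) (by intros; simp; ring)
      (by intros; simp; ring))
  have e1 : ∀ m, C.quadTerm k x (e m) (T x (d m)) =
      ∑ i, ∑ j, f (d i) (e m) (e j) * g (d m) (e i) (d j) +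
      ∑ i, ∑ j, f (e m) (d i) (e j) * g (e i) (d m) (d j) -
      ∑ i, ∑ j, f (d j) (e m) (e i) * g (e j) (d m) (d i) := by
    intro m
    rw [h.quadTerm_eq]
    have hvv : ∀ a b c d', C.metric x (C.vec k x a b) (C.vec k x c d') =
        ∑ j, k x a b (e j) * k x c d' (d j) := fun a b c d' => by
      rw [hexp]; simp only [metric_vec]
    have hcc : ∀ a b c d', C.metric x (C.covec k x a b) (C.covec k x c d') =
        ∑ j, k x (e j) a b * k x (d j) c d' := fun a b c d' => by
      rw [hexp]; simp only [metric_covec]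
    simp only [hvv, hcc, Finset.sum_add_distrib]
    rw [sub_eq_add_neg, ← Finset.sum_neg_distrib]
    congr 1
    · congr 1
      · exact Finset.sum_congr rfl fun i _ => Finset.sum_congr rfl fun j _ => by rw [← hf, ← hg]
      · exact Finset.sum_congr rfl fun i _ => Finset.sum_congr rfl fun j _ => by
          rw [← hf, ← hg, h.left]
    · refine Finset.sum_congr rfl fun i _ => ?_
      rw [← Finset.sum_neg_distrib]
      refine Finset.sum_congr rfl fun j _ => ?_
      rw [← hf, ← hg, h.left, h.skew x (e j) (d i), ← h.left, h.left]
      ring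
  rw [Finset.sum_congr rfl fun m _ => e1 m, Finset.sum_sub_distrib, Finset.sum_add_distrib]
  have X : ∑ a, ∑ b, ∑ c, f (e a) (e b) (e c) * g (d b) (d a) (d c) =
      ∑ a, ∑ b, ∑ c, f (e a) (e b) (e c) * g (d a) (d b) (d c) -
      ∑ a, ∑ b, ∑ c, f (e a) (e b) (e c) * g (d b) (d a) (d c) := by
    rw [← Finset.sum_sub_distrib]
    refine Finset.sum_congr rfl fun a _ => ?_
    have h1 : ∑ b, ∑ c, f (e a) (e b) (e c) * g (d b) (d a) (d c) =
        -∑ b, ∑ c, f (e a) (e b) (e c) * g (d c) (d a) (d b) := by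
      rw [Finset.sum_comm]
      simp only [← Finset.sum_neg_distrib]
      refine Finset.sum_congr rfl fun b _ => Finset.sum_congr rfl fun c _ => ?_
      rw [hfskew (e a) (e c)]
      ring
    have h2 : ∑ b, ∑ c, f (e a) (e b) (e c) * g (d b) (d a) (d c) =
        ∑ b, ∑ c, f (e a) (e b) (e c) * g (d a) (d b) (d c) +
        ∑ b, ∑ c, f (e a) (e b) (e c) * g (d c) (d a) (d b) := by
      simp only [← Finset.sum_add_distrib]
      refine Finset.sum_congr rfl fun b _ => Finset.sum_congr rfl fun c _ => ?_
      rw [hgcyc (d a) (d b) (d c)]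
      ring
    linarith
  have X1 : ∑ m, ∑ i, ∑ j, f (d i) (e m) (e j) * g (d m) (e i) (d j) =
      ∑ a, ∑ b, ∑ c, f (e a) (e b) (e c) * g (d b) (d a) (d c) := by
    rw [Finset.sum_comm]
    rw [Finset.sum_comm]
    conv_rhs => rw [Finset.sum_comm]
    refine Finset.sum_congr rfl fun m _ => ?_
    rw [Finset.sum_comm]
    conv_rhs => rw [Finset.sum_comm]
    exact Finset.sum_congr rfl fun j _ => s1 m j
  have X2 : ∑ m, ∑ i, ∑ j, f (e m) (d i) (e j) * g (e i) (d m) (d j) =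
      ∑ a, ∑ b, ∑ c, f (e a) (e b) (e c) * g (d b) (d a) (d c) := by
    refine Finset.sum_congr rfl fun m _ => ?_
    rw [Finset.sum_comm]
    conv_rhs => rw [Finset.sum_comm]
    exact Finset.sum_congr rfl fun j _ => s2 m j
  have X3 : ∑ m, ∑ i, ∑ j, f (d j) (e m) (e i) * g (e j) (d m) (d i) =
      ∑ a, ∑ b, ∑ c, f (e a) (e b) (e c) * g (d a) (d b) (d c) := by
    simp only [s3]
    have : ∀ m, ∑ i, ∑ j, f (e j) (e m) (e i) * g (d j) (d m) (d i) =
      ∑ j, ∑ i, f (e j) (e m) (e i) * g (d j) (d m) (d i) := fun m => Finset.sum_comm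
    simp only [this]
    rw [Finset.sum_comm]
  rw [X1, X2, X3]
  linarith

end IsPure

end CourantAlgebroid
end

noncomputable section

namespace CourantAlgebroid

variable {n : ℕ} {H : Type*} [TopologicalSpace H]
  {I : ModelWithCorners ℝ (EuclideanSpace ℝ (Fin n)) H}
  {M : Type*} [TopologicalSpace M] [ChartedSpace H M] [IsManifold I ∞ M]
  {F : Type*} [NormedAddCommGroup F] [NormedSpace ℝ F]
  {E : M → Type*} [TopologicalSpace (TotalSpace F E)] [∀ x, TopologicalSpace (E x)]
  [∀ x, AddCommGroup (E x)] [∀ x, Module ℝ (E x)] [FiberBundle F E] [VectorBundle ℝ F E]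
  [T2Space M] [FiniteDimensional ℝ F] [ContMDiffVectorBundle ∞ F E I]

/-! ## Comparison of Levi-Civita connections -/

theorem exists_section_eq (x : M) (v : TangentSpace I x) : ∃ X : SmoothVectorField I M, X x = v :=
  ⟨ext (I := I) (F := EuclideanSpace ℝ (Fin n)) (E := fun y : M => TangentSpace I y) x v,
    ext_apply (I := I) (F := EuclideanSpace ℝ (Fin n)) (E := fun y : M => TangentSpace I y) x v⟩

theorem exists_topForm_ne_zero {vol : TopForm I M} (hvol : IsVolumeForm I vol) (x : M) :
    ∃ Y : Fin n → SmoothVectorField I M, vol x (fun i => Y i x) ≠ 0 := by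
  obtain ⟨v, hv⟩ : ∃ v, vol x v ≠ 0 := by
    by_contra! h
    exact hvol.ne_zero x (AlternatingMap.ext h)
  choose Y hY using fun i => exists_section_eq (I := I) x (v i)
  refine ⟨Y, ?_⟩
  simp only [hY]
  exact hv

namespace Connection

variable {C : CourantAlgebroid I F E} (D D' : C.Connection)

/-- Two connections differ by a tensor. -/
theorem exists_isSum : ∃ k : TriForm E, IsSum D' D k := by
  have h1 : ∀ (ψ ψ₁ φ : Cₛ^∞⟮I; F, E⟯) (x : M), ψ x = ψ₁ x →
      D'.cov ψ φ x - D.cov ψ φ x = D'.cov ψ₁ φ x - D.cov ψ₁ φ x := fun ψ ψ₁ φ x h => by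
    rw [D'.cov_congr_left h, D.cov_congr_left h]
  have h2 : ∀ (ψ φ φ₁ : Cₛ^∞⟮I; F, E⟯) (x : M), φ x = φ₁ x →
      D'.cov ψ φ x - D.cov ψ φ x = D'.cov ψ φ₁ x - D.cov ψ φ₁ x := fun ψ φ φ₁ x h =>
    C.tensorial ((evalAt I F x).comp (D'.cov ψ - D.cov ψ)) (fun f χ => by
      change D'.cov ψ (smulSection f χ) x - D.cov ψ (smulSection f χ) x =
        f x • (D'.cov ψ χ x - D.cov ψ χ x)
      rw [D'.smul_right, D.smul_right]
      module) h
  refine ⟨fun x => mkTri (fun a b c => C.metric x (D'.cov (ext x a) (ext x b) x -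
    D.cov (ext x a) (ext x b) x) c) ?_ ?_ ?_ ?_ ?_ ?_, fun ψ φ χ x => ?_⟩
  · intros; simp; ring
  · intros; simp; ring
  · intros; simp; ring
  · intros; simp; ring
  · intros; simp; ring
  · intros; simp
  · change _ = _ + C.metric x (D'.cov (ext x (ψ x)) (ext x (φ x)) x -
      D.cov (ext x (ψ x)) (ext x (φ x)) x) (χ x)
    rw [h1 _ ψ _ x (ext_apply x _), h2 _ _ φ x (ext_apply x _)]
    simp

variable {D D'} {V : ∀ x, Submodule ℝ (E x)} {T : ∀ x, E x →ₗ[ℝ] E x} {k : TriForm E}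

theorem left_of_right (hT : C.IsSplitting V T)
    (hr : ∀ x a b c, k x a (T x b) c = k x a b (T x c))
    (hc : ∀ x a b c, k x a b c - k x b a c + k x c a b = 0) (x : M) (a b c : E x) :
    k x (T x a) b c = k x a (T x b) c := by
  have key : ∀ s : ℝ, s ≠ 0 → ∀ a b : E x, T x a = s • a → T x b = -s • b → ∀ c, k x a b c = 0 := by
    intro s hs a b ha hb c
    have h1 : ∀ c u v, T x u = s • u → T x v = -s • v → k x c u v = 0 := fun c u v hu hv => by
      have := hr x c u v
      rw [hu, hv] at this
      simp only [map_smul, LinearMap.smul_apply, smul_eq_mul] at this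
      have h2 : s * k x c u v = 0 := by linarith
      exact (mul_eq_zero.1 h2).resolve_left hs
    have h1' : ∀ c u v, T x u = -s • u → T x v = s • v → k x c u v = 0 := fun c u v hu hv => by
      have := hr x c u v
      rw [hu, hv] at this
      simp only [map_smul, LinearMap.smul_apply, smul_eq_mul] at this
      have h2 : s * k x c u v = 0 := by linarith
      exact (mul_eq_zero.1 h2).resolve_left hs
    have hss : s * s = 1 ∨ a = 0 := by
      have := hT.invol x a
      rw [ha, map_smul, ha, smul_smul] at this
      rcases eq_or_ne a 0 with h | h
      · exact Or.inr h
      · left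
        have h3 : (s * s - 1) • a = 0 := by rw [sub_smul, this, one_smul, sub_self]
        linarith [(smul_eq_zero.1 h3).resolve_right h]
    rcases hss with hss | rfl
    · have hplus : T x (c + s • T x c) = s • (c + s • T x c) := by
        rw [map_add, map_smul, hT.invol, smul_add, smul_smul, hss]; module
      have hminus : T x (c - s • T x c) = -s • (c - s • T x c) := by
        rw [map_sub, map_smul, hT.invol, smul_sub, smul_smul, neg_mul, hss]; module
      have e1 := h1' a b _ hb hplus
      have e2 := hc x a b (c - s • T x c)
      rw [h1 b a _ ha hminus, h1 _ a b ha hb] at e2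
      simp only [map_add, map_sub, map_smul] at e1 e2
      linarith
    · simp
  have e1 := key 1 one_ne_zero (a + T x a) (b - T x b) (by
    rw [map_add, hT.invol]; module) (by rw [map_sub, hT.invol]; module) c
  have e2 := key (-1) (by norm_num) (a - T x a) (b + T x b) (by
    rw [map_sub, hT.invol]; module) (by rw [map_add, hT.invol]; module) c
  simp only [map_add, map_sub, LinearMap.add_apply, LinearMap.sub_apply] at e1 e2
  linarith

theorem IsSum.right (h : IsSum D' D k) (hT : C.IsSplitting V T)
    (hD : ∀ ψ ψ' : Cₛ^∞⟮I; F, E⟯, (∀ x, ψ' x ∈ V x) → ∀ x, D.cov ψ ψ' x ∈ V x)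
    (hD' : ∀ ψ ψ' : Cₛ^∞⟮I; F, E⟯, (∀ x, ψ' x ∈ V x) → ∀ x, D'.cov ψ ψ' x ∈ V x)
    (x : M) (a b c : E x) : k x a (T x b) c = k x a b (T x c) := by
  have h1 := h (ext x a) (hT.onSection (ext x b)) (ext x c) x
  have h2 := h (ext x a) (ext x b) (hT.onSection (ext x c)) x
  rw [hT.cov_onSection hD, hT.cov_onSection hD', hT.symm, hT.symm] at h1
  simp only [IsSplitting.onSection_apply, ext_apply] at h1 h2
  linarith

theorem IsLeviCivita.isPure {vol : TopForm I M} (hvol : IsVolumeForm I vol)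
    (hT : C.IsSplitting V T) (hD : D.IsLeviCivita V vol) (hD' : D'.IsLeviCivita V vol)
    (h : IsSum D' D k) : C.IsPure T k := by
  have hr := h.right hT hD.metric_compatible hD'.metric_compatible
  have hc : ∀ x a b c, k x a b c - k x b a c + k x c a b = 0 := fun x a b c => by
    have := h.torsion_eq (ext x a) (ext x b) (ext x c) x
    rw [hD.torsion_free, hD'.torsion_free] at this
    simp only [ext_apply] at this
    linarith
  refine ⟨h.skew, hc, left_of_right hT hr hc, hr, fun x v => ?_⟩
  obtain ⟨Y, hY⟩ := exists_topForm_ne_zero hvol x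
  have h1 := (hD.divergence_eq (ext x v) Y x).symm.trans (hD'.divergence_eq (ext x v) Y x)
  have h2 := mul_right_cancel₀ hY h1
  have h3 := h.divergence_eq (ext x v) x
  rw [ext_apply] at h3
  linarith

section Pure

variable (hk : k.Smooth I F) (h : C.IsPure T k) (hT : C.IsSplitting V T)
  (hD : ∀ ψ ψ' : Cₛ^∞⟮I; F, E⟯, (∀ x, ψ' x ∈ V x) → ∀ x, D.cov ψ ψ' x ∈ V x)
include hk h

theorem sum_covTriForm (x : M) (w v : E x) :
    ∑ i, D.covTriForm hk x w (frameBasis I F E x i) v (C.dualFrame x i) = 0 := by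
  let φ : Cₛ^∞⟮I; F, E⟯ := ext x v
  let B : ∀ y, E y →ₗ[ℝ] E y →ₗ[ℝ] ℝ := fun y => (k y).flip (φ y)
  have h1 := D.der_tr (B := B) (fun a b => hk a φ b) (ext x w) x
  have h2 : (fun y => C.tr y (B y)) = fun _ => 0 := funext fun y => h.trace y (φ y)
  rw [h2, C.der_const] at h1
  have h3 := h.trace x (D.cov (ext x w) φ x)
  have h4 : ∀ i, D.covTriForm hk x w (frameBasis I F E x i) v (C.dualFrame x i) =
      D.covBi B (ext x w) (frame I F E x i) (ext x (C.dualFrame x i)) x -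
      k x (frameBasis I F E x i) (D.cov (ext x w) φ x) (C.dualFrame x i) := fun i => by
    have := D.covTriForm_apply hk (ext x w) (frame I F E x i) φ (ext x (C.dualFrame x i)) x
    rw [ext_apply, ext_apply, ext_apply, ← frameBasis_apply] at this
    rw [this, covTri, covBi, frameBasis_apply]
    simp only [B, LinearMap.flip_apply, ext_apply]
    ring
  rw [Finset.sum_congr rfl fun i _ => h4 i, Finset.sum_sub_distrib, ← h1, h3, sub_zero]

theorem covTriForm_skew (x : M) (w a b c : E x) :
    D.covTriForm hk x w a b c = -D.covTriForm hk x w a c b := by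
  have h1 := D.covTriForm_apply hk (ext x w) (ext x a) (ext x b) (ext x c) x
  have h2 := D.covTriForm_apply hk (ext x w) (ext x a) (ext x c) (ext x b) x
  simp only [ext_apply] at h1 h2
  rw [h1, h2, covTri, covTri]
  have h3 : (fun y => k y (ext (I := I) (F := F) x a y) (ext (I := I) (F := F) x b y)
      (ext (I := I) (F := F) x c y)) = fun y => (-1) * k y (ext (I := I) (F := F) x a y)
      (ext (I := I) (F := F) x c y) (ext (I := I) (F := F) x b y) :=
    funext fun y => by rw [h.skew]; ring
  rw [h3, C.der_const_mul _ _ (hk _ _ _), h.skew x _ _ (ext (I := I) (F := F) x c x),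
    h.skew x _ (D.cov (ext x w) (ext x b) x), h.skew x _ _ (D.cov (ext x w) (ext x c) x)]
  ring

include hT hD

theorem covTriForm_left (x : M) (w a b c : E x) :
    D.covTriForm hk x w (T x a) b c = D.covTriForm hk x w a (T x b) c := by
  have h1 := D.covTriForm_apply hk (ext x w) (hT.onSection (ext x a)) (ext x b) (ext x c) x
  have h2 := D.covTriForm_apply hk (ext x w) (ext x a) (hT.onSection (ext x b)) (ext x c) x
  simp only [ext_apply, IsSplitting.onSection_apply] at h1 h2
  rw [h1, h2, covTri, covTri]
  simp only [hT.cov_onSection hD, IsSplitting.onSection_apply, h.left]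

theorem linTerm_mixed (x : M) {u v : E x} (hu : T x u = u) (hv : T x v = -v) :
    C.linTerm (D.covTriForm hk x) u v = 0 := by
  set N := D.covTriForm hk x
  have hs : ∀ w a b c, N w a b c = -N w a c b := covTriForm_skew hk h x
  have hl : ∀ w a b c, N w (T x a) b c = N w a (T x b) c := covTriForm_left hk h hT hD x
  have s0 : ∀ w v, ∑ i, N w (frameBasis I F E x i) v (C.dualFrame x i) = 0 :=
    sum_covTriForm hk h x
  clear_value N
  have z1 : ∀ w c, N w v u c = 0 := fun w c => by
    have := hl w v u c
    rw [hu, hv] at this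
    simp only [map_neg, LinearMap.neg_apply] at this
    linarith
  have z2 : ∀ w c, N w u c v = 0 := fun w c => by
    have := hl w u v c
    rw [hu, hv] at this
    simp only [map_neg, LinearMap.neg_apply] at this
    rw [hs]
    linarith
  have s1 : ∑ i, N v (C.dualFrame x i) u (frameBasis I F E x i) = 0 := by
    have h1 := sum_swap (C := C) x ((N v).flip u)
    simp only [LinearMap.flip_apply] at h1
    rw [h1, s0]
  have s2 : ∑ i, N u (frameBasis I F E x i) (C.dualFrame x i) v = 0 := by
    simp only [hs u _ _ v, Finset.sum_neg_distrib]
    rw [s0, neg_zero]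
  simp only [linTerm, z1, z2, Finset.sum_add_distrib, Finset.sum_sub_distrib, s1, s2]
  simp

theorem sum_linTerm_eq_zero (x : M) :
    ∑ m, C.linTerm (D.covTriForm hk x) (frameBasis I F E x m) (T x (C.dualFrame x m)) = 0 := by
  rw [D.sum_linTerm_eq hk h.skew hT.smooth hT.symm (fun ψ φ φ' hφ y => by
    have : φ' = hT.onSection φ := ContMDiffSection.ext hφ
    rw [this, hT.cov_onSection hD])]
  have : xiSection hk hT.smooth = 0 := ContMDiffSection.ext fun y => C.metric_ext fun u => by
    rw [metric_xiSection, h.xi_eq_zero]; simp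
  rw [this]
  simp [divergence]

end Pure

variable {vol : TopForm I M} (hvol : IsVolumeForm I vol) (hT : C.IsSplitting V T)
  (hD : D.IsLeviCivita V vol) (hD' : D'.IsLeviCivita V vol)
include hvol hT hD hD'

theorem IsLeviCivita.ricciForm_eq (x : M) {u v : E x} (hu : T x u = u) (hv : T x v = -v) :
    D'.ricciForm x u v = D.ricciForm x u v := by
  obtain ⟨k, hk⟩ := exists_isSum D D'
  have hp := hD.isPure hvol hT hD' hk
  have := hk.ricci_eq hD.torsion_free x u v
  rw [linTerm_mixed hk.smooth hp hT hD.metric_compatible x hu hv, hp.quadTerm_mixed x hT hu hv]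
    at this
  linarith

theorem IsLeviCivita.ricci_eq {ψ ψ' : Cₛ^∞⟮I; F, E⟯} (hψ : ∀ x, ψ x ∈ V x)
    (hψ' : ∀ x, ψ' x ∈ C.perp V x) (x : M) : D'.ricci ψ ψ' x = D.ricci ψ ψ' x := by
  rw [← ricciForm_apply, ← ricciForm_apply]
  exact hD.ricciForm_eq hvol hT hD' x ((hT.mem_iff x _).1 (hψ x)) ((hT.mem_perp_iff x _).1 (hψ' x))

theorem IsLeviCivita.scalarCurvature_eq (x : M) :
    D'.scalarCurvature (C.genMetric V) x = D.scalarCurvature (C.genMetric V) x := by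
  obtain ⟨k, hk⟩ := exists_isSum D D'
  have hp := hD.isPure hvol hT hD' hk
  rw [hT.scalarCurvature_eq, hT.scalarCurvature_eq]
  have h1 := sum_linTerm_eq_zero hk.smooth hp hT hD.metric_compatible x
  have h2 := hp.sum_quadTerm x hT
  have h3 : 2 * ∑ m, D'.ricciForm x (frameBasis I F E x m) (T x (C.dualFrame x m)) =
      2 * ∑ m, D.ricciForm x (frameBasis I F E x m) (T x (C.dualFrame x m)) := by
    rw [Finset.mul_sum, Finset.sum_congr rfl fun m _ => hk.ricci_eq hD.torsion_free x _ _,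
      Finset.sum_add_distrib, Finset.sum_add_distrib, h1, h2, ← Finset.mul_sum]
    ring
  linarith

omit hvol hD' in
theorem isRicciCompatible_iff : D.IsRicciCompatible V ↔
    ∀ x (u v : E x), T x u = u → T x v = -v → D.ricciForm x u v = 0 := by
  constructor
  · intro h x u v hu hv
    let ψ : Cₛ^∞⟮I; F, E⟯ := (1 / 2 : ℝ) • (ext x u + hT.onSection (ext x u))
    let ψ' : Cₛ^∞⟮I; F, E⟯ := (1 / 2 : ℝ) • (ext x v - hT.onSection (ext x v))
    have h1 : ψ x = u := by
      simp only [ψ, section_smul_apply, section_add_apply, IsSplitting.onSection_apply, ext_apply, hu]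
      module
    have h2 : ψ' x = v := by
      simp only [ψ', section_smul_apply, section_sub_apply, IsSplitting.onSection_apply, ext_apply,
        hv]
      module
    rw [← h1, ← h2, ricciForm_apply]
    refine h _ _ (fun y => ?_) (fun y => ?_) x
    · rw [hT.mem_iff]
      simp only [ψ, section_smul_apply, section_add_apply, IsSplitting.onSection_apply, map_smul,
        map_add, hT.invol]
      rw [add_comm]
    · rw [hT.mem_perp_iff]
      simp only [ψ', section_smul_apply, section_sub_apply, IsSplitting.onSection_apply, map_smul,
        map_sub, hT.invol]
      module
  · intro h ψ ψ' hψ hψ' x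
    rw [← ricciForm_apply]
    exact h x _ _ ((hT.mem_iff x _).1 (hψ x)) ((hT.mem_perp_iff x _).1 (hψ' x))

end Connection

end CourantAlgebroid
end

noncomputable section

namespace CourantAlgebroid

variable {n : ℕ} {H : Type*} [TopologicalSpace H]
  {I : ModelWithCorners ℝ (EuclideanSpace ℝ (Fin n)) H}
  {M : Type*} [TopologicalSpace M] [ChartedSpace H M] [IsManifold I ∞ M]
  {F : Type*} [NormedAddCommGroup F] [NormedSpace ℝ F]
  {E : M → Type*} [TopologicalSpace (TotalSpace F E)] [∀ x, TopologicalSpace (E x)]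
  [∀ x, AddCommGroup (E x)] [∀ x, Module ℝ (E x)] [FiberBundle F E] [VectorBundle ℝ F E]
  [T2Space M] [FiniteDimensional ℝ F] [ContMDiffVectorBundle ∞ F E I]

/-! ## The splitting defined by a generalized metric -/

variable {C : CourantAlgebroid I F E} {V : ∀ x, Submodule ℝ (E x)}

theorem finiteDimensional_fibre (I : ModelWithCorners ℝ (EuclideanSpace ℝ (Fin n)) H)
    [IsManifold I ∞ M] [ContMDiffVectorBundle ∞ F E I] (x : M) : FiniteDimensional ℝ (E x) :=
  Module.Finite.of_basis (frameBasis I F E x)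

theorem trace_eq_sum (C : CourantAlgebroid I F E) (x : M) (f : E x →ₗ[ℝ] E x) :
    LinearMap.trace ℝ (E x) f = ∑ i, C.metric x (f (frameBasis I F E x i)) (C.dualFrame x i) := by
  rw [LinearMap.trace_eq_matrix_trace ℝ (frameBasis I F E x), Matrix.trace]
  refine Finset.sum_congr rfl fun i _ => ?_
  rw [Matrix.diag_apply, LinearMap.toMatrix_apply, ← coord_eq]
  rfl

theorem finrank_fibre (I : ModelWithCorners ℝ (EuclideanSpace ℝ (Fin n)) H)
    [IsManifold I ∞ M] [ContMDiffVectorBundle ∞ F E I] (x : M) :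
    finrank ℝ (E x) = finrank ℝ F := by
  rw [finrank_eq_card_basis (frameBasis I F E x), Fintype.card_fin]

theorem IsSplitting.sum_metric {T : ∀ x, E x →ₗ[ℝ] E x} (hT : C.IsSplitting V T) (x : M) :
    ∑ i, C.metric x (T x (frameBasis I F E x i)) (C.dualFrame x i) =
      2 * finrank ℝ (V x) - finrank ℝ F := by
  have := finiteDimensional_fibre (F := F) (E := E) I x
  have h1 : LinearMap.IsProj (V x) ((1 / 2 : ℝ) • (LinearMap.id + T x)) := by
    constructor
    · intro v
      rw [hT.mem_iff, LinearMap.smul_apply, LinearMap.add_apply, map_smul, map_add,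
        LinearMap.id_apply, hT.invol, add_comm]
    · intro v hv
      rw [LinearMap.smul_apply, LinearMap.add_apply, LinearMap.id_apply, (hT.mem_iff x v).1 hv]
      module
  have h2 := h1.trace
  rw [map_smul, map_add, LinearMap.trace_id, finrank_fibre (F := F) I x, C.trace_eq_sum,
    smul_eq_mul] at h2
  linarith

theorem finrank_eq_of_isGeneralizedMetric {p q : ℕ} (hsig : C.HasSignature p q)
    (hV : C.IsGeneralizedMetric V) (x : M) (hc : IsCompl (V x) (C.perp V x)) :
    finrank ℝ (V x) = p ∧ finrank ℝ F = p + q := by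
  have := finiteDimensional_fibre (F := F) (E := E) I x
  obtain ⟨P, N, hPN, -, hP, hN, hp, hq⟩ := hsig x
  have hsum := Submodule.finrank_add_eq_of_isCompl hPN
  have hsum' := Submodule.finrank_add_eq_of_isCompl hc
  have h1 : finrank ℝ (V x) + finrank ℝ N ≤ finrank ℝ (E x) := by
    apply Submodule.finrank_add_finrank_le_of_disjoint
    rw [Submodule.disjoint_def]
    intro v hv hv'
    by_contra h0
    exact lt_asymm (hV.pos x v hv h0) (hN v hv' h0)
  have hneg : ∀ v ∈ C.perp V x, C.metric x v v ≤ 0 := by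
    intro v hv
    by_contra! hpos
    have hW := hV.maximal x (V x ⊔ Submodule.span ℝ {v}) (by
      intro w hw hw0
      obtain ⟨a, ha, b, hb, rfl⟩ := Submodule.mem_sup.1 hw
      obtain ⟨c, rfl⟩ := Submodule.mem_span_singleton.1 hb
      have h0 : C.metric x a v = 0 := hv a ha
      simp only [map_add, map_smul, LinearMap.add_apply, LinearMap.smul_apply, smul_eq_mul, h0,
        C.metric_comm x v a]
      rcases eq_or_ne a 0 with rfl | ha0
      · have hc0 : c ≠ 0 := by rintro rfl; simp at hw0
        simp only [map_zero]
        have : 0 < c * c := mul_self_pos.2 hc0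
        nlinarith [mul_pos this hpos]
      · nlinarith [hV.pos x a ha ha0, mul_nonneg (mul_self_nonneg c) hpos.le]) le_sup_left
    have hvV : v ∈ V x := by
      rw [← hW]; exact Submodule.mem_sup_right (Submodule.mem_span_singleton_self v)
    have : C.metric x v v = 0 := hv v hvV
    linarith
  have h2 : finrank ℝ (C.perp V x) + finrank ℝ P ≤ finrank ℝ (E x) := by
    apply Submodule.finrank_add_finrank_le_of_disjoint
    rw [Submodule.disjoint_def]
    intro v hv hv'
    by_contra h0
    exact absurd (hP v hv' h0) (not_lt.2 (hneg v hv))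
  rw [finrank_fibre (F := F) I x] at *
  omega

theorem isCompl_of_isGeneralizedMetric (hV : C.IsGeneralizedMetric V) (x : M) :
    IsCompl (V x) (C.perp V x) := by
  have := finiteDimensional_fibre (F := F) (E := E) I x
  refine LinearMap.BilinForm.isCompl_orthogonal_of_restrict_nondegenerate
    (C.metric_symm x).isRefl ?_
  have h : ∀ v : V x, (∀ w : V x, (C.metric x).restrict (V x) v w = 0) → v = 0 := by
    rintro ⟨v, hv⟩ h
    by_contra h0
    exact (hV.pos x v hv fun h1 => h0 (Subtype.ext h1)).ne' (h ⟨v, hv⟩)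
  refine ⟨h, fun v hv => h v fun w => ?_⟩
  have := hv w
  change C.metric x _ _ = 0 at this
  change C.metric x _ _ = 0
  rw [C.metric_comm]
  exact this

theorem IsGeneralizedMetric.exists_isSplitting (hV : C.IsGeneralizedMetric V) :
    ∃ T, C.IsSplitting V T := by
  have hc := isCompl_of_isGeneralizedMetric hV
  let P : ∀ x, E x →ₗ[ℝ] E x := fun x => (V x).projection (C.perp V x) (hc x)
  have hP : ∀ x v, P x v ∈ V x := fun x v => Submodule.projection_apply_mem (hc x) v
  have hP1 : ∀ x, ∀ v ∈ V x, P x v = v := fun x v hv =>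
    Submodule.projection_apply_of_mem_left (hc x) hv
  have hP2 : ∀ x, ∀ v ∈ C.perp V x, P x v = 0 := fun x v hv =>
    Submodule.projection_apply_of_mem_right (hc x) hv
  have hP3 : ∀ x v, v - P x v ∈ C.perp V x := fun x v => by
    obtain ⟨a, ha, b, hb, rfl⟩ := Submodule.mem_sup.1
      ((hc x).sup_eq_top ▸ Submodule.mem_top : v ∈ V x ⊔ C.perp V x)
    rw [map_add, hP1 x a ha, hP2 x b hb]
    simpa using hb
  have hg : ∀ x u v, C.metric x (P x u) v = C.metric x (P x u) (P x v) := fun x u v => by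
    have : C.metric x (P x u) (v - P x v) = 0 := hP3 x v _ (hP x u)
    rw [map_sub] at this
    linarith
  refine ⟨fun x => (2 : ℝ) • P x - LinearMap.id, ?_, ?_, ?_, ?_⟩
  · intro x v
    rw [LinearMap.sub_apply, LinearMap.smul_apply, LinearMap.id_apply]
    constructor
    · intro hv
      rw [hP1 x v hv]; module
    · intro h
      have : P x v = v := by
        have h2 : (2 : ℝ) • P x v = (2 : ℝ) • v := by rw [sub_eq_iff_eq_add] at h; rw [h]; module
        exact smul_right_injective _ (two_ne_zero (α := ℝ)) h2
      rw [← this]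
      exact hP x v
  · intro x v
    simp only [LinearMap.sub_apply, LinearMap.smul_apply, LinearMap.id_apply, map_sub, map_smul,
      hP1 x _ (hP x v)]
    module
  · intro x u v
    simp only [LinearMap.sub_apply, LinearMap.smul_apply, LinearMap.id_apply, map_sub, map_smul]
    rw [hg x u v, C.metric_comm x u (P x v), hg x v u, C.metric_comm x (P x u)]
  · intro s s'
    refine .of_function ?_
    have hsm : ContMDiff I 𝓘(ℝ, ℝ) ∞ fun x => C.metric x (P x (s x)) (s' x) := by
      intro x
      classical
      obtain ⟨k, b, hb⟩ := hV.smooth x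
      let G : M → Matrix (Fin k) (Fin k) ℝ := fun y => Matrix.of fun i j =>
        C.metric y (b i y) (b j y)
      have hG : ∀ y i j, ContMDiffAt I 𝓘(ℝ, ℝ) ∞ (fun y => G y i j) y := fun y i j =>
        C.metric_smooth (b i) (b j) y
      have hdet : ∀ᶠ y in 𝓝 x, (G y).det ≠ 0 := hb.mono fun y ⟨hli, hsp⟩ h0 => by
        obtain ⟨c, hc0, hGc⟩ := Matrix.exists_mulVec_eq_zero_iff.2 h0
        have hmem : ∑ j, c j • b j y ∈ V y := by
          rw [← hsp]
          exact Submodule.sum_mem _ fun j _ => Submodule.smul_mem _ _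
            (Submodule.subset_span ⟨j, rfl⟩)
        have h1 : ∀ i, C.metric y (b i y) (∑ j, c j • b j y) = 0 := fun i => by
          have := congrFun hGc i
          rw [Matrix.mulVec, dotProduct] at this
          rw [map_sum]
          simp only [map_smul, smul_eq_mul]
          refine Eq.trans (Finset.sum_congr rfl fun j _ => ?_) this
          simp only [G, Matrix.of_apply]; ring
        have h2 : ∑ j, c j • b j y = 0 := by
          by_contra hne
          refine (hV.pos y _ hmem hne).ne' ?_
          rw [map_sum]
          exact Finset.sum_eq_zero fun i _ => by
            rw [map_smul, C.metric_comm, h1, smul_zero]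
        exact hc0 (funext fun j => Fintype.linearIndependent_iff.1 hli c h2 j)
      have hform : (fun y => C.metric y (P y (s y)) (s' y)) =ᶠ[𝓝 x] fun y =>
          ∑ i, ∑ j, (G y)⁻¹ i j * C.metric y (b j y) (s y) * C.metric y (b i y) (s' y) := by
        filter_upwards [hb, hdet] with y ⟨hli, hsp⟩ hdy
        have hbV : ∀ i, b i y ∈ V y := fun i => by
          rw [← hsp]; exact Submodule.subset_span ⟨i, rfl⟩
        let w : E y := ∑ i, ∑ j, ((G y)⁻¹ i j * C.metric y (b j y) (s y)) • b i y
        have hw : w ∈ V y := Submodule.sum_mem _ fun i _ => Submodule.sum_mem _ fun j _ =>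
          Submodule.smul_mem _ _ (hbV i)
        have hbw : ∀ l, C.metric y (b l y) w = C.metric y (b l y) (s y) := fun l => by
          simp only [w, map_sum, map_smul, smul_eq_mul]
          rw [Finset.sum_comm]
          have h3 : G y * (G y)⁻¹ = 1 := Matrix.mul_nonsing_inv _ (Ne.isUnit hdy)
          have h4 : ∀ j, ∑ i, (G y)⁻¹ i j * C.metric y (b j y) (s y) * C.metric y (b l y) (b i y) =
              (if l = j then 1 else 0) * C.metric y (b j y) (s y) := fun j => by
            rw [← Matrix.one_apply, ← h3, Matrix.mul_apply, Finset.sum_mul]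
            refine Finset.sum_congr rfl fun i _ => ?_
            simp only [G, Matrix.of_apply]; ring
          simp only [h4, ite_mul, one_mul, zero_mul, Finset.sum_ite_eq, Finset.mem_univ, if_true]
        have hperp : s y - w ∈ C.perp V y := by
          intro u hu
          change C.metric y u (s y - w) = 0
          rw [← hsp] at hu
          induction hu using Submodule.span_induction with
          | mem u hu => obtain ⟨l, rfl⟩ := hu; rw [map_sub, hbw, sub_self]
          | zero => simp
          | add u u' _ _ h h' => rw [map_add, LinearMap.add_apply, h, h', add_zero]
          | smul c u _ h => rw [map_smul, LinearMap.smul_apply, h, smul_zero]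
        have hPw : P y (s y) = w := by
          have h5 : s y = w + (s y - w) := by abel
          rw [h5, map_add, hP1 y w hw, hP2 y _ hperp, add_zero]
        rw [hPw]
        simp only [w, map_sum, LinearMap.sum_apply, map_smul, LinearMap.smul_apply, smul_eq_mul]
      refine ContMDiffAt.congr_of_eventuallyEq ?_ hform
      refine ContMDiffAt.sum fun i _ => ContMDiffAt.sum fun j _ => ?_
      exact ((contMDiffAt_matrix_inv (hG x) hdet.self_of_nhds i j).mul
        (C.metric_smooth (b j) s x)).mul (C.metric_smooth (b i) s' x)
    refine ((contMDiff_const (c := (2 : ℝ))).mul hsm |>.sub (C.metric_smooth s s')).congr fun x => ?_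
    simp [LinearMap.sub_apply, LinearMap.smul_apply]

end CourantAlgebroid
end

noncomputable section

namespace CourantAlgebroid

variable {n : ℕ} {H : Type*} [TopologicalSpace H]
  {I : ModelWithCorners ℝ (EuclideanSpace ℝ (Fin n)) H}
  {M : Type*} [TopologicalSpace M] [ChartedSpace H M] [IsManifold I ∞ M]
  {F : Type*} [NormedAddCommGroup F] [NormedSpace ℝ F]
  {E : M → Type*} [TopologicalSpace (TotalSpace F E)] [∀ x, TopologicalSpace (E x)]
  [∀ x, AddCommGroup (E x)] [∀ x, Module ℝ (E x)] [FiberBundle F E] [VectorBundle ℝ F E]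
  [T2Space M] [FiniteDimensional ℝ F] [ContMDiffVectorBundle ∞ F E I]

/-! ## Families of endomorphisms and conjugated splittings -/

variable {C : CourantAlgebroid I F E} {V : ∀ x, Submodule ℝ (E x)} {T : ∀ x, E x →ₗ[ℝ] E x}

/-- The inverse of a smooth family of automorphisms is smooth. -/
theorem weakSmooth_inverse {L B : ℝ → ∀ x, E x →ₗ[ℝ] E x}
    (hL : ∀ s : Cₛ^∞⟮I; F, E⟯, C.WeakSmooth fun t x => L t x (s x))
    (hLB : ∀ t x v, L t x (B t x v) = v) (s : Cₛ^∞⟮I; F, E⟯) :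
    C.WeakSmooth fun t x => B t x (s x) := by
  intro s'
  refine SmoothFamily.of_eventually fun t x => ?_
  obtain ⟨a, b, hab⟩ := C.exists_dual_sections x
  let A : ℝ × M → Matrix (Fin (finrank ℝ F)) (Fin (finrank ℝ F)) ℝ := fun p =>
    Matrix.of fun i j => C.metric p.2 (L p.1 p.2 (a j p.2)) (b i p.2)
  let N : ℝ × M → Matrix (Fin (finrank ℝ F)) (Fin (finrank ℝ F)) ℝ := fun p =>
    Matrix.of fun i j => C.metric p.2 (B p.1 p.2 (a j p.2)) (b i p.2)
  have hA : ∀ i j, ContMDiffAt (𝓘(ℝ, ℝ).prod I) 𝓘(ℝ, ℝ) ∞ (fun p => A p i j) (t, x) :=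
    fun i j => hL (a j) (b i) (t, x)
  have hAN : ∀ᶠ y in 𝓝 x, ∀ t, A (t, y) * N (t, y) = 1 := hab.mono fun y hy t => by
    ext i k
    have h1 : C.metric y (L t y (B t y (a k y))) (b i y) = if k = i then 1 else 0 := by
      rw [hLB]; exact hy.2.2 k i
    rw [← hy.1 (B t y (a k y))] at h1
    simp only [map_sum, map_smul, LinearMap.sum_apply, LinearMap.smul_apply, smul_eq_mul] at h1
    rw [Matrix.mul_apply, Matrix.one_apply]
    simp only [A, N, Matrix.of_apply, @eq_comm _ i k, ← h1, mul_comm]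
  refine ⟨fun t y => ∑ i, ∑ j, (A (t, y))⁻¹ i j * C.metric y (s y) (b j y) *
    C.metric y (a i y) (s' y), ?_, ?_⟩
  · refine ContMDiffAt.sum fun i _ => ContMDiffAt.sum fun j _ => ?_
    have hdet : (A (t, x)).det ≠ 0 := fun h0 => by
      have := congrArg Matrix.det (hAN.self_of_nhds t)
      rw [Matrix.det_mul, h0, zero_mul, Matrix.det_one] at this
      exact zero_ne_one this
    exact ((contMDiffAt_matrix_inv hA hdet i j).mul
      (SmoothFamily.of_function (C.metric_smooth s (b j)) (t, x))).mul
      (SmoothFamily.of_function (C.metric_smooth (a i) s') (t, x))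
  · filter_upwards [hab, hAN] with y hy hANy r
    rw [Matrix.inv_eq_right_inv (hANy r)]
    conv_lhs => rw [← hy.1 (B r y (s y))]
    simp only [map_sum, map_smul, LinearMap.sum_apply, LinearMap.smul_apply, smul_eq_mul]
    refine Finset.sum_congr rfl fun i _ => ?_
    rw [← Finset.sum_mul]
    congr 1
    conv_lhs => rw [← hy.1 (s y)]
    simp only [map_sum, map_smul, LinearMap.sum_apply, LinearMap.smul_apply, smul_eq_mul, N,
      Matrix.of_apply, mul_comm]

theorem eventually_injective {A : ∀ x, E x →ₗ[ℝ] E x}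
    (hA : ∀ s : Cₛ^∞⟮I; F, E⟯, C.WeakSmooth fun _ x => A x (s x)) (x : M) :
    ∀ᶠ p : ℝ × M in 𝓝 (0, x), ∀ v, v + p.1 • A p.2 v = 0 → v = 0 := by
  obtain ⟨a, b, hab⟩ := C.exists_dual_sections x
  let N : ℝ × M → Matrix (Fin (finrank ℝ F)) (Fin (finrank ℝ F)) ℝ := fun p =>
    Matrix.of fun i j => C.metric p.2 (a j p.2 + p.1 • A p.2 (a j p.2)) (b i p.2)
  have hN : Continuous N := by
    refine continuous_matrix fun i j => ?_
    have h1 : Continuous fun x => C.metric x (a j x) (b i x) := (C.metric_smooth _ _).continuous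
    have h2 : Continuous fun x => C.metric x (A x (a j x)) (b i x) :=
      ((hA (a j) (b i)).slice 0).continuous
    have h3 : (fun p => N p i j) = fun p : ℝ × M => C.metric p.2 (a j p.2) (b i p.2) +
        p.1 * C.metric p.2 (A p.2 (a j p.2)) (b i p.2) := by
      ext p; simp [N]
    rw [h3]
    exact (h1.comp continuous_snd).add (continuous_fst.mul (h2.comp continuous_snd))
  have h0 : (N (0, x)).det ≠ 0 := by
    have : N (0, x) = 1 := by
      ext i j
      simp [N, hab.self_of_nhds.2.2, Matrix.one_apply, eq_comm]
    rw [this, Matrix.det_one]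
    exact one_ne_zero
  have hev := hN.matrix_det.continuousAt.eventually_ne h0
  filter_upwards [hev, (continuous_snd.tendsto ((0 : ℝ), x)).eventually hab] with p hp hy v hv
  have h1 : (N p).mulVec (fun j => C.metric p.2 v (b j p.2)) = 0 := by
    ext i
    have h2 : C.metric p.2 (v + p.1 • A p.2 v) (b i p.2) = 0 := by rw [hv]; simp
    rw [← hy.1 v] at h2
    simp only [map_sum, map_smul, Finset.smul_sum, ← Finset.sum_add_distrib, LinearMap.sum_apply,
      smul_comm p.1, ← smul_add, LinearMap.smul_apply, smul_eq_mul] at h2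
    rw [Matrix.mulVec, dotProduct, Pi.zero_apply, ← h2]
    exact Finset.sum_congr rfl fun j _ => mul_comm _ _
  have h3 := Matrix.eq_zero_of_mulVec_eq_zero hp h1
  rw [← hy.1 v]
  exact Finset.sum_eq_zero fun j _ => by
    have := congrFun h3 j
    simp only [Pi.zero_apply] at this
    rw [this, zero_smul]

/-- For a compactly supported field of endomorphisms `A`, the maps `1 + ε A` are invertible for all
small `ε`. -/
theorem exists_inverse {A : ∀ x, E x →ₗ[ℝ] E x}
    (hA : ∀ s : Cₛ^∞⟮I; F, E⟯, C.WeakSmooth fun _ x => A x (s x)) {K : Set M} (hK : IsCompact K)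
    (hAK : ∀ x ∉ K, A x = 0) :
    ∃ δ : ℝ, 0 < δ ∧ ∃ B : ℝ → ∀ x, E x →ₗ[ℝ] E x, ∀ ε, |ε| ≤ δ →
      ∀ x v, B ε x v + ε • A x (B ε x v) = v ∧ B ε x (v + ε • A x v) = v := by
  have h0 : ∀ x ∈ K, ∀ᶠ p : ℝ × M in 𝓝 (0, x), ∀ v : E p.2, v + p.1 • A p.2 v = 0 → v = 0 :=
    fun x _ => eventually_injective hA x
  have h1 := hK.eventually_forall_of_forall_eventually (x₀ := (0 : ℝ))
    (P := fun (ε : ℝ) (x : M) => ∀ v : E x, v + ε • A x v = 0 → v = 0) h0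
  obtain ⟨δ, hδ, h⟩ := Metric.eventually_nhds_iff.1 h1
  have hinj : ∀ ε, |ε| ≤ δ / 2 → ∀ x, Function.Injective (LinearMap.id + ε • A x : E x →ₗ[ℝ] E x) := by
    intro ε hε x
    rw [← LinearMap.ker_eq_bot, LinearMap.ker_eq_bot']
    intro v hv
    by_cases hx : x ∈ K
    · refine h (y := ε) ?_ x hx v hv
      rw [Real.dist_eq, sub_zero]
      linarith
    · rw [hAK x hx] at hv
      simpa using hv
  have hfd := fun x => finiteDimensional_fibre (F := F) (E := E) I x
  have hB : ∀ (ε : ℝ) (x : M), ∃ B : E x →ₗ[ℝ] E x, |ε| ≤ δ / 2 →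
      ∀ v, B v + ε • A x (B v) = v ∧ B (v + ε • A x v) = v := by
    intro ε x
    by_cases hε : |ε| ≤ δ / 2
    · let e := LinearEquiv.ofInjectiveEndo _ (hinj ε hε x)
      refine ⟨e.symm, fun _ v => ⟨?_, ?_⟩⟩
      · exact e.apply_symm_apply v
      · exact e.symm_apply_apply v
    · exact ⟨0, fun h => absurd h hε⟩
  choose B hB using hB
  exact ⟨δ / 2, by linarith, B, fun ε hε x v => hB ε x hε v⟩

/-- An infinitesimal variation of a splitting: a smooth skew field of endomorphisms anticommuting
with the involution. -/
structure IsInfinitesimal (C : CourantAlgebroid I F E) (T A : ∀ x, E x →ₗ[ℝ] E x) : Prop where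
  smooth : ∀ s : Cₛ^∞⟮I; F, E⟯, C.WeakSmooth fun _ x => A x (s x)
  skew : ∀ x u v, C.metric x (A x u) v = -C.metric x u (A x v)
  anti : ∀ x v, T x (A x v) = -A x (T x v)

/-- The infinitesimal variation of the splitting defined by a bundle map `V₊ → V₋`. -/
theorem IsVariation.exists_isInfinitesimal (hT : C.IsSplitting V T) {φ : ∀ x, V x →ₗ[ℝ] E x}
    (hφ : C.IsVariation V φ) : ∃ A, C.IsInfinitesimal T A ∧ (∀ x (v : V x), A x v = φ x v) ∧
      ∀ x, φ x = 0 → A x = 0 := by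
  have hmem : ∀ x v, (1 / 2 : ℝ) • (v + T x v) ∈ V x := fun x v => by
    rw [hT.mem_iff, map_smul, map_add, hT.invol, add_comm]
  let Φ : ∀ x, E x →ₗ[ℝ] E x := fun x => φ x ∘ₗ
    ((1 / 2 : ℝ) • (LinearMap.id + T x)).codRestrict (V x) (fun v => hmem x v)
  have hΦT : ∀ x v, T x (Φ x v) = -Φ x v := fun x v =>
    (hT.mem_perp_iff x _).1 (hφ.mem_perp x _)
  have hTΦ : ∀ x v, Φ x (T x v) = Φ x v := fun x v => by
    refine congrArg (φ x) (Subtype.ext ?_)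
    change (1 / 2 : ℝ) • (T x v + T x (T x v)) = (1 / 2 : ℝ) • (v + T x v)
    rw [hT.invol, add_comm]
  have hΦφ : ∀ x (v : V x), Φ x v = φ x v := fun x v => by
    refine congrArg (φ x) (Subtype.ext ?_)
    change (1 / 2 : ℝ) • ((v : E x) + T x v) = v
    rw [(hT.mem_iff x _).1 v.2]
    module
  have hΦs : ∀ s s' : Cₛ^∞⟮I; F, E⟯,
      ContMDiff I 𝓘(ℝ, ℝ) ∞ fun x => C.metric x (Φ x (s x)) (s' x) := fun s s' => by
    let σ : Cₛ^∞⟮I; F, E⟯ := (1 / 2 : ℝ) • (s + hT.onSection s)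
    exact C.metric_smooth ⟨_, hφ.smooth σ fun x => hmem x (s x)⟩ s'
  let A : ∀ x, E x →ₗ[ℝ] E x := fun x =>
    { toFun := fun u => C.sharp x (C.metric x (Φ x u) - (C.metric x u).comp (Φ x))
      map_add' := fun u v => C.metric_ext fun w => by
        simp only [metric_sharp, map_add, LinearMap.add_apply, LinearMap.sub_apply,
          LinearMap.comp_apply]
        ring
      map_smul' := fun c u => C.metric_ext fun w => by
        simp only [metric_sharp, map_smul, LinearMap.smul_apply, LinearMap.sub_apply,
          LinearMap.comp_apply, RingHom.id_apply, smul_eq_mul]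
        ring }
  have hA : ∀ x u v, C.metric x (A x u) v = C.metric x (Φ x u) v - C.metric x u (Φ x v) :=
    fun x u v => C.metric_sharp x _ v
  refine ⟨A, ⟨fun s s' => ?_, fun x u v => ?_, fun x v => C.metric_ext fun u => ?_⟩, fun x v => ?_,
    fun x hx => ?_⟩
  · refine .of_function (((hΦs s s').sub (hΦs s' s)).congr fun x => ?_)
    rw [hA, C.metric_comm x (s x)]
  · rw [C.metric_comm x u, hA, hA, C.metric_comm x (Φ x v), C.metric_comm x v]
    ring
  · rw [hT.symm, hA, map_neg, LinearMap.neg_apply, hA, hTΦ, hTΦ, ← hT.symm, hΦT, hT.symm, hΦT]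
    simp only [map_neg, LinearMap.neg_apply]
    ring
  · refine C.metric_ext fun u => ?_
    have h1 := hT.symm x v (Φ x u)
    rw [(hT.mem_iff x _).1 v.2, hΦT, map_neg] at h1
    rw [hA, hΦφ]
    linarith
  · refine LinearMap.ext fun u => C.metric_ext fun v => ?_
    have : Φ x = 0 := by simp only [Φ, hx, LinearMap.zero_comp]
    rw [hA, this]
    simp

namespace IsInfinitesimal

variable {A : ∀ x, E x →ₗ[ℝ] E x} (hA : C.IsInfinitesimal T A) (hT : C.IsSplitting V T)
  {ε : ℝ} {B : ∀ x, E x →ₗ[ℝ] E x} (hB : ∀ x v, B x v + ε • A x (B x v) = v)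
  (hB' : ∀ x v, B x (v + ε • A x v) = v)

/-- The involution `(1 + ε A) T (1 + ε A)⁻¹`, where `B` is the inverse of `1 + ε A`. -/
def conj (T A B : ∀ x, E x →ₗ[ℝ] E x) (ε : ℝ) (x : M) : E x →ₗ[ℝ] E x :=
  (LinearMap.id + ε • A x) ∘ₗ (T x ∘ₗ B x)

theorem conj_apply (T A B : ∀ x, E x →ₗ[ℝ] E x) (ε : ℝ) (x : M) (v : E x) :
    conj T A B ε x v = T x (B x v) + ε • A x (T x (B x v)) := rfl

include hA hB in
theorem conj_eq (x : M) (v : E x) :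
    conj T A B ε x v = T x v + (2 * ε) • A x (T x (B x v)) := by
  rw [conj_apply]
  nth_rw 3 [← hB x v]
  rw [map_add, map_smul, hA.anti]
  module

include hB' hB in
theorem trace_conj (x : M) : ∑ i, C.metric x (conj T A B ε x (frameBasis I F E x i))
    (C.dualFrame x i) = ∑ i, C.metric x (T x (frameBasis I F E x i)) (C.dualFrame x i) := by
  have := finiteDimensional_fibre (F := F) (E := E) I x
  rw [← trace_eq_sum, ← trace_eq_sum, conj, LinearMap.trace_comp_comm', LinearMap.comp_assoc]
  congr 1
  have : B x ∘ₗ (LinearMap.id + ε • A x) = LinearMap.id := LinearMap.ext fun v => hB' x v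
  rw [this, LinearMap.comp_id]

include hA hT hB hB' in
theorem isSplitting_graph {φ : ∀ x, V x →ₗ[ℝ] E x} (hφ : ∀ x (v : V x), A x v = φ x v)
    (hs : ∀ s : Cₛ^∞⟮I; F, E⟯, C.WeakSmooth fun _ x => conj T A B ε x (s x)) :
    C.IsSplitting (graph V fun x => ε • φ x) (conj T A B ε) := by
  refine ⟨fun x v => ?_, fun x v => ?_, fun x u v => ?_, hs⟩
  · rw [graph, LinearMap.mem_range]
    constructor
    · rintro ⟨w, rfl⟩
      have h1 : ((V x).subtype + ε • φ x) w = (w : E x) + ε • A x w := by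
        rw [LinearMap.add_apply, LinearMap.smul_apply, hφ]; rfl
      rw [h1, conj_apply, hB', (hT.mem_iff x _).1 w.2]
    · intro h
      have h1 : T x (B x v) = B x v := by
        rw [conj_apply] at h
        have := congrArg (B x) h
        rwa [hB'] at this
      refine ⟨⟨B x v, (hT.mem_iff x _).2 h1⟩, ?_⟩
      rw [LinearMap.add_apply, LinearMap.smul_apply, ← hφ]
      exact hB x v
  · rw [conj_apply, conj_apply, hB', hT.invol, hB]
  · obtain ⟨a, rfl⟩ : ∃ a, u = a + ε • A x a := ⟨B x u, (hB x u).symm⟩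
    obtain ⟨b, rfl⟩ : ∃ b, v = b + ε • A x b := ⟨B x v, (hB x v).symm⟩
    rw [conj_apply, conj_apply, hB', hB']
    simp only [map_add, map_smul, LinearMap.add_apply, LinearMap.smul_apply, smul_eq_mul, hA.skew]
    have h1 : C.metric x (T x a) (A x (A x b)) = C.metric x a (A x (A x (T x b))) := by
      rw [hT.symm, hA.anti, hA.anti, map_neg, map_neg, map_neg, neg_neg]
    have h2 := hT.symm x a b
    linear_combination h2 - ε ^ 2 * h1

end IsInfinitesimal

end CourantAlgebroid
end

noncomputable section

namespace CourantAlgebroid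

variable {n : ℕ} {H : Type*} [TopologicalSpace H]
  {I : ModelWithCorners ℝ (EuclideanSpace ℝ (Fin n)) H}
  {M : Type*} [TopologicalSpace M] [ChartedSpace H M] [IsManifold I ∞ M]
  {F : Type*} [NormedAddCommGroup F] [NormedSpace ℝ F]
  {E : M → Type*} [TopologicalSpace (TotalSpace F E)] [∀ x, TopologicalSpace (E x)]
  [∀ x, AddCommGroup (E x)] [∀ x, Module ℝ (E x)] [FiberBundle F E] [VectorBundle ℝ F E]
  [T2Space M] [FiniteDimensional ℝ F] [ContMDiffVectorBundle ∞ F E I]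

/-! ## Adding a tensor to a connection -/

section Der

variable (C : CourantAlgebroid I F E)

theorem der_exp (ψ : Cₛ^∞⟮I; F, E⟯) {u : M → ℝ} (hu : ContMDiff I 𝓘(ℝ, ℝ) ∞ u) (x : M) :
    C.der ψ (fun y => Real.exp (u y)) x = Real.exp (u x) * C.der ψ u x := by
  have h1 : HasMFDerivAt 𝓘(ℝ, ℝ) 𝓘(ℝ, ℝ) Real.exp (u x)
      (ContinuousLinearMap.toSpanSingleton ℝ (Real.exp (u x))) :=
    (Real.hasDerivAt_exp (u x)).hasFDerivAt.hasMFDerivAt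
  have h2 := (h1.comp x (mdiff (x := x) hu).hasMFDerivAt).mfderiv
  have h3 := congrArg (fun L : TangentSpace I x →L[ℝ] ℝ => L (C.anchor x (ψ x))) h2
  refine h3.trans ?_
  exact mul_comm (C.der ψ u x) (Real.exp (u x))

theorem lieDerivTopForm_exp (ψ : Cₛ^∞⟮I; F, E⟯) {u : M → ℝ} (hu : ContMDiff I 𝓘(ℝ, ℝ) ∞ u)
    {vol : TopForm I M} (hvol : IsVolumeForm I vol) (Y : Fin n → SmoothVectorField I M) (x : M) :
    lieDerivTopForm I (C.anchorField ψ) (fun x => Real.exp (u x) • vol x) Y x =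
      Real.exp (u x) * (lieDerivTopForm I (C.anchorField ψ) vol Y x +
        C.der ψ u x * vol x (fun i => Y i x)) := by
  have hexp : ContMDiff I 𝓘(ℝ, ℝ) ∞ fun y => Real.exp (u y) := Real.contDiff_exp.contMDiff.comp hu
  have h1 : C.der ψ (fun y => Real.exp (u y) * vol y (fun i => Y i y)) x =
      Real.exp (u x) * C.der ψ (fun y => vol y (fun i => Y i y)) x +
      vol x (fun i => Y i x) * (Real.exp (u x) * C.der ψ u x) := by
    rw [C.der_mul ψ hexp (hvol.smooth Y), C.der_exp ψ hu]
  simp only [lieDerivTopForm, AlternatingMap.smul_apply, smul_eq_mul, ← Finset.mul_sum]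
  refine (congrArg₂ (· - ·) h1 rfl).trans ?_
  simp only [der, anchorField]
  change _ = Real.exp (u x) * (mvfderiv I (fun y => vol y (fun i => Y i y)) x
    (C.anchor x (ψ x)) - _ + _)
  ring

end Der

namespace Connection

variable {C : CourantAlgebroid I F E} (D : C.Connection)

/-- The connection `D + k`. -/
def addTensor {k : TriForm E} (hk : k.Smooth I F) (hs : ∀ x a b c, k x a b c = -k x a c b) :
    C.Connection where
  cov := LinearMap.mk₂ ℝ (fun ψ φ => D.cov ψ φ + C.mkSection (fun x => C.vec k x (ψ x) (φ x))
      fun s => (hk ψ φ s).congr fun x => C.metric_vec k x _ _ _)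
    (fun a b c => ContMDiffSection.ext fun x => C.metric_ext fun u => by
      simp [metric_vec]; ring)
    (fun r a b => ContMDiffSection.ext fun x => C.metric_ext fun u => by
      simp [metric_vec])
    (fun a b c => ContMDiffSection.ext fun x => C.metric_ext fun u => by
      simp [metric_vec]; ring)
    (fun r a b => ContMDiffSection.ext fun x => C.metric_ext fun u => by
      simp [metric_vec])
  smul_left f ψ ψ' := ContMDiffSection.ext fun x => C.metric_ext fun u => by
    simp [metric_vec, D.smul_left]
  smul_right f ψ ψ' x := C.metric_ext fun u => by
    simp [metric_vec, D.smul_right]; ring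
  metric_compat ψ φ φ' x := by
    rw [D.metric_compat]
    simp only [LinearMap.mk₂_apply, section_add_apply, mkSection_apply, map_add,
      LinearMap.add_apply, metric_vec]
    rw [C.metric_comm x (φ x) (C.vec k x _ _), metric_vec, hs]
    ring

theorem isSum_addTensor {k : TriForm E} (hk : k.Smooth I F)
    (hs : ∀ x a b c, k x a b c = -k x a c b) : IsSum (D.addTensor hk hs) D k := fun ψ φ χ x => by
  simp [addTensor, metric_vec]

end Connection

/-! ## Levi-Civita connections of a splitting -/

section TriForms

variable {C : CourantAlgebroid I F E} {V : ∀ x, Submodule ℝ (E x)} {T : ∀ x, E x →ₗ[ℝ] E x}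

/-- The torsion of a tensor. -/
def torsionTri (k : TriForm E) : TriForm E := fun x =>
  mkTri (fun a b c => k x a b c - k x b a c + k x c a b) (by intros; simp; ring)
    (by intros; simp; ring) (by intros; simp; ring) (by intros; simp; ring) (by intros; simp; ring)
    (by intros; simp; ring)

@[simp] theorem torsionTri_apply (k : TriForm E) (x : M) (a b c : E x) :
    torsionTri k x a b c = k x a b c - k x b a c + k x c a b := rfl

/-- The projection to the `1`-eigenspace of an involution. -/
def posPart (T : ∀ x, E x →ₗ[ℝ] E x) (x : M) : E x →ₗ[ℝ] E x := (1 / 2 : ℝ) • (LinearMap.id + T x)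

/-- The projection to the `-1`-eigenspace of an involution. -/
def negPart (T : ∀ x, E x →ₗ[ℝ] E x) (x : M) : E x →ₗ[ℝ] E x := (1 / 2 : ℝ) • (LinearMap.id - T x)

theorem posPart_apply (x : M) (v : E x) : posPart T x v = (1 / 2 : ℝ) • (v + T x v) := rfl
theorem negPart_apply (x : M) (v : E x) : negPart T x v = (1 / 2 : ℝ) • (v - T x v) := rfl

theorem posPart_add_negPart (x : M) (v : E x) : posPart T x v + negPart T x v = v := by
  rw [posPart_apply, negPart_apply]; module

section Splitting

variable (hT : C.IsSplitting V T)
include hT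

theorem IsSplitting.posPart_apply_self (x : M) (v : E x) : posPart T x (T x v) = posPart T x v := by
  rw [posPart_apply, posPart_apply, hT.invol, add_comm]

theorem IsSplitting.negPart_apply_self (x : M) (v : E x) :
    negPart T x (T x v) = -negPart T x v := by
  rw [negPart_apply, negPart_apply, hT.invol]; module

theorem IsSplitting.posPart_posPart (x : M) (v : E x) :
    posPart T x (posPart T x v) = posPart T x v := by
  conv_lhs => rw [posPart_apply (v := v), map_smul, map_add, hT.posPart_apply_self]
  module

theorem IsSplitting.negPart_negPart (x : M) (v : E x) :
    negPart T x (negPart T x v) = negPart T x v := by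
  conv_lhs => rw [negPart_apply (v := v), map_smul, map_sub, hT.negPart_apply_self]
  module

theorem IsSplitting.metric_posPart (x : M) (u v : E x) :
    C.metric x (posPart T x u) v = C.metric x u (posPart T x v) := by
  simp [posPart_apply, hT.symm]

theorem IsSplitting.metric_negPart (x : M) (u v : E x) :
    C.metric x (negPart T x u) v = C.metric x u (negPart T x v) := by
  simp [negPart_apply, hT.symm]

end Splitting

/-- A tensor preserving the splitting with torsion `-τ`. -/
def correctTorsion (τ : TriForm E) (T : ∀ x, E x →ₗ[ℝ] E x) : TriForm E := fun x =>
  mkTri (fun a b c =>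
    -((1 / 3) * τ x (posPart T x a) (posPart T x b) (posPart T x c) +
      (1 / 3) * τ x (negPart T x a) (negPart T x b) (negPart T x c) +
      τ x (negPart T x a) (posPart T x b) (posPart T x c) +
      τ x (posPart T x a) (negPart T x b) (negPart T x c)))
    (by intros; simp only [map_add, LinearMap.add_apply]; ring)
    (by intros; simp only [map_smul, LinearMap.smul_apply, smul_eq_mul]; ring)
    (by intros; simp only [map_add, LinearMap.add_apply]; ring)
    (by intros; simp only [map_smul, LinearMap.smul_apply, smul_eq_mul]; ring)
    (by intros; simp only [map_add]; ring)
    (by intros; simp only [map_smul, smul_eq_mul]; ring)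

theorem correctTorsion_apply (τ : TriForm E) (x : M) (a b c : E x) :
    correctTorsion τ T x a b c =
    -((1 / 3) * τ x (posPart T x a) (posPart T x b) (posPart T x c) +
      (1 / 3) * τ x (negPart T x a) (negPart T x b) (negPart T x c) +
      τ x (negPart T x a) (posPart T x b) (posPart T x c) +
      τ x (posPart T x a) (negPart T x b) (negPart T x c)) := rfl

/-- A torsion-free tensor preserving the splitting with divergence `e`. -/
def correctTrace (C : CourantAlgebroid I F E) (e : ∀ x, E x →ₗ[ℝ] ℝ) (T : ∀ x, E x →ₗ[ℝ] E x)
    (p q : ℝ) : TriForm E := fun x =>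
  mkTri (fun a b c =>
    (1 - p)⁻¹ * (C.metric x (posPart T x a) (posPart T x b) * e x (posPart T x c) -
      C.metric x (posPart T x a) (posPart T x c) * e x (posPart T x b)) +
    (1 - q)⁻¹ * (C.metric x (negPart T x a) (negPart T x b) * e x (negPart T x c) -
      C.metric x (negPart T x a) (negPart T x c) * e x (negPart T x b)))
    (by intros; simp only [map_add, LinearMap.add_apply]; ring)
    (by intros; simp only [map_smul, LinearMap.smul_apply, smul_eq_mul]; ring)
    (by intros; simp only [map_add]; ring)
    (by intros; simp only [map_smul, smul_eq_mul]; ring)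
    (by intros; simp only [map_add]; ring)
    (by intros; simp only [map_smul, smul_eq_mul]; ring)

theorem correctTrace_apply (e : ∀ x, E x →ₗ[ℝ] ℝ) (p q : ℝ) (x : M) (a b c : E x) :
    correctTrace C e T p q x a b c =
    (1 - p)⁻¹ * (C.metric x (posPart T x a) (posPart T x b) * e x (posPart T x c) -
      C.metric x (posPart T x a) (posPart T x c) * e x (posPart T x b)) +
    (1 - q)⁻¹ * (C.metric x (negPart T x a) (negPart T x b) * e x (negPart T x c) -
      C.metric x (negPart T x a) (negPart T x c) * e x (negPart T x b)) := rfl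

theorem torsionTri_correctTrace (e : ∀ x, E x →ₗ[ℝ] ℝ) (p q : ℝ) (x : M) (a b c : E x) :
    torsionTri (correctTrace C e T p q) x a b c = 0 := by
  simp only [torsionTri_apply, correctTrace_apply]
  rw [C.metric_comm x (posPart T x b) (posPart T x a), C.metric_comm x (posPart T x c)
    (posPart T x a), C.metric_comm x (posPart T x c) (posPart T x b), C.metric_comm x (negPart T x b)
    (negPart T x a), C.metric_comm x (negPart T x c) (negPart T x a), C.metric_comm x
    (negPart T x c) (negPart T x b)]
  ring

theorem correctTrace_skew (e : ∀ x, E x →ₗ[ℝ] ℝ) (p q : ℝ) (x : M) (a b c : E x) :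
    correctTrace C e T p q x a b c = -correctTrace C e T p q x a c b := by
  simp only [correctTrace_apply]; ring

theorem torsionTri_correctTorsion {k : TriForm E} (hk : ∀ x a b c, k x a b c = -k x a c b) (x : M)
    (a b c : E x) :
    torsionTri (correctTorsion (torsionTri k) T) x a b c = -torsionTri k x a b c := by
  have h1 : ∀ a b c, torsionTri k x a b c = -torsionTri k x b a c := fun a b c => by
    simp only [torsionTri_apply]; rw [hk x c a b]; ring
  have h2 : ∀ a b c, torsionTri k x a b c = -torsionTri k x a c b := fun a b c => by
    simp only [torsionTri_apply]; rw [hk x a b c, hk x b a c, hk x c a b]; ring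
  rw [torsionTri_apply]
  simp only [correctTorsion_apply]
  conv_rhs => rw [← posPart_add_negPart (T := T) x a, ← posPart_add_negPart (T := T) x b,
    ← posPart_add_negPart (T := T) x c]
  generalize torsionTri k x = τ at *
  generalize posPart T x a = a₁
  generalize posPart T x b = b₁
  generalize posPart T x c = c₁
  generalize negPart T x a = a₂
  generalize negPart T x b = b₂
  generalize negPart T x c = c₂
  simp only [map_add, LinearMap.add_apply]
  rw [h1 b₁ a₁ c₁, h1 c₁ a₁ b₁, h2 a₁ c₁ b₁, h1 b₂ a₂ c₂, h1 c₂ a₂ b₂, h2 a₂ c₂ b₂, h1 b₂ a₁ c₁,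
    h1 c₂ a₁ b₁, h2 a₁ c₂ b₁, h1 b₁ a₂ c₂, h1 c₁ a₂ b₂, h2 a₂ c₁ b₂]
  ring

theorem correctTorsion_skew {k : TriForm E} (hk : ∀ x a b c, k x a b c = -k x a c b) (x : M)
    (a b c : E x) :
    correctTorsion (torsionTri k) T x a b c = -correctTorsion (torsionTri k) T x a c b := by
  have h2 : ∀ a b c, torsionTri k x a b c = -torsionTri k x a c b := fun a b c => by
    simp only [torsionTri_apply]; rw [hk x a b c, hk x b a c, hk x c a b]; ring
  simp only [correctTorsion_apply]
  rw [h2 (posPart T x a) (posPart T x b), h2 (negPart T x a) (negPart T x b),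
    h2 (negPart T x a) (posPart T x b), h2 (posPart T x a) (negPart T x b)]
  ring

variable (hT : C.IsSplitting V T)
include hT

theorem correctTorsion_right (τ : TriForm E) (x : M) (a b c : E x) :
    correctTorsion τ T x a (T x b) c = correctTorsion τ T x a b (T x c) := by
  simp only [correctTorsion_apply, hT.posPart_apply_self, hT.negPart_apply_self, map_neg,
    LinearMap.neg_apply]

theorem correctTrace_right (e : ∀ x, E x →ₗ[ℝ] ℝ) (p q : ℝ) (x : M) (a b c : E x) :
    correctTrace C e T p q x a (T x b) c = correctTrace C e T p q x a b (T x c) := by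
  simp only [correctTrace_apply, hT.posPart_apply_self, hT.negPart_apply_self, map_neg]
  ring

theorem sum_correctTrace {p q : ℝ} (hp : p ≠ 1) (hq : q ≠ 1)
    (htr : ∀ x, ∑ i, C.metric x (T x (frameBasis I F E x i)) (C.dualFrame x i) = p - q)
    (hF : (finrank ℝ F : ℝ) = p + q) (e : ∀ x, E x →ₗ[ℝ] ℝ) (x : M) (v : E x) :
    ∑ i, correctTrace C e T p q x (frameBasis I F E x i) v (C.dualFrame x i) = e x v := by
  have hd : ∑ i, C.metric x (frameBasis I F E x i) (C.dualFrame x i) = p + q := by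
    simp [metric_dualFrame_right, hF]
  have t1 : ∑ i, C.metric x (posPart T x (frameBasis I F E x i))
      (posPart T x (C.dualFrame x i)) = p := by
    simp only [← hT.metric_posPart, hT.posPart_posPart]
    simp only [posPart_apply, map_smul, map_add, LinearMap.smul_apply, LinearMap.add_apply,
      smul_eq_mul, ← Finset.mul_sum, Finset.sum_add_distrib, htr, hd]
    ring
  have t2 : ∑ i, C.metric x (negPart T x (frameBasis I F E x i))
      (negPart T x (C.dualFrame x i)) = q := by
    simp only [← hT.metric_negPart, hT.negPart_negPart]
    simp only [negPart_apply, map_smul, map_sub, LinearMap.smul_apply, LinearMap.sub_apply,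
      smul_eq_mul, ← Finset.mul_sum, Finset.sum_sub_distrib, htr, hd]
    ring
  have s1 : ∑ i, C.metric x (posPart T x (frameBasis I F E x i)) (posPart T x v) *
      e x (posPart T x (C.dualFrame x i)) = e x (posPart T x v) := by
    conv_rhs => rw [← hT.posPart_posPart x v, ← C.sum_frame_dualFrame x (posPart T x v)]
    simp only [map_sum, map_smul, smul_eq_mul]
    refine Finset.sum_congr rfl fun i _ => ?_
    rw [hT.metric_posPart, hT.posPart_posPart, C.metric_comm]
  have s2 : ∑ i, C.metric x (negPart T x (frameBasis I F E x i)) (negPart T x v) *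
      e x (negPart T x (C.dualFrame x i)) = e x (negPart T x v) := by
    conv_rhs => rw [← hT.negPart_negPart x v, ← C.sum_frame_dualFrame x (negPart T x v)]
    simp only [map_sum, map_smul, smul_eq_mul]
    refine Finset.sum_congr rfl fun i _ => ?_
    rw [hT.metric_negPart, hT.negPart_negPart, C.metric_comm]
  simp only [correctTrace_apply, Finset.sum_add_distrib, ← Finset.mul_sum, Finset.sum_sub_distrib,
    s1, s2, ← Finset.sum_mul, t1, t2]
  have hp' : 1 - p ≠ 0 := sub_ne_zero.2 hp.symm
  have hq' : 1 - q ≠ 0 := sub_ne_zero.2 hq.symm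
  conv_rhs => rw [← posPart_add_negPart (T := T) x v, map_add]
  field_simp

end TriForms

end CourantAlgebroid
end

noncomputable section

namespace CourantAlgebroid

variable {n : ℕ} {H : Type*} [TopologicalSpace H]
  {I : ModelWithCorners ℝ (EuclideanSpace ℝ (Fin n)) H}
  {M : Type*} [TopologicalSpace M] [ChartedSpace H M] [IsManifold I ∞ M]
  {F : Type*} [NormedAddCommGroup F] [NormedSpace ℝ F]
  {E : M → Type*} [TopologicalSpace (TotalSpace F E)] [∀ x, TopologicalSpace (E x)]
  [∀ x, AddCommGroup (E x)] [∀ x, Module ℝ (E x)] [FiberBundle F E] [VectorBundle ℝ F E]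
  [T2Space M] [FiniteDimensional ℝ F] [ContMDiffVectorBundle ∞ F E I]

/-! ## Existence of Levi-Civita connections -/

namespace Connection

variable {C : CourantAlgebroid I F E} (D : C.Connection)

section Fixed

variable {V : ∀ x, Submodule ℝ (E x)} {T : ∀ x, E x →ₗ[ℝ] E x}
  (hT : ∀ s : Cₛ^∞⟮I; F, E⟯, C.WeakSmooth fun _ x => T x (s x))

/-- The covariant derivative of a field of endomorphisms, as a trilinear form. -/
def covEndo : TriForm E := fun x =>
  have hB : ∀ a b : Cₛ^∞⟮I; F, E⟯, ContMDiff I 𝓘(ℝ, ℝ) ∞ fun x => (C.metric x ∘ₗ T x) (a x) (b x) :=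
    fun a b => (hT a b).slice 0
  mkTri (fun a b c => D.covBiForm hB (ext x a) x b c)
    (fun a a' b c => by
      simp only [covBiForm, LinearMap.mk₂_apply, covBi, map_add, LinearMap.add_apply, der_add_left,
        section_add_apply]
      ring)
    (fun r a b c => by
      simp only [covBiForm, LinearMap.mk₂_apply, covBi, map_smul, LinearMap.smul_apply, der_smul_left,
        section_smul_apply, smul_eq_mul]
      ring)
    (by intros; simp) (by intros; simp) (by intros; simp) (by intros; simp)

theorem covEndo_apply (ψ a b : Cₛ^∞⟮I; F, E⟯) (x : M) : D.covEndo hT x (ψ x) (a x) (b x) =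
    C.der ψ (fun y => C.metric y (T y (a y)) (b y)) x - C.metric x (T x (D.cov ψ a x)) (b x) -
      C.metric x (T x (a x)) (D.cov ψ b x) := by
  have hB : ∀ a b : Cₛ^∞⟮I; F, E⟯, ContMDiff I 𝓘(ℝ, ℝ) ∞ fun x => (C.metric x ∘ₗ T x) (a x) (b x) :=
    fun a b => (hT a b).slice 0
  change D.covBi (fun y => C.metric y ∘ₗ T y) (ext x (ψ x)) (ext x (a x)) (ext x (b x)) x = _
  rw [D.covBi_congr hB (ext x (ψ x)) (ext_apply x (a x)) (ext_apply x (b x)), covBi,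
    C.der_congr_left (ext_apply x (ψ x)), D.cov_congr_left (ext_apply x (ψ x)),
    D.cov_congr_left (ext_apply x (ψ x))]
  rfl

/-- The tensor `½ T (∇T)`. -/
def halfCovEndo : TriForm E := fun x =>
  mkTri (fun a b c => (1 / 2) * D.covEndo hT x a b (T x c)) (by intros; simp; ring)
    (by intros; simp; ring) (by intros; simp; ring) (by intros; simp; ring) (by intros; simp; ring)
    (by intros; simp; ring)

theorem halfCovEndo_apply (x : M) (a b c : E x) :
    D.halfCovEndo hT x a b c = (1 / 2) * D.covEndo hT x a b (T x c) := rfl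

/-- The sum of `½ T (∇T)` and the tensor making it torsion-free. -/
def torsionFreeTensor : TriForm E := fun x =>
  D.halfCovEndo hT x + correctTorsion (torsionTri (D.halfCovEndo hT)) T x

/-- The one-form that the trace part of the Levi-Civita tensor has to produce. -/
def traceDefect (u : M → ℝ) (x : M) : E x →ₗ[ℝ] ℝ where
  toFun v := C.der (ext x v) u x - C.tr x ((D.torsionFreeTensor hT x).flip v)
  map_add' a b := by
    simp only [map_add, der_add_left, tr, LinearMap.add_apply, Finset.sum_add_distrib]; ring
  map_smul' r a := by
    simp only [map_smul, der_smul_left, tr, LinearMap.smul_apply, smul_eq_mul, ← Finset.mul_sum,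
      RingHom.id_apply]
    ring

theorem traceDefect_apply (u : M → ℝ) (ψ : Cₛ^∞⟮I; F, E⟯) (x : M) :
    D.traceDefect hT u x (ψ x) =
      C.der ψ u x - C.tr x ((D.torsionFreeTensor hT x).flip (ψ x)) := by
  change C.der (ext x (ψ x)) u x - _ = _
  rw [C.der_congr_left (ext_apply x (ψ x))]

/-- The tensor `k` such that `D + k` is a Levi-Civita connection of the splitting `T`. -/
def leviCivitaTensor (u : M → ℝ) (p q : ℝ) : TriForm E := fun x =>
  D.torsionFreeTensor hT x + correctTrace C (D.traceDefect hT u) T p q x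

theorem leviCivitaTensor_apply (u : M → ℝ) (p q : ℝ) (x : M) (a b c : E x) :
    D.leviCivitaTensor hT u p q x a b c = D.halfCovEndo hT x a b c +
      correctTorsion (torsionTri (D.halfCovEndo hT)) T x a b c +
      correctTrace C (D.traceDefect hT u) T p q x a b c := rfl

section Splitting

variable (hS : C.IsSplitting V T)
include hS

theorem covEndo_comp (x : M) (a b c : E x) :
    D.covEndo hT x a b (T x c) = -D.covEndo hT x a (T x b) c := by
  have h1 := D.covEndo_apply hT (ext x a) (ext x b) (hS.onSection (ext x c)) x
  have h2 := D.covEndo_apply hT (ext x a) (hS.onSection (ext x b)) (ext x c) x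
  have h3 := D.der_metric (ext x a) (ext x b) (ext x c) x
  have h4 := D.der_metric (ext x a) (hS.onSection (ext x b)) (hS.onSection (ext x c)) x
  simp only [IsSplitting.onSection_apply, ext_apply, hS.invol, hS.symm x (T x _), hS.symm] at *
  linarith

theorem halfCovEndo_skew (x : M) (a b c : E x) :
    D.halfCovEndo hT x a b c = -D.halfCovEndo hT x a c b := by
  have hsymm : ∀ b c, D.covEndo hT x a b c = D.covEndo hT x a c b := fun b c => by
    have h1 := D.covEndo_apply hT (ext x a) (ext x b) (ext x c) x
    have h2 := D.covEndo_apply hT (ext x a) (ext x c) (ext x b) x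
    have h3 : (fun y => C.metric y (T y (ext (I := I) (F := F) x b y))
        (ext (I := I) (F := F) x c y)) = fun y => C.metric y (T y (ext (I := I) (F := F) x c y))
        (ext (I := I) (F := F) x b y) := funext fun y => by rw [hS.symm, C.metric_comm]
    rw [h3] at h1
    simp only [ext_apply] at h1 h2
    rw [h1, h2, hS.symm, hS.symm x b, C.metric_comm x b, C.metric_comm x (D.cov (ext x a) (ext x b) x)]
    ring
  rw [halfCovEndo_apply, halfCovEndo_apply, covEndo_comp D hT hS, hsymm]
  ring

theorem leviCivitaTensor_skew (u : M → ℝ) (p q : ℝ) (x : M) (a b c : E x) :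
    D.leviCivitaTensor hT u p q x a b c = -D.leviCivitaTensor hT u p q x a c b := by
  rw [leviCivitaTensor_apply, leviCivitaTensor_apply, halfCovEndo_skew D hT hS,
    correctTorsion_skew (halfCovEndo_skew D hT hS), correctTrace_skew]
  ring

theorem torsionTri_leviCivitaTensor (u : M → ℝ) (p q : ℝ) (x : M) (a b c : E x) :
    torsionTri (D.leviCivitaTensor hT u p q) x a b c = 0 := by
  have h1 := torsionTri_correctTorsion (T := T) (halfCovEndo_skew D hT hS) x a b c
  have h2 := torsionTri_correctTrace (C := C) (T := T) (D.traceDefect hT u) p q x a b c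
  rw [torsionTri_apply] at h1 h2 ⊢
  simp only [leviCivitaTensor_apply]
  rw [torsionTri_apply] at h1
  linarith

theorem sum_leviCivitaTensor {p q : ℝ} (hp : p ≠ 1) (hq : q ≠ 1)
    (htr : ∀ x, ∑ i, C.metric x (T x (frameBasis I F E x i)) (C.dualFrame x i) = p - q)
    (hF : (finrank ℝ F : ℝ) = p + q) (u : M → ℝ) (ψ : Cₛ^∞⟮I; F, E⟯) (x : M) :
    ∑ i, D.leviCivitaTensor hT u p q x (frameBasis I F E x i) (ψ x) (C.dualFrame x i) =
      C.der ψ u x := by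
  have h1 := sum_correctTrace hS hp hq htr hF (D.traceDefect hT u) x (ψ x)
  rw [traceDefect_apply] at h1
  simp only [leviCivitaTensor, LinearMap.add_apply, Finset.sum_add_distrib, h1]
  simp only [tr, LinearMap.flip_apply]
  ring

theorem isLeviCivita_addTensor {D : C.Connection}
    (hD : ∀ ψ ψ' ψ'' x, D.torsion ψ ψ' ψ'' x = 0) {vol : TopForm I M} (hvol : IsVolumeForm I vol)
    (hdiv : ∀ (ψ : Cₛ^∞⟮I; F, E⟯) (Y : Fin n → SmoothVectorField I M) (x : M),
      lieDerivTopForm I (C.anchorField ψ) vol Y x = D.divergence ψ x * vol x (fun i => Y i x))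
    {p q : ℝ} (hp : p ≠ 1) (hq : q ≠ 1)
    (htr : ∀ x, ∑ i, C.metric x (T x (frameBasis I F E x i)) (C.dualFrame x i) = p - q)
    (hF : (finrank ℝ F : ℝ) = p + q) {u : M → ℝ} (hu : ContMDiff I 𝓘(ℝ, ℝ) ∞ u) {D' : C.Connection}
    (h : IsSum D' D (D.leviCivitaTensor hT u p q)) :
    D'.IsLeviCivita V fun x => Real.exp (u x) • vol x := by
  refine ⟨fun ψ φ hφ x => ?_, fun ψ ψ' ψ'' x => ?_, fun ψ Y x => ?_⟩
  · have hφ' : ∀ y, T y (φ y) = φ y := fun y => (hS.mem_iff y _).1 (hφ y)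
    rw [hS.mem_iff]
    refine C.metric_ext fun w => ?_
    have key : ∀ w : E x, C.metric x (D'.cov ψ φ x) w =
        (1 / 2) * C.metric x (D.cov ψ φ x) (w + T x w) +
        (correctTorsion (torsionTri (D.halfCovEndo hT)) T x (ψ x) (φ x) w +
        correctTrace C (D.traceDefect hT u) T p q x (ψ x) (φ x) w) := fun w => by
      have h1 := h ψ φ (ext x w) x
      have h2 := D.covEndo_apply hT ψ φ (hS.onSection (ext x w)) x
      have h3 := D.der_metric ψ φ (hS.onSection (ext x w)) x
      simp only [hφ', IsSplitting.onSection_apply, ext_apply, hS.invol,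
        hS.symm x (D.cov ψ φ x)] at h1 h2 h3
      rw [h1, leviCivitaTensor_apply, halfCovEndo_apply, h2, h3, map_add]
      ring
    rw [hS.symm, key, key, hS.invol, ← correctTorsion_right hS, ← correctTrace_right hS, hφ',
      add_comm w]
  · have h1 := torsionTri_leviCivitaTensor D hT hS u p q x (ψ x) (ψ' x) (ψ'' x)
    rw [torsionTri_apply] at h1
    rw [h.torsion_eq, hD, h1, add_zero]
  · rw [C.lieDerivTopForm_exp ψ hu hvol, hdiv, h.divergence_eq,
      sum_leviCivitaTensor D hT hS hp hq htr hF, AlternatingMap.smul_apply, smul_eq_mul]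
    ring

end Splitting

/-- The Levi-Civita tensor vanishes where the splitting is parallel. -/
theorem leviCivitaTensor_eq_zero {u : M → ℝ} (p q : ℝ) {x : M} (hu : u =ᶠ[𝓝 x] fun _ => 0)
    (h : ∀ a b c, D.covEndo hT x a b c = 0) : D.leviCivitaTensor hT u p q x = 0 := by
  have h1 : D.halfCovEndo hT x = 0 := by
    ext a b c; rw [halfCovEndo_apply, h]; simp
  have h2 : D.torsionFreeTensor hT x = 0 := by
    ext a b c
    simp only [torsionFreeTensor, LinearMap.add_apply, correctTorsion_apply, torsionTri_apply, h1,
      LinearMap.zero_apply]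
    ring
  have h3 : D.traceDefect hT u x = 0 := by
    ext v
    change C.der (ext x v) u x - C.tr x ((D.torsionFreeTensor hT x).flip v) = 0
    rw [h2, C.der_congr _ hu, C.der_const]
    simp [tr]
  ext a b c
  simp only [leviCivitaTensor, LinearMap.add_apply, correctTrace_apply, h2, h3,
    LinearMap.zero_apply]
  ring

/-- If the connection commutes with `T` and `T'` agrees with `T` near `x`, then `T'` is parallel
at `x`. -/
theorem covEndo_eq_zero {T' : ∀ x, E x →ₗ[ℝ] E x} (hS : C.IsSplitting V T')
    (hD : ∀ ψ ψ' : Cₛ^∞⟮I; F, E⟯, (∀ x, ψ' x ∈ V x) → ∀ x, D.cov ψ ψ' x ∈ V x) {x : M}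
    (h : ∀ᶠ y in 𝓝 x, T y = T' y) (a b c : E x) : D.covEndo hT x a b c = 0 := by
  have h1 := D.covEndo_apply hT (ext x a) (ext x b) (ext x c) x
  have h2 := D.der_metric (ext x a) (hS.onSection (ext x b)) (ext x c) x
  have h3 : (fun y => C.metric y (T y (ext (I := I) (F := F) x b y))
      (ext (I := I) (F := F) x c y)) =ᶠ[𝓝 x] fun y =>
      C.metric y (hS.onSection (ext x b) y) (ext (I := I) (F := F) x c y) :=
    h.mono fun y hy => by simp only [hy, IsSplitting.onSection_apply]
  rw [C.der_congr _ h3, h2, hS.cov_onSection hD, h.self_of_nhds] at h1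
  simp only [IsSplitting.onSection_apply, ext_apply] at h1
  rw [h1]
  ring

end Fixed

section Family

variable {U : ℝ → ∀ x, E x →ₗ[ℝ] E x}
  (hU : ∀ s : Cₛ^∞⟮I; F, E⟯, C.WeakSmooth fun t x => U t x (s x))

omit [FiniteDimensional ℝ F] [ContMDiffVectorBundle ∞ F E I] in
theorem _root_.CourantAlgebroid.weakSmooth_slice
    (hU : ∀ s : Cₛ^∞⟮I; F, E⟯, C.WeakSmooth fun t x => U t x (s x)) (t : ℝ) (s : Cₛ^∞⟮I; F, E⟯) :
    C.WeakSmooth fun _ x => U t x (s x) :=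
  fun s' => .of_function ((hU s s').slice t)

theorem triSmooth_covEndo : TriSmooth I F fun t => D.covEndo (weakSmooth_slice hU t) :=
  fun a b c => by
    refine SmoothFamily.congr ?_ fun t x => D.covEndo_apply (weakSmooth_slice hU t) a b c x
    exact ((C.der_family a (hU b c)).sub (hU (D.cov a b) c)).sub (hU b (D.cov a c))

theorem triSmooth_halfCovEndo : TriSmooth I F fun t => D.halfCovEndo (weakSmooth_slice hU t) :=
  fun a b c => ((D.triSmooth_covEndo hU).apply (weakSmooth_section C a) (weakSmooth_section C b)
    (hU c)).const_mul _

include hU in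
theorem weakSmooth_posPart {w : ℝ → ∀ x, E x} (hw : C.WeakSmooth w) :
    C.WeakSmooth fun t x => posPart (U t) x (w t x) :=
  .smul (.const _) (hw.add (hw.endo hU))

include hU in
theorem weakSmooth_negPart {w : ℝ → ∀ x, E x} (hw : C.WeakSmooth w) :
    C.WeakSmooth fun t x => negPart (U t) x (w t x) :=
  .smul (.const _) (hw.sub (hw.endo hU))

theorem triSmooth_torsionTri {k : ℝ → TriForm E} (hk : TriSmooth I F k) :
    TriSmooth I F fun t => torsionTri (k t) :=
  fun a b c => ((hk a b c).sub (hk b a c)).add (hk c a b)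

include hU in
theorem triSmooth_correctTorsion {k : ℝ → TriForm E} (hk : TriSmooth I F k) :
    TriSmooth I F fun t => correctTorsion (k t) (U t) := fun a b c => by
  have P := fun s => weakSmooth_posPart hU (weakSmooth_section C s)
  have N := fun s => weakSmooth_negPart hU (weakSmooth_section C s)
  exact (((((hk.apply (P a) (P b) (P c)).const_mul _).add
    ((hk.apply (N a) (N b) (N c)).const_mul _)).add (hk.apply (N a) (P b) (P c))).add
    (hk.apply (P a) (N b) (N c))).neg

theorem triSmooth_torsionFreeTensor :
    TriSmooth I F fun t => D.torsionFreeTensor (weakSmooth_slice hU t) := fun a b c =>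
  (D.triSmooth_halfCovEndo hU a b c).add
    (triSmooth_correctTorsion hU (triSmooth_torsionTri (D.triSmooth_halfCovEndo hU)) a b c)

theorem smoothFamily_traceDefect {u : ℝ → M → ℝ} (hu : SmoothFamily I u) (s : Cₛ^∞⟮I; F, E⟯) :
    SmoothFamily I fun t x => D.traceDefect (weakSmooth_slice hU t) (u t) x (s x) := by
  refine SmoothFamily.congr ?_ fun t x => D.traceDefect_apply _ (u t) s x
  exact (C.der_family s hu).sub (C.smoothFamily_tr fun a b => D.triSmooth_torsionFreeTensor hU a s b)

theorem triSmooth_leviCivitaTensor {u : ℝ → M → ℝ} (hu : SmoothFamily I u) (p q : ℝ) :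
    TriSmooth I F fun t => D.leviCivitaTensor (weakSmooth_slice hU t) (u t) p q := fun a b c => by
  have P := fun s => weakSmooth_posPart hU (weakSmooth_section C s)
  have N := fun s => weakSmooth_negPart hU (weakSmooth_section C s)
  have hP := fun s => (P s).pair (D.smoothFamily_traceDefect hU hu)
  have hN := fun s => (N s).pair (D.smoothFamily_traceDefect hU hu)
  exact (D.triSmooth_torsionFreeTensor hU a b c).add
    ((((((P a).metric (P b)).mul (hP c)).sub (((P a).metric (P c)).mul (hP b))).const_mul _).add
    (((((N a).metric (N b)).mul (hN c)).sub (((N a).metric (N c)).mul (hN b))).const_mul _))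

end Family

end Connection

end CourantAlgebroid
end

noncomputable section

namespace CourantAlgebroid

variable {n : ℕ} {H : Type*} [TopologicalSpace H]
  {I : ModelWithCorners ℝ (EuclideanSpace ℝ (Fin n)) H}
  {M : Type*} [TopologicalSpace M] [ChartedSpace H M] [IsManifold I ∞ M]
  {F : Type*} [NormedAddCommGroup F] [NormedSpace ℝ F]
  {E : M → Type*} [TopologicalSpace (TotalSpace F E)] [∀ x, TopologicalSpace (E x)]
  [∀ x, AddCommGroup (E x)] [∀ x, Module ℝ (E x)] [FiberBundle F E] [VectorBundle ℝ F E]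
  [T2Space M] [FiniteDimensional ℝ F] [ContMDiffVectorBundle ∞ F E I]

/-! ## Families of connections -/

namespace Connection

variable {C : CourantAlgebroid I F E} {D : C.Connection}

theorem ext_cov {D D' : C.Connection} (h : ∀ ψ φ x, D'.cov ψ φ x = D.cov ψ φ x) : D' = D := by
  have h1 : D'.cov = D.cov := by
    ext ψ φ x; exact h ψ φ x
  cases D; cases D'
  simp only at h1
  subst h1
  rfl

theorem weakSmooth_vec {k : ℝ → TriForm E} (hk : TriSmooth I F k) (a b : Cₛ^∞⟮I; F, E⟯) :
    C.WeakSmooth fun t x => C.vec (k t) x (a x) (b x) := fun s =>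
  (hk a b s).congr fun t x => C.metric_vec _ x _ _ _

theorem weakSmooth_covec {k : ℝ → TriForm E} (hk : TriSmooth I F k) (a b : Cₛ^∞⟮I; F, E⟯) :
    C.WeakSmooth fun t x => C.covec (k t) x (a x) (b x) := fun s =>
  (hk s a b).congr fun t x => C.metric_covec _ x _ _ _

theorem smoothFamily_curvature (hD : ∀ ψ ψ' ψ'' x, D.torsion ψ ψ' ψ'' x = 0)
    {k : ℝ → TriForm E} (hk : TriSmooth I F k) {D' : ℝ → C.Connection}
    (h : ∀ t, IsSum (D' t) D (k t)) (φ' φ ψ ψ' : Cₛ^∞⟮I; F, E⟯) :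
    SmoothFamily I fun t => (D' t).curvature φ' φ ψ ψ' := by
  have key : SmoothFamily I fun t x => (1 / 2) * (2 * D.curvature φ' φ ψ ψ' x +
      (D.covTri (k t) ψ ψ' φ φ' x - D.covTri (k t) ψ' ψ φ φ' x + D.covTri (k t) φ φ' ψ ψ' x -
        D.covTri (k t) φ' φ ψ ψ' x) +
      (-C.metric x (C.vec (k t) x (ψ' x) (φ x)) (C.vec (k t) x (ψ x) (φ' x)) +
      C.metric x (C.vec (k t) x (ψ x) (φ x)) (C.vec (k t) x (ψ' x) (φ' x)) -
      C.metric x (C.vec (k t) x (φ' x) (ψ x)) (C.vec (k t) x (φ x) (ψ' x)) +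
      C.metric x (C.vec (k t) x (φ x) (ψ x)) (C.vec (k t) x (φ' x) (ψ' x)) +
      C.metric x (C.covec (k t) x (ψ x) (ψ' x)) (C.covec (k t) x (φ x) (φ' x)))) := by
    have v := fun a b => weakSmooth_vec (C := C) hk a b
    have w := fun a b => weakSmooth_covec (C := C) hk a b
    have c := fun a b c d => D.smoothFamily_covTri hk a b c d
    refine SmoothFamily.const_mul _ (((SmoothFamily.of_function
      (D.contMDiff_curvature φ' φ ψ ψ')).const_mul 2).add ?_ |>.add ?_)
    · exact (((c ψ ψ' φ φ').sub (c ψ' ψ φ φ')).add (c φ φ' ψ ψ')).sub (c φ' φ ψ ψ')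
    · exact (((((v ψ' φ).metric (v ψ φ')).neg.add ((v ψ φ).metric (v ψ' φ'))).sub
        ((v φ' ψ).metric (v φ ψ'))).add ((v φ ψ).metric (v φ' ψ'))).add
        ((w ψ ψ').metric (w φ φ'))
  refine key.congr fun t x => ?_
  have := (h t).curvature_eq hD φ' φ ψ ψ' x
  rw [quadCurv] at this
  linarith

theorem smoothFamily_ricci (hD : ∀ ψ ψ' ψ'' x, D.torsion ψ ψ' ψ'' x = 0)
    {k : ℝ → TriForm E} (hk : TriSmooth I F k) {D' : ℝ → C.Connection}
    (h : ∀ t, IsSum (D' t) D (k t)) (ψ ψ' : Cₛ^∞⟮I; F, E⟯) :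
    SmoothFamily I fun t => (D' t).ricci ψ ψ' := by
  refine SmoothFamily.of_local fun x => ?_
  obtain ⟨s, r, hs⟩ := C.exists_dual_sections x
  refine ⟨_, SmoothFamily.sum (s := Finset.univ) fun i _ =>
    smoothFamily_curvature hD hk h (s i) ψ (r i) ψ', ?_⟩
  filter_upwards [hs] with y hy t
  exact (D' t).ricci_eq_sum hy.1 ψ ψ'

theorem smoothFamily_ricciForm (hD : ∀ ψ ψ' ψ'' x, D.torsion ψ ψ' ψ'' x = 0)
    {k : ℝ → TriForm E} (hk : TriSmooth I F k) {D' : ℝ → C.Connection}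
    (h : ∀ t, IsSum (D' t) D (k t)) (ψ : Cₛ^∞⟮I; F, E⟯) {w : ℝ → ∀ x, E x} (hw : C.WeakSmooth w) :
    SmoothFamily I fun t x => (D' t).ricciForm x (ψ x) (w t x) :=
  hw.pair (L := fun t x => (D' t).ricciForm x (ψ x)) fun s =>
    (smoothFamily_ricci hD hk h ψ s).congr fun t x => (D' t).ricciForm_apply ψ s x

theorem smoothFamily_divergence (D : C.Connection) {X : ℝ → Cₛ^∞⟮I; F, E⟯}
    (hX : C.WeakSmooth fun t x => X t x) : SmoothFamily I fun t => D.divergence (X t) := by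
  refine SmoothFamily.of_local fun x => ?_
  obtain ⟨s, r, hs⟩ := C.exists_dual_sections x
  refine ⟨_, SmoothFamily.sum (s := Finset.univ) fun i _ =>
    (C.der_family (s i) (hX (r i))).sub (hX (D.cov (s i) (r i))), ?_⟩
  filter_upwards [hs] with y hy t
  rw [D.divergence_eq_sum hy.1]
  exact Finset.sum_congr rfl fun i _ => by rw [D.der_metric]; ring

end Connection

section Derivative

variable {C : CourantAlgebroid I F E}

theorem TriSmooth.hasDerivAt {k : ℝ → TriForm E} (hk : TriSmooth I F k) (x : M) (a b c : E x) :
    ∃ r, HasDerivAt (fun t => k t x a b c) r 0 := by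
  have h := (hk (ext x a) (ext x b) (ext x c)).hasDerivAt 0 x
  simp only [ext_apply] at h
  exact ⟨_, h⟩

theorem hasDerivAt_sum_mul_zero {ι : Type*} [Fintype ι] {f g : ι → ℝ → ℝ}
    (hf : ∀ i, ∃ r, HasDerivAt (f i) r 0) (hg : ∀ i, ∃ r, HasDerivAt (g i) r 0)
    (hf0 : ∀ i, f i 0 = 0) (hg0 : ∀ i, g i 0 = 0) :
    HasDerivAt (fun t => ∑ i, f i t * g i t) 0 0 := by
  have h : ∀ i ∈ Finset.univ, HasDerivAt (fun t => f i t * g i t) 0 0 := fun i _ => by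
    obtain ⟨r, hr⟩ := hf i
    obtain ⟨r', hr'⟩ := hg i
    have := hr.mul hr'
    rw [hf0, hg0, mul_zero, zero_mul, add_zero] at this
    exact this
  have := HasDerivAt.fun_sum h
  simpa using this

theorem hasDerivAt_quadTerm {k : ℝ → TriForm E} (hk : TriSmooth I F k) {x : M} (h0 : k 0 x = 0)
    (u v : E x) : HasDerivAt (fun t => C.quadTerm (k t) x u v) 0 0 := by
  have hexp : ∀ a b : E x, C.metric x a b = ∑ j, C.metric x a (frameBasis I F E x j) *
      C.metric x b (C.dualFrame x j) := by
    intro a b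
    conv_lhs => rw [← C.sum_frame_dualFrame x a]
    simp only [map_sum, map_smul, LinearMap.sum_apply, LinearMap.smul_apply, smul_eq_mul]
    refine Finset.sum_congr rfl fun j _ => ?_
    rw [C.metric_comm x b]
  have hvv : ∀ a b c d, HasDerivAt (fun t => C.metric x (C.vec (k t) x a b)
      (C.vec (k t) x c d)) 0 0 := fun a b c d => by
    have h1 : ∀ t, C.metric x (C.vec (k t) x a b) (C.vec (k t) x c d) =
        ∑ j, k t x a b (frameBasis I F E x j) * k t x c d (C.dualFrame x j) := fun t => by
      rw [hexp]; simp only [metric_vec]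
    simp only [h1]
    exact hasDerivAt_sum_mul_zero (fun j => hk.hasDerivAt x _ _ _) (fun j => hk.hasDerivAt x _ _ _)
      (fun j => by rw [h0]; simp) (fun j => by rw [h0]; simp)
  have hcc : ∀ a b c d, HasDerivAt (fun t => C.metric x (C.covec (k t) x a b)
      (C.covec (k t) x c d)) 0 0 := fun a b c d => by
    have h1 : ∀ t, C.metric x (C.covec (k t) x a b) (C.covec (k t) x c d) =
        ∑ j, k t x (frameBasis I F E x j) a b * k t x (C.dualFrame x j) c d := fun t => by
      rw [hexp]; simp only [metric_covec]
    simp only [h1]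
    exact hasDerivAt_sum_mul_zero (fun j => hk.hasDerivAt x _ _ _) (fun j => hk.hasDerivAt x _ _ _)
      (fun j => by rw [h0]; simp) (fun j => by rw [h0]; simp)
  have h : ∀ i ∈ Finset.univ, HasDerivAt (fun t => C.quadCurv (k t) x (frameBasis I F E x i) u
      (C.dualFrame x i) v) 0 0 := fun i _ => by
    have := ((((hvv v u (C.dualFrame x i) (frameBasis I F E x i)).neg.add
      (hvv (C.dualFrame x i) u v (frameBasis I F E x i))).sub
      (hvv (frameBasis I F E x i) (C.dualFrame x i) u v)).add
      (hvv u (C.dualFrame x i) (frameBasis I F E x i) v)).add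
      (hcc (C.dualFrame x i) v u (frameBasis I F E x i))
    simp only [neg_zero, add_zero, sub_zero] at this
    exact this
  have := HasDerivAt.fun_sum h
  rw [Finset.sum_const_zero] at this
  exact this

/-- The product of a function vanishing at `0` and a continuous function. -/
theorem hasDerivAt_mul_of_zero {f g : ℝ → ℝ} {f' : ℝ} (hf : HasDerivAt f f' 0) (hf0 : f 0 = 0)
    (hg : ContinuousAt g 0) : HasDerivAt (fun t => f t * g t) (f' * g 0) 0 := by
  rw [hasDerivAt_iff_tendsto_slope] at hf ⊢
  have h1 := hf.mul (hg.tendsto.mono_left nhdsWithin_le_nhds)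
  refine h1.congr' (Filter.Eventually.of_forall fun t => ?_)
  simp only [slope_def_field, hf0, zero_mul, sub_zero]
  ring

end Derivative

/-! ## The variation of the action density -/

theorem isVolumeForm_exp {vol : TopForm I M} (hvol : IsVolumeForm I vol) {u : M → ℝ}
    (hu : ContMDiff I 𝓘(ℝ, ℝ) ∞ u) : IsVolumeForm I fun x => Real.exp (u x) • vol x where
  smooth X := (Real.contDiff_exp.contMDiff.comp hu).mul (hvol.smooth X)
  ne_zero x := smul_ne_zero (Real.exp_ne_zero _) (hvol.ne_zero x)

section Variation

variable {C : CourantAlgebroid I F E} {V : ∀ x, Submodule ℝ (E x)} {T A : ∀ x, E x →ₗ[ℝ] E x}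

/-- The value of the action density on any Levi-Civita connection. -/
theorem ehScalar_eq {vol : TopForm I M} (hvol : IsVolumeForm I vol) (hT : C.IsSplitting V T)
    {D : C.Connection} (hD : D.IsLeviCivita V vol) (x : M) :
    C.ehScalar V vol x = D.scalarCurvature (C.genMetric V) x + C.canonicalScalar x := by
  have h : ∃ D : C.Connection, D.IsLeviCivita V vol := ⟨D, hD⟩
  rw [ehScalar, dif_pos h, hD.scalarCurvature_eq hvol hT h.choose_spec]

theorem contMDiff_scalarCurvature (D : C.Connection) :
    ContMDiff I 𝓘(ℝ, ℝ) ∞ (D.scalarCurvature C.metric) := by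
  have h : D.scalarCurvature C.metric = fun x => C.tr x (D.ricciForm x) := funext fun x => by
    rw [Connection.scalarCurvature, tr]
    refine Finset.sum_congr rfl fun i _ => ?_
    rw [← C.gramInv_metric_sum x (D.ricciForm x (frameBasis I F E x i))]
    refine Finset.sum_congr rfl fun j _ => ?_
    rw [frameBasis_apply, frameBasis_apply, Connection.ricciForm_apply, smul_eq_mul]
  rw [h]
  exact C.contMDiff_tr fun s s' => (D.contMDiff_ricci s s').congr fun x => D.ricciForm_apply s s' x

theorem contMDiff_canonicalScalar (C : CourantAlgebroid I F E) :
    ContMDiff I 𝓘(ℝ, ℝ) ∞ C.canonicalScalar := by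
  by_cases h : ∃ D : C.Connection, ∃ (V : ∀ x, Submodule ℝ (E x)) (vol : TopForm I M),
      C.IsGeneralizedMetric V ∧ IsVolumeForm I vol ∧ D.IsLeviCivita V vol
  · have : C.canonicalScalar = h.choose.scalarCurvature C.metric := funext fun x => by
      rw [canonicalScalar, dif_pos h]
    rw [this]
    exact contMDiff_scalarCurvature _
  · have : C.canonicalScalar = fun _ => 0 := funext fun x => by
      rw [canonicalScalar, dif_neg h]
    rw [this]
    exact contMDiff_const

/-- The linearization of the action density, up to a divergence. -/
def firstVariation (D : C.Connection) (V : ∀ x, Submodule ℝ (E x)) (T A : ∀ x, E x →ₗ[ℝ] E x)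
    (f : M → ℝ) (x : M) : ℝ :=
  f x * (D.scalarCurvature (C.genMetric V) x + C.canonicalScalar x) +
    2 * ∑ m, D.ricciForm x (frameBasis I F E x m) (A x (T x (C.dualFrame x m)))

section Family

variable {B : ℝ → ∀ x, E x →ₗ[ℝ] E x} {ε : ℝ → ℝ}

theorem weakSmooth_inverse_family (hA : C.IsInfinitesimal T A) (hε : ContDiff ℝ ∞ ε)
    (hB : ∀ t x v, B t x v + ε t • A x (B t x v) = v) (s : Cₛ^∞⟮I; F, E⟯) :
    C.WeakSmooth fun t x => B t x (s x) :=
  C.weakSmooth_inverse (L := fun t x => LinearMap.id + ε t • A x)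
    (fun s => (weakSmooth_section C s).add
      (.smul (.of_param hε) (fun s' => .of_function ((hA.smooth s s').slice 0))))
    (fun t x v => hB t x v) s

theorem weakSmooth_conj (hT : C.IsSplitting V T) (hA : C.IsInfinitesimal T A) (hε : ContDiff ℝ ∞ ε)
    (hB : ∀ t x v, B t x v + ε t • A x (B t x v) = v) (s : Cₛ^∞⟮I; F, E⟯) :
    C.WeakSmooth fun t x => IsInfinitesimal.conj T A (B t) (ε t) x (s x) := by
  have h1 := weakSmooth_inverse_family hA hε hB s
  have h2 : C.WeakSmooth fun t x => T x (B t x (s x)) :=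
    h1.endo (T := fun _ => T) fun s s' => .of_function ((hT.smooth s s').slice 0)
  have h3 : C.WeakSmooth fun t x => A x (T x (B t x (s x))) :=
    h2.endo (T := fun _ => A) fun s s' => .of_function ((hA.smooth s s').slice 0)
  exact h2.add (.smul (.of_param hε) h3)

end Family

end Variation

end CourantAlgebroid
end

noncomputable section

namespace CourantAlgebroid

variable {n : ℕ} {H : Type*} [TopologicalSpace H]
  {I : ModelWithCorners ℝ (EuclideanSpace ℝ (Fin n)) H}
  {M : Type*} [TopologicalSpace M] [ChartedSpace H M] [IsManifold I ∞ M]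
  {F : Type*} [NormedAddCommGroup F] [NormedSpace ℝ F]
  {E : M → Type*} [TopologicalSpace (TotalSpace F E)] [∀ x, TopologicalSpace (E x)]
  [∀ x, AddCommGroup (E x)] [∀ x, Module ℝ (E x)] [FiberBundle F E] [VectorBundle ℝ F E]
  [T2Space M] [FiniteDimensional ℝ F] [ContMDiffVectorBundle ∞ F E I]

section Variation

variable {C : CourantAlgebroid I F E} {V : ∀ x, Submodule ℝ (E x)} {T A : ∀ x, E x →ₗ[ℝ] E x}
  {vol : TopForm I M} {D : C.Connection} {p q : ℝ} {f : M → ℝ} {φ : ∀ x, V x →ₗ[ℝ] E x}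
  {B : ℝ → ∀ x, E x →ₗ[ℝ] E x} {ε : ℝ → ℝ} {K : Set M}

/-- A smooth family of Levi-Civita connections for a variation of a generalized metric and a volume
form. -/
theorem exists_connection_family (hvol : IsVolumeForm I vol) (hT : C.IsSplitting V T)
    (hD : D.IsLeviCivita V vol) (hp : p ≠ 1) (hq : q ≠ 1)
    (htr : ∀ x, ∑ i, C.metric x (T x (frameBasis I F E x i)) (C.dualFrame x i) = p - q)
    (hF : (finrank ℝ F : ℝ) = p + q) (hA : C.IsInfinitesimal T A)
    (hφ : ∀ x (v : V x), A x v = φ x v) (hf : ContMDiff I 𝓘(ℝ, ℝ) ∞ f) (hε : ContDiff ℝ ∞ ε)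
    (hε0 : ε 0 = 0) (hB : ∀ t x v, B t x v + ε t • A x (B t x v) = v)
    (hB' : ∀ t x v, B t x (v + ε t • A x v) = v) (hK : IsClosed K) (hAK : ∀ x ∉ K, A x = 0)
    (hfK : ∀ x ∉ K, f x = 0) :
    ∃ (k : ℝ → TriForm E) (D' : ℝ → C.Connection), TriSmooth I F k ∧
      (∀ t, Connection.IsSum (D' t) D (k t)) ∧
      (∀ t, (D' t).IsLeviCivita (graph V fun x => ε t • φ x)
        fun x => Real.exp (ε t * f x) • vol x) ∧
      (∀ t, ∀ x ∉ K, k t x = 0) ∧ ∀ x, k 0 x = 0 := by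
  have hU := weakSmooth_conj hT hA hε hB
  have hS : ∀ t, C.IsSplitting (graph V fun x => ε t • φ x)
      (IsInfinitesimal.conj T A (B t) (ε t)) := fun t =>
    hA.isSplitting_graph hT (hB t) (hB' t) hφ (weakSmooth_slice hU t)
  have hu : SmoothFamily I fun t x => ε t * f x :=
    (SmoothFamily.of_param hε).mul (.of_function hf)
  have hs := fun t => D.leviCivitaTensor_skew (weakSmooth_slice hU t) (hS t)
    (fun x => ε t * f x) p q
  have hk := D.triSmooth_leviCivitaTensor hU hu p q
  have hvan : ∀ t x, (∀ᶠ y in 𝓝 x, ε t • A y = 0) → (∀ᶠ y in 𝓝 x, ε t * f y = 0) →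
      D.leviCivitaTensor (weakSmooth_slice hU t) (fun x => ε t * f x) p q x = 0 := by
    intro t x h1 h2
    refine D.leviCivitaTensor_eq_zero _ p q h2 (D.covEndo_eq_zero _ hT hD.metric_compatible ?_)
    filter_upwards [h1] with y hy
    ext v
    have h3 : ∀ w, ε t • A y w = 0 := fun w => LinearMap.congr_fun hy w
    have h4 := hB t y v
    rw [h3, add_zero] at h4
    rw [IsInfinitesimal.conj_apply, h3, h4, add_zero]
  refine ⟨_, fun t => D.addTensor (hk.slice t) (hs t), hk, fun t => D.isSum_addTensor _ _,
    fun t => ?_, fun t x hx => hvan t x ?_ ?_, fun x => hvan 0 x ?_ ?_⟩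
  · exact Connection.isLeviCivita_addTensor (weakSmooth_slice hU t) (hS t) hD.torsion_free hvol
      hD.divergence_eq hp hq
      (fun x => (IsInfinitesimal.trace_conj (hB t) (hB' t) x).trans (htr x)) hF (hu.slice t)
      (D.isSum_addTensor _ _)
  · filter_upwards [hK.isOpen_compl.mem_nhds hx] with y hy
    rw [hAK y hy, smul_zero]
  · filter_upwards [hK.isOpen_compl.mem_nhds hx] with y hy
    rw [hfK y hy, mul_zero]
  · exact Filter.Eventually.of_forall fun y => by rw [hε0, zero_smul]
  · exact Filter.Eventually.of_forall fun y => by rw [hε0, zero_mul]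

/-- The action density of a variation, and its derivative up to a divergence. -/
theorem exists_density_family (hvol : IsVolumeForm I vol) (hT : C.IsSplitting V T)
    (hD : D.IsLeviCivita V vol) (hp : p ≠ 1) (hq : q ≠ 1)
    (htr : ∀ x, ∑ i, C.metric x (T x (frameBasis I F E x i)) (C.dualFrame x i) = p - q)
    (hF : (finrank ℝ F : ℝ) = p + q) (hA : C.IsInfinitesimal T A)
    (hφ : ∀ x (v : V x), A x v = φ x v) (hf : ContMDiff I 𝓘(ℝ, ℝ) ∞ f) (hε : ContDiff ℝ ∞ ε)
    (hε0 : ε 0 = 0) (hB : ∀ t x v, B t x v + ε t • A x (B t x v) = v)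
    (hB' : ∀ t x v, B t x (v + ε t • A x v) = v) (hK : IsClosed K) (hAK : ∀ x ∉ K, A x = 0)
    (hfK : ∀ x ∉ K, f x = 0) :
    ∃ (R : ℝ → M → ℝ) (X : ℝ → Cₛ^∞⟮I; F, E⟯), SmoothFamily I R ∧
      (C.WeakSmooth fun t x => X t x) ∧ (∀ t, ∀ x ∉ K, X t x = 0) ∧
      (∀ t x, C.ehScalar (graph V fun x => ε t • φ x) (fun x => Real.exp (ε t * f x) • vol x) x =
        R t x + C.canonicalScalar x) ∧
      (∀ x, R 0 x = D.scalarCurvature (C.genMetric V) x) ∧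
      ∀ x, HasDerivAt (fun t => R t x - D.divergence (X t) x)
        (deriv ε 0 * (2 * ∑ m, D.ricciForm x (frameBasis I F E x m)
          (A x (T x (C.dualFrame x m))))) 0 := by
  obtain ⟨k, D', hk, hsum, hLC, hkK, hk0⟩ := exists_connection_family hvol hT hD hp hq htr hF hA hφ
    hf hε hε0 hB hB' hK hAK hfK
  have hU := weakSmooth_conj hT hA hε hB
  have hS : ∀ t, C.IsSplitting (graph V fun x => ε t • φ x)
      (IsInfinitesimal.conj T A (B t) (ε t)) := fun t =>
    hA.isSplitting_graph hT (hB t) (hB' t) hφ (weakSmooth_slice hU t)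
  have hD0 : D' 0 = D := Connection.ext_cov fun ψ χ x => by
    rw [(hsum 0).cov_eq]
    have : C.vec (k 0) x (ψ x) (χ x) = 0 := C.metric_ext fun u => by
      rw [metric_vec, hk0]; simp
    rw [this, add_zero]
  have hB0 : ∀ x v, B 0 x v = v := fun x v => by
    have := hB 0 x v
    rwa [hε0, zero_smul, add_zero] at this
  have hW : ∀ s : Cₛ^∞⟮I; F, E⟯, C.WeakSmooth fun t x => A x (T x (B t x (s x))) := fun s =>
    ((weakSmooth_inverse_family hA hε hB s).endo (T := fun _ => T)
      fun s s' => .of_function ((hT.smooth s s').slice 0)).endo (T := fun _ => A)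
      fun s s' => .of_function ((hA.smooth s s').slice 0)
  have hksm : ∀ t, (k t).Smooth I F := fun t => hk.slice t
  have hXsm : C.WeakSmooth fun t x => Connection.xiSection (hksm t) hT.smooth x := fun s => by
    simp only [Connection.metric_xiSection]
    exact Connection.smoothFamily_xi hk hT.smooth s
  refine ⟨fun t x => ∑ m, (D' t).ricciForm x (frameBasis I F E x m)
    (IsInfinitesimal.conj T A (B t) (ε t) x (C.dualFrame x m)),
    fun t => Connection.xiSection (hksm t) hT.smooth, ?_, hXsm, ?_, ?_, ?_, ?_⟩
  · refine (C.smoothFamily_tr (B := fun t x => ((D' t).ricciForm x).compl₂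
      (IsInfinitesimal.conj T A (B t) (ε t) x)) fun s s' => ?_).congr fun t x => rfl
    exact Connection.smoothFamily_ricciForm hD.torsion_free hk hsum s (hU s')
  · intro t x hx
    refine C.metric_ext fun u => ?_
    rw [Connection.metric_xiSection]
    change ∑ m, (k t x (T x (C.dualFrame x m)) (frameBasis I F E x m) u -
      k t x (frameBasis I F E x m) (T x u) (C.dualFrame x m)) = _
    rw [hkK t x hx]
    simp
  · intro t x
    have hv : IsVolumeForm I fun x => Real.exp (ε t * f x) • vol x :=
      isVolumeForm_exp hvol (u := fun x => ε t * f x) (contMDiff_const.mul hf)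
    rw [ehScalar_eq hv (hS t) (hLC t), (hS t).scalarCurvature_eq]
  · intro x
    rw [hT.scalarCurvature_eq]
    refine Finset.sum_congr rfl fun m _ => ?_
    rw [hD0]
    rw [IsInfinitesimal.conj_apply, hB0, hε0, zero_smul, add_zero]
  · intro x
    have h1 : ∀ t, ∑ m, (D' t).ricciForm x (frameBasis I F E x m)
        (IsInfinitesimal.conj T A (B t) (ε t) x (C.dualFrame x m)) -
        D.divergence (Connection.xiSection (hksm t) hT.smooth) x =
        ∑ m, D.ricciForm x (frameBasis I F E x m) (T x (C.dualFrame x m)) +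
        (1 / 2) * ∑ m, C.quadTerm (k t) x (frameBasis I F E x m) (T x (C.dualFrame x m)) +
        ε t * (2 * ∑ m, (D' t).ricciForm x (frameBasis I F E x m)
          (A x (T x (B t x (C.dualFrame x m))))) := by
      intro t
      have e1 := D.sum_linTerm_eq (hksm t) (hsum t).skew hT.smooth hT.symm (fun ψ χ χ' hχ y => by
        have : χ' = hT.onSection χ := ContMDiffSection.ext hχ
        rw [this, hT.cov_onSection hD.metric_compatible]) x
      have e2 : 2 * ∑ m, (D' t).ricciForm x (frameBasis I F E x m) (T x (C.dualFrame x m)) =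
          2 * ∑ m, D.ricciForm x (frameBasis I F E x m) (T x (C.dualFrame x m)) +
          ∑ m, C.linTerm (D.covTriForm (hksm t) x) (frameBasis I F E x m) (T x (C.dualFrame x m)) +
          ∑ m, C.quadTerm (k t) x (frameBasis I F E x m) (T x (C.dualFrame x m)) := by
        rw [Finset.mul_sum, Finset.sum_congr rfl fun m _ => (hsum t).ricci_eq hD.torsion_free x _ _,
          Finset.sum_add_distrib, Finset.sum_add_distrib, ← Finset.mul_sum]
      simp only [hA.conj_eq (hB t), map_add, map_smul, smul_eq_mul, Finset.sum_add_distrib,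
        ← Finset.mul_sum]
      rw [e1] at e2
      linarith
    have h2 : HasDerivAt (fun t => ∑ m, C.quadTerm (k t) x (frameBasis I F E x m)
        (T x (C.dualFrame x m))) 0 0 := by
      have := HasDerivAt.fun_sum (u := Finset.univ) fun m _ =>
        hasDerivAt_quadTerm (C := C) hk (hk0 x) (frameBasis I F E x m) (T x (C.dualFrame x m))
      rw [Finset.sum_const_zero] at this
      exact this
    have h3 : Continuous fun t => 2 * ∑ m, (D' t).ricciForm x (frameBasis I F E x m)
        (A x (T x (B t x (C.dualFrame x m)))) := by
      refine continuous_const.mul (continuous_finsetSum _ fun m _ => ?_)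
      have := ((Connection.smoothFamily_ricciForm hD.torsion_free hk hsum (frame I F E x m)
        (hW (ext x (C.dualFrame x m)))).contDiff_param x).continuous
      simp only [ext_apply, ← frameBasis_apply] at this
      exact this
    have h4 := hasDerivAt_mul_of_zero
      ((hε.differentiable (by simp) 0).hasDerivAt) hε0 h3.continuousAt
    have h5 := ((h2.const_mul (1 / 2)).const_add
      (∑ m, D.ricciForm x (frameBasis I F E x m) (T x (C.dualFrame x m)))).add h4
    simp only [h1]
    simp only [hD0, hB0, mul_zero, zero_add] at h5
    exact h5

end Variation

end CourantAlgebroid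
end

noncomputable section

namespace CourantAlgebroid

variable {n : ℕ} {H : Type*} [TopologicalSpace H]
  {I : ModelWithCorners ℝ (EuclideanSpace ℝ (Fin n)) H}
  {M : Type*} [TopologicalSpace M] [ChartedSpace H M] [IsManifold I ∞ M]
  {F : Type*} [NormedAddCommGroup F] [NormedSpace ℝ F]
  {E : M → Type*} [TopologicalSpace (TotalSpace F E)] [∀ x, TopologicalSpace (E x)]
  [∀ x, AddCommGroup (E x)] [∀ x, Module ℝ (E x)] [FiberBundle F E] [VectorBundle ℝ F E]
  [T2Space M] [FiniteDimensional ℝ F] [ContMDiffVectorBundle ∞ F E I]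

/-! ## Coordinate vector fields -/

section Coordinates

/-- The basis of `TangentSpace I x` given by the preferred chart at `c`. -/
def coordBasis (I : ModelWithCorners ℝ (EuclideanSpace ℝ (Fin n)) H) [IsManifold I ∞ M] {c x : M}
    (hx : x ∈ (chartAt H c).source) : Basis (Fin n) ℝ (TangentSpace I x) :=
  (trivializationAt (EuclideanSpace ℝ (Fin n)) (TangentSpace I : M → Type _) c).basisAt
    (EuclideanSpace.basisFun (Fin n) ℝ).toBasis hx

/-- The derivative of the inverse of the preferred chart at `c`. -/
abbrev chartDeriv (I : ModelWithCorners ℝ (EuclideanSpace ℝ (Fin n)) H) (c : M)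
    (y : EuclideanSpace ℝ (Fin n)) :
    EuclideanSpace ℝ (Fin n) →L[ℝ] TangentSpace I ((extChartAt I c).symm y) :=
  mfderivWithin 𝓘(ℝ, EuclideanSpace ℝ (Fin n)) I (extChartAt I c).symm (Set.range I) y

theorem coordBasis_apply {c x : M} (hx : x ∈ (chartAt H c).source) (i : Fin n) :
    coordBasis I hx i = (chartDeriv I c (extChartAt I c x)
      (EuclideanSpace.single i (1 : ℝ) : EuclideanSpace ℝ (Fin n)) : EuclideanSpace ℝ (Fin n)) := by
  have h := TangentBundle.symmL_trivializationAt (I := I) hx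
  have h1 := congrArg (fun L => L (EuclideanSpace.single i (1 : ℝ) : EuclideanSpace ℝ (Fin n))) h
  refine Eq.trans ?_ h1
  simp only [coordBasis, Trivialization.basisAt, Basis.map_apply, OrthonormalBasis.coe_toBasis,
    EuclideanSpace.basisFun_apply]
  exact (((trivializationAt (EuclideanSpace ℝ (Fin n)) (TangentSpace I : M → Type _) c).symmₗ_apply
    (R := ℝ) (b := x) hx _)).symm

theorem topForm_congr (vol : TopForm I M) {x y : M} (h : x = y) (v : Fin n → EuclideanSpace ℝ (Fin n)) :
    vol x v = vol y v := by
  subst h; rfl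

theorem chartCoeff_extChartAt (vol : TopForm I M) {c x : M} (hx : x ∈ (chartAt H c).source) :
    chartCoeff I vol c (extChartAt I c x) = vol x (coordBasis I hx) := by
  unfold chartCoeff
  refine (topForm_congr vol ((extChartAt I c).left_inv (by rwa [extChartAt_source])) _).trans ?_
  congr 1
  funext i
  exact (coordBasis_apply hx i).symm

theorem topForm_basis_ne_zero {vol : TopForm I M} {x : M} (h : vol x ≠ 0)
    (b : Basis (Fin n) ℝ (TangentSpace I x)) : vol x b ≠ 0 := fun h0 =>
  h (((vol x).map_basis_eq_zero_iff b).1 h0)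

/-- The coordinate vector fields extend from a neighbourhood of a point to global fields. -/
theorem exists_coordFields {c x : M} (hx : x ∈ (chartAt H c).source) :
    ∃ Y : Fin n → SmoothVectorField I M, ∀ᶠ y in 𝓝 x, ∀ (hy : y ∈ (chartAt H c).source) i,
      Y i y = coordBasis I hy i := by
  set e := trivializationAt (EuclideanSpace ℝ (Fin n)) (TangentSpace I : M → Type _) c with he
  have hxe : x ∈ e.baseSet := hx
  obtain ⟨χ, h1, h2, -, -⟩ := exists_cutoff I (e.open_baseSet.mem_nhds hxe)
  set b := (EuclideanSpace.basisFun (Fin n) ℝ).toBasis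
  refine ⟨fun i => ⟨fun y => χ y • e.localFrame b i y, ?_⟩, ?_⟩
  · exact ContMDiffOn.smul_section_of_tsupport (χ.contMDiff.contMDiffOn) e.open_baseSet h1
      (e.contMDiffOn_localFrame_baseSet ∞ b i)
  · filter_upwards [h2] with y hy hyc i
    change χ y • e.localFrame b i y = _
    rw [hy, one_smul, e.localFrame_apply_of_mem_baseSet b (show y ∈ e.baseSet from hyc)]
    rfl

/-- The function `vol(∂₁, …, ∂ₙ)` on the domain of the chart at `c` is smooth. -/
theorem contMDiffAt_chartCoeff {vol : TopForm I M} (hvol : IsVolumeForm I vol) {c x : M}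
    (hx : x ∈ (chartAt H c).source) :
    ContMDiffAt I 𝓘(ℝ, ℝ) ∞ (fun y => chartCoeff I vol c (extChartAt I c y)) x := by
  obtain ⟨Y, hY⟩ := exists_coordFields (I := I) hx
  refine (hvol.smooth Y x).congr_of_eventuallyEq ?_
  filter_upwards [hY, (chartAt H c).open_source.mem_nhds hx] with y hy hyc
  rw [chartCoeff_extChartAt vol hyc]
  congr 1
  funext i
  exact (hy hyc i).symm

theorem chartCoeff_ne_zero {vol : TopForm I M} (hvol : IsVolumeForm I vol) {c : M}
    {y : EuclideanSpace ℝ (Fin n)} (hy : y ∈ (extChartAt I c).target) :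
    chartCoeff I vol c y ≠ 0 := by
  have hx : (extChartAt I c).symm y ∈ (chartAt H c).source := by
    have := (extChartAt I c).map_target hy
    rwa [extChartAt_source] at this
  have := chartCoeff_extChartAt (I := I) vol hx
  rw [(extChartAt I c).right_inv hy] at this
  rw [this]
  exact topForm_basis_ne_zero (hvol.ne_zero _) _

theorem continuousOn_chartCoeff {vol : TopForm I M} (hvol : IsVolumeForm I vol) (c : M) :
    ContinuousOn (chartCoeff I vol c) (extChartAt I c).target := by
  have h1 : ContinuousOn (fun y => chartCoeff I vol c (extChartAt I c y)) (extChartAt I c).source :=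
    fun x hx => (contMDiffAt_chartCoeff hvol (by rwa [extChartAt_source] at hx)).continuousAt.continuousWithinAt
  refine (h1.comp (continuousOn_extChartAt_symm c) (extChartAt I c).mapsTo_symm).congr ?_
  intro y hy
  simp only [Function.comp_apply]
  rw [(extChartAt I c).right_inv hy]

/-- The standard basis of the model space, as a basis of a tangent space. -/
def modelBasis (I : ModelWithCorners ℝ (EuclideanSpace ℝ (Fin n)) H) (x : M) :
    Basis (Fin n) ℝ (TangentSpace I x) :=
  (EuclideanSpace.basisFun (Fin n) ℝ).toBasis

theorem formRatio_eq (α o : TopForm I M) (x : M) (b : Basis (Fin n) ℝ (TangentSpace I x)) :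
    formRatio I α o x = α x b / o x b := by
  have h0 : (fun i => (EuclideanSpace.single i (1 : ℝ) : EuclideanSpace ℝ (Fin n))) =
      modelBasis I x := by
    funext i
    exact ((EuclideanSpace.basisFun (Fin n) ℝ).coe_toBasis ▸
      (EuclideanSpace.basisFun_apply (Fin n) ℝ i).symm)
  have hb : ∀ β : TopForm I M, β x b = β x (modelBasis I x) * (modelBasis I x).det b := fun β => by
    conv_lhs => rw [(β x).eq_smul_basis_det (modelBasis I x)]
    rfl
  have hd : (modelBasis I x).det b ≠ 0 := ((modelBasis I x).isUnit_det b).ne_zero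
  have h1 : formRatio I α o x = α x (modelBasis I x) / o x (modelBasis I x) := by
    rw [← h0]; rfl
  rw [h1, hb α, hb o, mul_div_mul_right _ _ hd]

end Coordinates

end CourantAlgebroid
end

noncomputable section

namespace CourantAlgebroid

variable {n : ℕ} {H : Type*} [TopologicalSpace H]
  {I : ModelWithCorners ℝ (EuclideanSpace ℝ (Fin n)) H}
  {M : Type*} [TopologicalSpace M] [ChartedSpace H M] [IsManifold I ∞ M]
  {F : Type*} [NormedAddCommGroup F] [NormedSpace ℝ F]
  {E : M → Type*} [TopologicalSpace (TotalSpace F E)] [∀ x, TopologicalSpace (E x)]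
  [∀ x, AddCommGroup (E x)] [∀ x, Module ℝ (E x)] [FiberBundle F E] [VectorBundle ℝ F E]
  [T2Space M] [FiniteDimensional ℝ F] [ContMDiffVectorBundle ∞ F E I]

/-! ## The measure of a volume form -/

section Measure

variable [MeasurableSpace M] [BorelSpace M]

theorem measurableSet_extChartAt_target (c : M) : MeasurableSet (extChartAt I c).target := by
  rw [extChartAt_target]
  exact ((I.continuous_symm.isOpen_preimage _ (chartAt H c).open_target).measurableSet).inter
    I.isClosed_range.measurableSet

theorem aemeasurable_extChartAt_symm (c : M) :
    AEMeasurable (extChartAt I c).symm (volume.restrict (extChartAt I c).target) :=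
  (continuousOn_extChartAt_symm c).aemeasurable (measurableSet_extChartAt_target c)

theorem measurableSet_target_inter_preimage (c : M) {S : Set M} (hS : MeasurableSet S) :
    MeasurableSet ((extChartAt I c).target ∩ (extChartAt I c).symm ⁻¹' S) := by
  have h : Measurable ((extChartAt I c).target.restrict (extChartAt I c).symm) :=
    (continuousOn_iff_continuous_restrict.1 (continuousOn_extChartAt_symm c)).measurable
  have := (measurableSet_extChartAt_target (I := I) c).subtype_image (h hS)
  convert this using 1
  ext y
  simp [Set.restrict, and_comm]

theorem aemeasurable_chartCoeff {vol : TopForm I M} (hvol : IsVolumeForm I vol) (c : M) :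
    AEMeasurable (chartCoeff I vol c) (volume.restrict (extChartAt I c).target) :=
  (continuousOn_chartCoeff hvol c).aemeasurable (measurableSet_extChartAt_target c)

theorem chartMeasure_apply (vol : TopForm I M) (c : M) {S : Set M}
    (hS : MeasurableSet S) : chartMeasure I vol c S =
      ∫⁻ y in (extChartAt I c).target ∩ (extChartAt I c).symm ⁻¹' S,
        ENNReal.ofReal |chartCoeff I vol c y| := by
  unfold chartMeasure
  rw [Measure.map_apply_of_aemeasurable ((aemeasurable_extChartAt_symm c).mono_ac
    (withDensity_absolutelyContinuous _ _)) hS, withDensity_apply', 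
    Measure.restrict_restrict' (measurableSet_extChartAt_target c), Set.inter_comm]

theorem chartMeasure_source (vol : TopForm I M) (c : M) :
    (chartMeasure I vol c).restrict (chartAt H c).source = chartMeasure I vol c := by
  refine Measure.restrict_eq_self_of_ae_mem ?_
  rw [ae_iff]
  change chartMeasure I vol c (chartAt H c).sourceᶜ = 0
  rw [chartMeasure_apply vol c (chartAt H c).open_source.measurableSet.compl]
  have : (extChartAt I c).target ∩ (extChartAt I c).symm ⁻¹' (chartAt H c).sourceᶜ = ∅ := by
    ext y
    simp only [Set.mem_inter_iff, Set.mem_preimage, Set.mem_compl_iff, Set.mem_empty_iff_false,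
      iff_false, not_and, not_not]
    intro hy
    have := (extChartAt I c).map_target hy
    rwa [extChartAt_source] at this
  rw [this]
  simp

/-- The derivative of a change of charts. -/
def transDeriv (I : ModelWithCorners ℝ (EuclideanSpace ℝ (Fin n)) H) (b c : M)
    (y : EuclideanSpace ℝ (Fin n)) :
    EuclideanSpace ℝ (Fin n) →L[ℝ] EuclideanSpace ℝ (Fin n) :=
  (mfderiv I 𝓘(ℝ, EuclideanSpace ℝ (Fin n)) (extChartAt I c) ((extChartAt I b).symm y) :
    TangentSpace I ((extChartAt I b).symm y) →L[ℝ] EuclideanSpace ℝ (Fin n)) ∘L (chartDeriv I b y)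

theorem hasFDerivWithinAt_trans {b c : M} {y : EuclideanSpace ℝ (Fin n)}
    (hy : y ∈ (extChartAt I b).target) (hc : (extChartAt I b).symm y ∈ (chartAt H c).source) :
    HasFDerivWithinAt (extChartAt I c ∘ (extChartAt I b).symm) (transDeriv I b c y)
      (Set.range I) y := by
  have h1 : HasMFDerivAt I 𝓘(ℝ, EuclideanSpace ℝ (Fin n)) (extChartAt I c)
      ((extChartAt I b).symm y) _ := (mdifferentiableAt_extChartAt hc).hasMFDerivAt
  have h2 := (mdifferentiableWithinAt_extChartAt_symm (I := I) hy).hasMFDerivWithinAt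
  exact (h1.comp_hasMFDerivWithinAt y h2).hasFDerivWithinAt

theorem chartCoeff_trans (vol : TopForm I M) {b c : M} {y : EuclideanSpace ℝ (Fin n)}
    (hc : (extChartAt I b).symm y ∈ (chartAt H c).source) :
    chartCoeff I vol b y = (transDeriv I b c y).det *
      chartCoeff I vol c (extChartAt I c ((extChartAt I b).symm y)) := by
  set x := (extChartAt I b).symm y with hx
  rw [chartCoeff_extChartAt vol hc]
  set B := (EuclideanSpace.basisFun (Fin n) ℝ).toBasis with hB
  have hBi : ∀ i, B i = (EuclideanSpace.single i (1 : ℝ) : EuclideanSpace ℝ (Fin n)) := fun i => by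
    simp [hB]
  set L : EuclideanSpace ℝ (Fin n) →ₗ[ℝ] TangentSpace I x :=
    (mfderivWithin 𝓘(ℝ, EuclideanSpace ℝ (Fin n)) I (extChartAt I c).symm (Set.range I)
      (extChartAt I c x) : EuclideanSpace ℝ (Fin n) →L[ℝ] EuclideanSpace ℝ (Fin n)).toLinearMap
    with hL
  have hid : ∀ v : TangentSpace I x, L (mfderiv I 𝓘(ℝ, EuclideanSpace ℝ (Fin n)) (extChartAt I c) x v) = v := fun v => by
    have := mfderivWithin_extChartAt_symm_comp_mfderiv_extChartAt' (I := I) (x := c) (y := x)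
      (by rwa [extChartAt_source])
    exact congrArg (fun A => A v) this
  set α := (vol x).compLinearMap L with hα
  have h1 : vol x (coordBasis I hc) = α B := by
    rw [hα, AlternatingMap.compLinearMap_apply]
    congr 1
    funext i
    rw [coordBasis_apply, hBi]
    rfl
  have h2 : chartCoeff I vol b y = α (fun i => (transDeriv I b c y : _ →ₗ[ℝ] _) (B i)) := by
    rw [hα, AlternatingMap.compLinearMap_apply]
    unfold chartCoeff
    congr 1
    funext i
    rw [hBi]
    exact (hid _).symm
  rw [h1, h2, α.eq_smul_basis_det B]
  simp only [AlternatingMap.smul_apply, smul_eq_mul, Basis.det_self, mul_one]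
  have h3 := B.det_comp (transDeriv I b c y : EuclideanSpace ℝ (Fin n) →ₗ[ℝ] _) B
  rw [Basis.det_self, mul_one] at h3
  have h4 : B.det (fun i => (transDeriv I b c y : _ →ₗ[ℝ] _) (B i)) = (transDeriv I b c y).det := h3
  rw [h4, mul_comm]

theorem chartMeasure_eq (vol : TopForm I M) (b c : M) {S : Set M}
    (hS : MeasurableSet S) (hb : S ⊆ (chartAt H b).source) (hc : S ⊆ (chartAt H c).source) :
    chartMeasure I vol b S = chartMeasure I vol c S := by
  rw [chartMeasure_apply vol b hS, chartMeasure_apply vol c hS]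
  have e1 : ∀ a, S ⊆ (chartAt H a).source → (extChartAt I a).target ∩ (extChartAt I a).symm ⁻¹' S =
      extChartAt I a '' S := fun a ha => by
    refine ((extChartAt I a).image_eq_target_inter_inv_preimage ?_).symm
    rwa [extChartAt_source]
  have hm := measurableSet_target_inter_preimage (I := I) b hS
  set A := (extChartAt I b).target ∩ (extChartAt I b).symm ⁻¹' S with hA
  have e2 : extChartAt I c '' S = (extChartAt I c ∘ (extChartAt I b).symm) '' A := by
    rw [hA, e1 b hb, Set.image_image]
    refine Set.image_congr fun x hx => ?_
    simp only [Function.comp_apply]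
    rw [(extChartAt I b).left_inv]
    rw [extChartAt_source]; exact hb hx
  rw [e1 c hc, e2, lintegral_image_eq_lintegral_abs_det_fderiv_mul volume hm
    (f' := fun y => transDeriv I b c y)]
  · refine setLIntegral_congr_fun hm fun y hy => ?_
    simp only [Function.comp_apply]
    rw [chartCoeff_trans vol (c := c) (hc hy.2), abs_mul, ENNReal.ofReal_mul (abs_nonneg _)]
  · exact fun y hy => (hasFDerivWithinAt_trans hy.1 (hc hy.2)).mono
      fun z hz => extChartAt_target_subset_range b hz.1
  · intro y hy z hz h
    have h' := (extChartAt I c).injOn (by rw [extChartAt_source]; exact hc hy.2)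
      (by rw [extChartAt_source]; exact hc hz.2) h
    exact (extChartAt I b).symm.injOn hy.1 hz.1 h'

variable [SigmaCompactSpace M]

theorem formMeasure_restrict_source (vol : TopForm I M) (b : M) :
    (formMeasure I vol).restrict (chartAt H b).source = chartMeasure I vol b := by
  set ρ := chartPartition I M with hρ
  have hsub : ρ.IsSubordinate fun c => (chartAt H c).source :=
    (SmoothPartitionOfUnity.exists_isSubordinate_chartAt_source I M).choose_spec
  ext S hS
  rw [Measure.restrict_apply hS, ← chartMeasure_source vol b, Measure.restrict_apply hS]
  set S' := S ∩ (chartAt H b).source with hS'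
  have hm : MeasurableSet S' := hS.inter (chartAt H b).open_source.measurableSet
  have hρm : ∀ c, Measurable fun x => ENNReal.ofReal (ρ c x) := fun c =>
    ((ρ c).contMDiff.continuous.measurable).ennreal_ofReal
  unfold formMeasure
  rw [Measure.sum_apply _ hm]
  have h1 : ∀ c, ((chartMeasure I vol c).withDensity fun x => ENNReal.ofReal (ρ c x)) S' =
      ∫⁻ x in S', ENNReal.ofReal (ρ c x) ∂(chartMeasure I vol b) := fun c => by
    rw [withDensity_apply _ hm]
    have hsc : MeasurableSet (chartAt H c).source := (chartAt H c).open_source.measurableSet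
    have hz : ∀ μ : Measure M, ∫⁻ x in S', ENNReal.ofReal (ρ c x) ∂μ =
        ∫⁻ x in S' ∩ (chartAt H c).source, ENNReal.ofReal (ρ c x) ∂μ := fun μ => by
      rw [← lintegral_indicator hm, ← lintegral_indicator (hm.inter hsc)]
      congr 1
      funext x
      by_cases hx : x ∈ (chartAt H c).source
      · by_cases hx' : x ∈ S' <;> simp [hx, hx']
      · have : ρ c x = 0 := by
          by_contra h
          exact hx (hsub c (subset_tsupport _ h))
        by_cases hx' : x ∈ S' <;> simp [hx, hx', this]
    rw [hz, hz]
    congr 1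
    ext T hT
    rw [Measure.restrict_apply hT, Measure.restrict_apply hT]
    refine chartMeasure_eq vol c b (hT.inter (hm.inter hsc)) ?_ ?_
    · exact fun x hx => hx.2.2
    · exact fun x hx => hx.2.1.2
  refine (tsum_congr h1).trans ?_
  set J := {c : M | ∃ x, ρ c x ≠ 0} with hJ
  have hJc : J.Countable := by
    have := ρ.locallyFinite
    have h2 : LocallyFinite fun c : J => Function.support (ρ c) :=
      this.comp_injective Subtype.val_injective
    have h3 := h2.countable_univ fun c => c.2
    exact Set.countable_coe_iff.1 (Set.countable_univ_iff.1 h3)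
  have h0 : ∀ c, c ∉ J → ∀ x, ρ c x = 0 := fun c hc x => by
    by_contra h
    exact hc ⟨x, h⟩
  refine Eq.trans (tsum_subtype_eq_of_support_subset (s := J) ?_).symm ?_
  · intro c hc
    by_contra hcJ
    refine hc ?_
    simp [h0 c hcJ]
  have := hJc.to_subtype
  rw [← lintegral_tsum fun c : J => (hρm c).aemeasurable]
  have h4 : ∀ x, ∑' c : J, ENNReal.ofReal (ρ c x) = 1 := fun x => by
    rw [tsum_subtype_eq_of_support_subset (s := J) (f := fun c => ENNReal.ofReal (ρ c x))]
    · have hfin : (Function.support fun c => ρ c x).Finite := ρ.locallyFinite.point_finite x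
      rw [← ENNReal.ofReal_tsum_of_nonneg (fun c => ρ.nonneg c x) (summable_of_finite_support hfin),
        tsum_eq_finsum hfin, ρ.sum_eq_one (Set.mem_univ x), ENNReal.ofReal_one]
    · intro c hc
      by_contra hcJ
      exact hc (by simp [h0 c hcJ])
  simp only [h4, lintegral_one, Measure.restrict_apply MeasurableSet.univ, Set.univ_inter]

end Measure

end CourantAlgebroid
end

noncomputable section

namespace CourantAlgebroid

variable {n : ℕ} {H : Type*} [TopologicalSpace H]
  {I : ModelWithCorners ℝ (EuclideanSpace ℝ (Fin n)) H}
  {M : Type*} [TopologicalSpace M] [ChartedSpace H M] [IsManifold I ∞ M]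
  {F : Type*} [NormedAddCommGroup F] [NormedSpace ℝ F]
  {E : M → Type*} [TopologicalSpace (TotalSpace F E)] [∀ x, TopologicalSpace (E x)]
  [∀ x, AddCommGroup (E x)] [∀ x, Module ℝ (E x)] [FiberBundle F E] [VectorBundle ℝ F E]
  [T2Space M] [FiniteDimensional ℝ F] [ContMDiffVectorBundle ∞ F E I]

section Measure

theorem exists_interior_mem {U : Set M} (hU : IsOpen U) (hne : U.Nonempty) :
    ∃ x ∈ U, I.IsInteriorPoint x := by
  obtain ⟨x, hx⟩ := hne
  have h1 := extChartAt_target_subset_closure_interior (I := I) (mem_extChartAt_target (I := I) x)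
  have h2 : ∀ᶠ y in 𝓝[(extChartAt I x).target] (extChartAt I x x), (extChartAt I x).symm y ∈ U :=
    (continuousOn_extChartAt_symm x _ (mem_extChartAt_target x)).eventually
      (by rw [extChartAt_to_inv]; exact hU.mem_nhds hx)
  rw [eventually_nhdsWithin_iff, Metric.eventually_nhds_iff] at h2
  obtain ⟨r, hr, h2⟩ := h2
  obtain ⟨y, hy, hyr⟩ := Metric.mem_closure_iff.1 h1 r hr
  have hyt := interior_subset hy
  refine ⟨_, h2 (by rwa [dist_comm]) hyt, ?_⟩
  have hs := (extChartAt I x).map_target hyt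
  rw [extChartAt_source] at hs
  rw [I.isInteriorPoint_iff_of_mem_atlas (n := ∞) (by simp) (chart_mem_atlas H x) hs]
  change extChartAt I x _ ∈ interior (extChartAt I x).target
  rwa [(extChartAt I x).right_inv hyt]

theorem chart_mem_interior {c x : M} (hx : x ∈ (chartAt H c).source) (hi : I.IsInteriorPoint x) :
    extChartAt I c x ∈ interior (extChartAt I c).target :=
  (I.isInteriorPoint_iff_of_mem_atlas (n := ∞) (by simp) (chart_mem_atlas H c) hx).1 hi

theorem dense_interior : Dense (I.interior M) :=
  dense_iff_inter_open.2 fun U hU hne => by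
    obtain ⟨x, hx, hi⟩ := exists_interior_mem (I := I) hU hne
    exact ⟨x, hx, hi⟩

variable [MeasurableSpace M] [BorelSpace M] [SigmaCompactSpace M]

theorem formMeasure_apply_of_subset (vol : TopForm I M) {c : M} {S : Set M}
    (hS : MeasurableSet S) (hc : S ⊆ (chartAt H c).source) : formMeasure I vol S =
      ∫⁻ y in (extChartAt I c).target ∩ (extChartAt I c).symm ⁻¹' S,
        ENNReal.ofReal |chartCoeff I vol c y| := by
  rw [← chartMeasure_apply vol c hS, ← formMeasure_restrict_source vol c,
    Measure.restrict_apply hS, Set.inter_eq_left.2 hc]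

theorem isLocallyFiniteMeasure_formMeasure {vol : TopForm I M} (hvol : IsVolumeForm I vol) :
    IsLocallyFiniteMeasure (formMeasure I vol) := by
  refine ⟨fun x => ?_⟩
  set C := |chartCoeff I vol x (extChartAt I x x)| + 1
  have h1 : ∀ᶠ z in 𝓝 x, |chartCoeff I vol x (extChartAt I x z)| < C :=
    ((contMDiffAt_chartCoeff hvol (mem_chart_source H x)).continuousAt.abs).eventually_lt_const
      (lt_add_one _)
  have h2 : ∀ᶠ z in 𝓝 x, extChartAt I x z ∈ Metric.ball (extChartAt I x x) 1 :=
    (continuousAt_extChartAt x).eventually (Metric.ball_mem_nhds _ one_pos)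
  obtain ⟨U, hU, hUo, hxU⟩ := eventually_nhds_iff.1
    ((h1.and h2).and ((chartAt H x).open_source.mem_nhds (mem_chart_source H x)))
  refine ⟨U, hUo.mem_nhds hxU, ?_⟩
  rw [formMeasure_apply_of_subset vol (c := x) hUo.measurableSet fun z hz => (hU z hz).2]
  have hm := measurableSet_target_inter_preimage (I := I) x hUo.measurableSet
  set A := (extChartAt I x).target ∩ (extChartAt I x).symm ⁻¹' U
  have hA : A ⊆ Metric.ball (extChartAt I x x) 1 := fun y hy => by
    have := (hU _ hy.2).1.2
    rwa [(extChartAt I x).right_inv hy.1] at this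
  calc ∫⁻ y in A, ENNReal.ofReal |chartCoeff I vol x y| ≤ ∫⁻ y in A, ENNReal.ofReal C := by
        refine setLIntegral_mono measurable_const fun y hy => ENNReal.ofReal_le_ofReal ?_
        have := (hU _ hy.2).1.1
        rw [(extChartAt I x).right_inv hy.1] at this
        exact this.le
    _ = ENNReal.ofReal C * volume A := by simp
    _ < ⊤ := ENNReal.mul_lt_top ENNReal.ofReal_lt_top
        ((measure_mono hA).trans_lt measure_ball_lt_top)

theorem isOpenPosMeasure_formMeasure {vol : TopForm I M} (hvol : IsVolumeForm I vol) :
    (formMeasure I vol).IsOpenPosMeasure := by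
  refine ⟨fun U hU hne h0 => ?_⟩
  obtain ⟨x, hx, hi⟩ := exists_interior_mem (I := I) hU hne
  have hxs := mem_chart_source H x
  have hO : IsOpen (U ∩ (chartAt H x).source) := hU.inter (chartAt H x).open_source
  have h1 := measure_mono_null (Set.inter_subset_left (s := U) (t := (chartAt H x).source)) h0
  rw [formMeasure_apply_of_subset vol (c := x) hO.measurableSet Set.inter_subset_right] at h1
  have hm := measurableSet_target_inter_preimage (I := I) x hO.measurableSet
  set A := (extChartAt I x).target ∩ (extChartAt I x).symm ⁻¹' (U ∩ (chartAt H x).source) with hA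
  have hAt : A ⊆ (extChartAt I x).target := Set.inter_subset_left
  rw [lintegral_eq_zero_iff' (((aemeasurable_chartCoeff hvol x).mono_set hAt).abs.ennreal_ofReal)]
    at h1
  have hAn : A ∈ 𝓝 (extChartAt I x x) := by
    have hint := mem_interior_iff_mem_nhds.1 (chart_mem_interior hxs hi)
    refine Filter.inter_mem hint ?_
    refine (continuousAt_extChartAt_symm x).preimage_mem_nhds ?_
    rw [extChartAt_to_inv]
    exact hO.mem_nhds ⟨hx, hxs⟩
  have h2 : volume A = 0 := by
    have h3 : ∀ᵐ y ∂(volume.restrict A), False := by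
      filter_upwards [h1, ae_restrict_mem hm] with y hy hyA
      have := chartCoeff_ne_zero hvol (hAt hyA)
      simp only [Pi.zero_apply, ENNReal.ofReal_eq_zero] at hy
      exact absurd (abs_nonpos_iff.1 hy) this
    rw [ae_iff] at h3
    simpa using h3
  exact (Measure.measure_pos_of_mem_nhds volume hAn).ne' h2

/-- The integral of a function over the domain of a chart. -/
theorem setIntegral_source {vol : TopForm I M} (hvol : IsVolumeForm I vol) (c : M) {G : M → ℝ}
    (hG : Measurable G) : ∫ x in (chartAt H c).source, G x ∂(formMeasure I vol) =
      ∫ y in (extChartAt I c).target, |chartCoeff I vol c y| * G ((extChartAt I c).symm y) := by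
  rw [formMeasure_restrict_source]
  unfold chartMeasure
  rw [integral_map ((aemeasurable_extChartAt_symm c).mono_ac
    (withDensity_absolutelyContinuous _ _)) hG.aestronglyMeasurable,
    integral_withDensity_eq_integral_toReal_smul₀
      (aemeasurable_chartCoeff hvol c).abs.ennreal_ofReal (by simp)]
  simp [ENNReal.toReal_ofReal]

end Measure

end CourantAlgebroid
end

noncomputable section

namespace CourantAlgebroid

variable {n : ℕ} {H : Type*} [TopologicalSpace H]
  {I : ModelWithCorners ℝ (EuclideanSpace ℝ (Fin n)) H}
  {M : Type*} [TopologicalSpace M] [ChartedSpace H M] [IsManifold I ∞ M]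
  {F : Type*} [NormedAddCommGroup F] [NormedSpace ℝ F]
  {E : M → Type*} [TopologicalSpace (TotalSpace F E)] [∀ x, TopologicalSpace (E x)]
  [∀ x, AddCommGroup (E x)] [∀ x, Module ℝ (E x)] [FiberBundle F E] [VectorBundle ℝ F E]
  [T2Space M] [FiniteDimensional ℝ F] [ContMDiffVectorBundle ∞ F E I]

/-! ## The Lie derivative of a top-degree form in a chart -/

section ChartLieDerivative

variable {c : M} {y : EuclideanSpace ℝ (Fin n)}

/-- The coordinate expression of a vector field. -/
def chartField (I : ModelWithCorners ℝ (EuclideanSpace ℝ (Fin n)) H) [IsManifold I ∞ M] (c : M)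
    (X : SmoothVectorField I M) (y : EuclideanSpace ℝ (Fin n)) : EuclideanSpace ℝ (Fin n) :=
  VectorField.mpullback 𝓘(ℝ, EuclideanSpace ℝ (Fin n)) I (extChartAt I c).symm (fun x => X x) y

theorem mem_source_of_mem_interior (hy : y ∈ interior (extChartAt I c).target) :
    (extChartAt I c).symm y ∈ (chartAt H c).source := by
  have := (extChartAt I c).map_target (interior_subset hy)
  rwa [extChartAt_source] at this

theorem mfderiv_symm_eq (hy : y ∈ interior (extChartAt I c).target) :
    mfderiv 𝓘(ℝ, EuclideanSpace ℝ (Fin n)) I (extChartAt I c).symm y = chartDeriv I c y :=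
  (mfderivWithin_of_mem_nhds (Filter.mem_of_superset (mem_interior_iff_mem_nhds.1 hy)
    (extChartAt_target_subset_range c))).symm

theorem isInvertible_mfderiv_symm (hy : y ∈ interior (extChartAt I c).target) :
    (mfderiv 𝓘(ℝ, EuclideanSpace ℝ (Fin n)) I (extChartAt I c).symm y).IsInvertible := by
  rw [mfderiv_symm_eq hy]
  exact isInvertible_mfderivWithin_extChartAt_symm (interior_subset hy)

theorem contMDiffAt_symm (hy : y ∈ interior (extChartAt I c).target) :
    ContMDiffAt 𝓘(ℝ, EuclideanSpace ℝ (Fin n)) I ∞ (extChartAt I c).symm y :=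
  (contMDiffOn_extChartAt_symm c).contMDiffAt (mem_interior_iff_mem_nhds.1 hy)

theorem chartDeriv_chartField (X : SmoothVectorField I M)
    (hy : y ∈ interior (extChartAt I c).target) :
    chartDeriv I c y (chartField I c X y) = X ((extChartAt I c).symm y) := by
  rw [← mfderiv_symm_eq hy]
  exact (isInvertible_mfderiv_symm hy).self_apply_inverse _

theorem contDiffAt_chartField (X : SmoothVectorField I M)
    (hy : y ∈ interior (extChartAt I c).target) : ContDiffAt ℝ ∞ (chartField I c X) y := by
  refine contMDiffAt_vectorSpace_iff_contDiffAt.1 ?_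
  exact ContMDiffAt.mpullback_vectorField_preimage (n := ∞) (X.contMDiff _) (contMDiffAt_symm hy)
    (isInvertible_mfderiv_symm hy) (by simp)

theorem chartField_eq {X : SmoothVectorField I M} {v : EuclideanSpace ℝ (Fin n)}
    (hy : y ∈ interior (extChartAt I c).target)
    (h : X ((extChartAt I c).symm y) = chartDeriv I c y v) : chartField I c X y = v := by
  have h1 := isInvertible_mfderiv_symm hy
  have : chartField I c X y = (mfderiv 𝓘(ℝ, EuclideanSpace ℝ (Fin n)) I (extChartAt I c).symm y).inverse
    (X ((extChartAt I c).symm y)) := rfl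
  rw [this, h, ← mfderiv_symm_eq hy]
  exact h1.inverse_apply_self _

theorem contDiffAt_chartCoeff {vol : TopForm I M} (hvol : IsVolumeForm I vol)
    (hy : y ∈ interior (extChartAt I c).target) : ContDiffAt ℝ ∞ (chartCoeff I vol c) y := by
  have h1 := (contMDiffAt_chartCoeff hvol (mem_source_of_mem_interior hy)).comp y (contMDiffAt_symm hy)
  refine (contMDiffAt_iff_contDiffAt.1 h1).congr_of_eventuallyEq ?_
  filter_upwards [isOpen_interior.mem_nhds hy] with z hz
  simp only [Function.comp_apply]
  rw [(extChartAt I c).right_inv (interior_subset hz)]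

theorem chartDeriv_single (hy : y ∈ interior (extChartAt I c).target) (i : Fin n) :
    chartDeriv I c y (EuclideanSpace.single i (1 : ℝ)) =
      coordBasis I (mem_source_of_mem_interior hy) i := by
  rw [coordBasis_apply, (extChartAt I c).right_inv (interior_subset hy)]

theorem mlieBracket_coord (X Y : SmoothVectorField I M) (i : Fin n)
    (hy : y ∈ interior (extChartAt I c).target)
    (hY : ∀ᶠ z in 𝓝 ((extChartAt I c).symm y), ∀ hz : z ∈ (chartAt H c).source,
      Y z = coordBasis I hz i) :
    VectorField.mlieBracket I (fun z => X z) (fun z => Y z) ((extChartAt I c).symm y) =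
      - chartDeriv I c y (fderiv ℝ (chartField I c X) y (EuclideanSpace.single i (1 : ℝ))) := by
  have h0 : minSmoothness ℝ 2 ≤ (∞ : WithTop ℕ∞) := by
    rw [minSmoothness_of_isRCLikeNormedField]
    exact WithTop.coe_le_coe.2 (le_top (a := (2 : ℕ∞)))
  have : IsManifold I (minSmoothness ℝ 2) M := IsManifold.of_le h0
  have : IsManifold 𝓘(ℝ, EuclideanSpace ℝ (Fin n)) (minSmoothness ℝ 2) (EuclideanSpace ℝ (Fin n)) :=
    inferInstance
  have h1 := VectorField.mpullback_mlieBracket (I := 𝓘(ℝ, EuclideanSpace ℝ (Fin n))) (I' := I)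
    (n := ∞) (f := (extChartAt I c).symm) (V := fun z => X z) (W := fun z => Y z) (x₀ := y)
    ((X.contMDiff _).mdifferentiableAt (by simp)) ((Y.contMDiff _).mdifferentiableAt (by simp))
    (contMDiffAt_symm hy) h0
  have h2 : chartField I c Y =ᶠ[𝓝 y] fun _ => EuclideanSpace.single i (1 : ℝ) := by
    filter_upwards [(contMDiffAt_symm hy).continuousAt.eventually hY,
      isOpen_interior.mem_nhds hy] with z hz hzi
    refine chartField_eq hzi ?_
    rw [hz (mem_source_of_mem_interior hzi), chartDeriv_single hzi]
  have h3 : VectorField.mlieBracket 𝓘(ℝ, EuclideanSpace ℝ (Fin n)) (chartField I c X)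
      (chartField I c Y) y =
      - fderiv ℝ (chartField I c X) y (EuclideanSpace.single i (1 : ℝ)) := by
    refine (congrFun (VectorField.mlieBracketWithin_eq_lieBracketWithin (𝕜 := ℝ)
      (V := chartField I c X) (W := chartField I c Y) (s := Set.univ)) y).trans ?_
    rw [VectorField.lieBracketWithin_univ]
    simp only [VectorField.lieBracket]
    rw [h2.fderiv_eq, h2.eq_of_nhds]
    simp
    rfl
  have h4 := congrArg (fun v => mfderiv 𝓘(ℝ, EuclideanSpace ℝ (Fin n)) I (extChartAt I c).symm y v)
    (h1.trans h3)
  refine Eq.trans ?_ (h4.trans ?_)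
  · exact ((isInvertible_mfderiv_symm hy).self_apply_inverse _).symm
  · refine Eq.trans ?_ (map_neg (chartDeriv I c y) _)
    rw [mfderiv_symm_eq hy]
    rfl

theorem topForm_update (vol : TopForm I M) (hy : y ∈ interior (extChartAt I c).target) (i : Fin n)
    (v : EuclideanSpace ℝ (Fin n)) :
    vol ((extChartAt I c).symm y) (Function.update
      (coordBasis I (mem_source_of_mem_interior hy)) i (chartDeriv I c y v)) =
      v i * chartCoeff I vol c y := by
  set b := coordBasis I (mem_source_of_mem_interior hy) with hb
  have h1 : chartDeriv I c y v = ∑ j, v j • b j := by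
    conv_lhs => rw [← (EuclideanSpace.basisFun (Fin n) ℝ).sum_repr v, map_sum]
    refine Finset.sum_congr rfl fun j _ => ?_
    rw [map_smul, EuclideanSpace.basisFun_apply, chartDeriv_single hy]
    rfl
  have h2 : chartCoeff I vol c y = vol ((extChartAt I c).symm y) b := by
    have := chartCoeff_extChartAt (I := I) vol (mem_source_of_mem_interior hy)
    rwa [(extChartAt I c).right_inv (interior_subset hy)] at this
  rw [h1, AlternatingMap.map_update_sum, Finset.sum_eq_single i, AlternatingMap.map_update_smul,
    Function.update_eq_self, h2, smul_eq_mul]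
  · intro j _ hj
    rw [AlternatingMap.map_update_smul, AlternatingMap.map_update_self _ _ hj.symm, smul_zero]
  · simp

theorem lieDerivTopForm_coord {vol : TopForm I M} (hvol : IsVolumeForm I vol)
    (X : SmoothVectorField I M) (Y : Fin n → SmoothVectorField I M)
    (hy : y ∈ interior (extChartAt I c).target)
    (hY : ∀ᶠ z in 𝓝 ((extChartAt I c).symm y), ∀ (hz : z ∈ (chartAt H c).source) i,
      Y i z = coordBasis I hz i) :
    lieDerivTopForm I X vol Y ((extChartAt I c).symm y) =
      ∑ i, fderiv ℝ (fun z => chartField I c X z i * chartCoeff I vol c z) y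
        (EuclideanSpace.single i (1 : ℝ)) := by
  have hw := (contDiffAt_chartCoeff hvol hy).differentiableAt (by simp)
  have hX := (contDiffAt_chartField X hy).differentiableAt (by simp)
  have hXi : ∀ i, HasFDerivAt (fun z => chartField I c X z i)
      ((EuclideanSpace.proj i : EuclideanSpace ℝ (Fin n) →L[ℝ] ℝ) ∘L fderiv ℝ (chartField I c X) y) y :=
    fun i => (EuclideanSpace.proj i : EuclideanSpace ℝ (Fin n) →L[ℝ] ℝ).hasFDerivAt.comp y
      hX.hasFDerivAt
  have h0 : ∀ i, fderiv ℝ (fun z => chartField I c X z i * chartCoeff I vol c z) y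
      (EuclideanSpace.single i (1 : ℝ)) =
      chartField I c X y i * fderiv ℝ (chartCoeff I vol c) y (EuclideanSpace.single i (1 : ℝ)) +
      fderiv ℝ (chartField I c X) y (EuclideanSpace.single i (1 : ℝ)) i * chartCoeff I vol c y :=
    fun i => by
      refine (congrArg (fun L : EuclideanSpace ℝ (Fin n) →L[ℝ] ℝ => L (EuclideanSpace.single i (1 : ℝ)))
        ((hXi i).mul hw.hasFDerivAt).fderiv).trans ?_
      simp [mul_comm]
  have hYx : ∀ i, Y i ((extChartAt I c).symm y) =
      coordBasis I (mem_source_of_mem_interior hy) i := hY.self_of_nhds _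
  have h1 : mvfderiv I (fun z => vol z (fun i => Y i z)) ((extChartAt I c).symm y)
      (X ((extChartAt I c).symm y)) = fderiv ℝ (chartCoeff I vol c) y (chartField I c X y) := by
    have e1 : chartCoeff I vol c =ᶠ[𝓝 y] (fun z => vol z (fun i => Y i z)) ∘ (extChartAt I c).symm := by
      filter_upwards [(contMDiffAt_symm hy).continuousAt.eventually hY,
        isOpen_interior.mem_nhds hy] with z hz hzi
      have := chartCoeff_extChartAt (I := I) vol (mem_source_of_mem_interior hzi)
      rw [(extChartAt I c).right_inv (interior_subset hzi)] at this
      rw [this]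
      simp only [Function.comp_apply]
      congr 1
      funext i
      exact (hz _ i).symm
    rw [e1.fderiv_eq, ← mfderiv_eq_fderiv]
    rw [mfderiv_comp y ((hvol.smooth Y _).mdifferentiableAt (by simp))
      ((contMDiffAt_symm hy).mdifferentiableAt (by simp))]
    have e2 : mfderiv 𝓘(ℝ, EuclideanSpace ℝ (Fin n)) I (extChartAt I c).symm y (chartField I c X y) =
      X ((extChartAt I c).symm y) := by
      rw [mfderiv_symm_eq hy]; exact chartDeriv_chartField X hy
    exact (congrArg (fun v => mfderiv I 𝓘(ℝ, ℝ) (fun z => vol z (fun i => Y i z))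
      ((extChartAt I c).symm y) v) e2).symm
  have h2 : ∀ i, vol ((extChartAt I c).symm y) (Function.update
      (fun j => Y j ((extChartAt I c).symm y)) i
      (VectorField.mlieBracket I (fun z => X z) (fun z => Y i z) ((extChartAt I c).symm y))) =
      - (fderiv ℝ (chartField I c X) y (EuclideanSpace.single i (1 : ℝ)) i * chartCoeff I vol c y) :=
    fun i => by
      rw [mlieBracket_coord X (Y i) i hy (hY.mono fun z hz hzs => hz hzs i), funext hYx,
        ← topForm_update vol hy, ← AlternatingMap.map_update_neg]
  have h3 : fderiv ℝ (chartCoeff I vol c) y (chartField I c X y) =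
      ∑ i, chartField I c X y i * fderiv ℝ (chartCoeff I vol c) y (EuclideanSpace.single i (1 : ℝ)) := by
    conv_lhs => rw [← (EuclideanSpace.basisFun (Fin n) ℝ).sum_repr (chartField I c X y), map_sum]
    refine Finset.sum_congr rfl fun j _ => ?_
    rw [map_smul, EuclideanSpace.basisFun_apply]
    rfl
  unfold lieDerivTopForm
  rw [h1, Finset.sum_congr rfl fun i _ => h2 i, Finset.sum_congr rfl fun i _ => h0 i,
    Finset.sum_add_distrib, ← h3, Finset.sum_neg_distrib, sub_neg_eq_add]

end ChartLieDerivative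

end CourantAlgebroid
end

noncomputable section

namespace CourantAlgebroid

variable {n : ℕ} {H : Type*} [TopologicalSpace H]
  {I : ModelWithCorners ℝ (EuclideanSpace ℝ (Fin n)) H}
  {M : Type*} [TopologicalSpace M] [ChartedSpace H M] [IsManifold I ∞ M]
  {F : Type*} [NormedAddCommGroup F] [NormedSpace ℝ F]
  {E : M → Type*} [TopologicalSpace (TotalSpace F E)] [∀ x, TopologicalSpace (E x)]
  [∀ x, AddCommGroup (E x)] [∀ x, Module ℝ (E x)] [FiberBundle F E] [VectorBundle ℝ F E]
  [T2Space M] [FiniteDimensional ℝ F] [ContMDiffVectorBundle ∞ F E I]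

/-! ## The divergence theorem -/

section DivergenceTheorem

theorem contMDiff_formRatio {α o : TopForm I M} (hα : IsVolumeForm I α) (ho : IsVolumeForm I o) :
    ContMDiff I 𝓘(ℝ, ℝ) ∞ (formRatio I α o) := fun x => by
  have hx := mem_chart_source H x
  have h1 := (contMDiffAt_chartCoeff hα hx).div₀ (contMDiffAt_chartCoeff ho hx)
    (chartCoeff_ne_zero ho ((extChartAt I x).map_source (mem_extChartAt_source x)))
  refine h1.congr_of_eventuallyEq ?_
  filter_upwards [(chartAt H x).open_source.mem_nhds hx] with z hz
  rw [formRatio_eq α o z (coordBasis I hz)]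
  simp only [Pi.div_apply]
  rw [chartCoeff_extChartAt α hz, chartCoeff_extChartAt o hz]

theorem formRatio_ne_zero {α o : TopForm I M} (hα : IsVolumeForm I α) (ho : IsVolumeForm I o) (x : M) :
    formRatio I α o x ≠ 0 := by
  rw [formRatio_eq α o x (modelBasis I x)]
  exact div_ne_zero (topForm_basis_ne_zero (hα.ne_zero x) _) (topForm_basis_ne_zero (ho.ne_zero x) _)

theorem formRatio_smul (α o : TopForm I M) (u : M → ℝ) (x : M) :
    formRatio I (fun x => u x • α x) o x = u x * formRatio I α o x := by
  exact mul_div_assoc _ _ _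

theorem lieDerivTopForm_eq_zero {vol : TopForm I M} {X : SmoothVectorField I M}
    (Y : Fin n → SmoothVectorField I M) {x : M} (hX : ∀ᶠ z in 𝓝 x, X z = 0) :
    lieDerivTopForm I X vol Y x = 0 := by
  have h1 : ∀ i, VectorField.mlieBracket I (fun y => X y) (fun y => Y i y) x = 0 := fun i => by
    have h2 : (fun y => X y) =ᶠ[𝓝 x] (0 : ∀ y : M, TangentSpace I y) := hX
    refine (h2.mlieBracket_vectorField_eq (W := fun y => Y i y) (W₁ := fun y => Y i y)
      (Filter.EventuallyEq.refl _ _)).trans ?_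
    rw [VectorField.mlieBracket_zero_left]
    rfl
  unfold lieDerivTopForm
  rw [hX.self_of_nhds, map_zero, Finset.sum_eq_zero, sub_zero]
  intro i _
  rw [h1 i]
  exact (vol x).map_update_zero _ i

/-- The integral of a partial derivative of a compactly supported function vanishes. -/
theorem integral_fderiv_eq_zero {g : EuclideanSpace ℝ (Fin n) → ℝ} (hg : ContDiff ℝ 1 g)
    (hc : HasCompactSupport g) (v : EuclideanSpace ℝ (Fin n)) :
    Integrable (fun y => fderiv ℝ g y v) ∧ ∫ y, fderiv ℝ g y v = 0 := by
  have hi : Integrable (fun y => fderiv ℝ g y v) :=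
    ((hg.continuous_fderiv (by simp)).clm_apply continuous_const).integrable_of_hasCompactSupport
      (hc.fderiv_apply ℝ v)
  refine ⟨hi, ?_⟩
  have := integral_mul_fderiv_eq_neg_fderiv_mul_of_integrable (μ := volume) (v := v)
    (f := fun _ : EuclideanSpace ℝ (Fin n) => (1 : ℝ)) (g := g) (by simp) (by simpa using hi)
    (by simpa using hg.continuous.integrable_of_hasCompactSupport hc)
    (fun x _ => differentiableAt_const _) (fun x _ => (hg.differentiable (by simp)) x)
  simpa using this

variable [MeasurableSpace M] [BorelSpace M] [SigmaCompactSpace M]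
variable {o vol : TopForm I M} {X : SmoothVectorField I M} {β : M → ℝ} {K : Set M}

theorem eventually_sign_eq {w : EuclideanSpace ℝ (Fin n) → ℝ} {y : EuclideanSpace ℝ (Fin n)}
    (hw : ContinuousAt w y) (h : w y ≠ 0) :
    ∀ᶠ z in 𝓝 y, (SignType.sign (w z) : ℝ) = SignType.sign (w y) := by
  rcases lt_or_gt_of_ne h with h | h
  · filter_upwards [hw.eventually_lt_const h] with z hz
    rw [sign_neg h, sign_neg hz]
  · filter_upwards [hw.eventually_const_lt h] with z hz
    rw [sign_pos h, sign_pos hz]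

theorem integral_divergence_of_chart (ho : IsVolumeForm I o) (hvol : IsVolumeForm I vol)
    (hβ : Continuous β)
    (hL : ∀ Y x, lieDerivTopForm I X vol Y x = β x * vol x (fun i => Y i x)) (hK : IsCompact K)
    (hKi : K ⊆ I.interior M) {c : M} (hKc : K ⊆ (chartAt H c).source) (hX : ∀ x ∉ K, X x = 0)
    (hβ0 : ∀ x ∉ K, β x = 0) :
    ∫ x, β x * formRatio I vol o x ∂(formMeasure I o) = 0 := by
  set σ := (extChartAt I c).symm with hσ
  have hcK : IsCompact (extChartAt I c '' K) := hK.image_of_continuousOn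
    ((continuousOn_extChartAt c).mono (by rwa [extChartAt_source]))
  have hKint : extChartAt I c '' K ⊆ interior (extChartAt I c).target := by
    rintro _ ⟨x, hx, rfl⟩
    exact chart_mem_interior (hKc hx) (hKi hx)
  have hmem : ∀ y ∈ (extChartAt I c).target, y ∉ extChartAt I c '' K → σ y ∉ K := fun y hy h hK =>
    h ⟨_, hK, (extChartAt I c).right_inv hy⟩
  set w : EuclideanSpace ℝ (Fin n) → ℝ := fun y => SignType.sign (chartCoeff I o c y) with hw
  classical
  set g : Fin n → EuclideanSpace ℝ (Fin n) → ℝ := fun i y =>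
    if y ∈ interior (extChartAt I c).target then
      w y * (chartField I c X y i * chartCoeff I vol c y) else 0 with hg
  have hX0 : ∀ y ∈ interior (extChartAt I c).target, y ∉ extChartAt I c '' K →
      chartField I c X y = 0 := fun y hy h => by
    refine chartField_eq hy ?_
    rw [hX _ (hmem y (interior_subset hy) h), map_zero]
  have hg0 : ∀ i, ∀ y ∉ extChartAt I c '' K, g i y = 0 := fun i y hy => by
    by_cases h : y ∈ interior (extChartAt I c).target
    · simp [hg, h, hX0 y h hy]
    · exact if_neg h
  have hgloc : ∀ i, ∀ y ∈ interior (extChartAt I c).target,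
      g i =ᶠ[𝓝 y] fun z => w y * (chartField I c X z i * chartCoeff I vol c z) := fun i y hy => by
    filter_upwards [eventually_sign_eq (contDiffAt_chartCoeff ho hy).continuousAt
      (chartCoeff_ne_zero ho (interior_subset hy)), isOpen_interior.mem_nhds hy] with z hz hzi
    simp only [hg, hzi, if_true, hw]
    rw [hz]
  have hsm : ∀ i, ∀ y ∈ interior (extChartAt I c).target,
      ContDiffAt ℝ ∞ (fun z => chartField I c X z i * chartCoeff I vol c z) y := fun i y hy =>
    ((EuclideanSpace.proj i : EuclideanSpace ℝ (Fin n) →L[ℝ] ℝ).contDiff.contDiffAt.comp y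
      (contDiffAt_chartField X hy)).mul (contDiffAt_chartCoeff hvol hy)
  have hgsm : ∀ i, ContDiff ℝ 1 (g i) := fun i => contDiff_iff_contDiffAt.2 fun y => by
    by_cases hy : y ∈ interior (extChartAt I c).target
    · exact ((contDiffAt_const.mul ((hsm i y hy).of_le (by simp))).congr_of_eventuallyEq (hgloc i y hy))
    · refine contDiffAt_const (c := (0 : ℝ)).congr_of_eventuallyEq ?_
      filter_upwards [hcK.isClosed.isOpen_compl.mem_nhds fun h => hy (hKint h)] with z hz
      exact hg0 i z hz
  have hgc : ∀ i, HasCompactSupport (g i) := fun i =>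
    HasCompactSupport.intro hcK fun y hy => hg0 i y hy
  have hfd0 : ∀ i, ∀ y ∉ extChartAt I c '' K, fderiv ℝ (g i) y = 0 := fun i y hy => by
    have : g i =ᶠ[𝓝 y] fun _ => 0 := by
      filter_upwards [hcK.isClosed.isOpen_compl.mem_nhds hy] with z hz
      exact hg0 i z hz
    rw [this.fderiv_eq]; simp
  have hGm : Measurable fun x => β x * formRatio I vol o x :=
    (hβ.mul (contMDiff_formRatio hvol ho).continuous).measurable
  rw [← setIntegral_eq_integral_of_forall_compl_eq_zero (s := (chartAt H c).source)
    fun x hx => by rw [hβ0 x fun h => hx (hKc h), zero_mul], setIntegral_source ho c hGm]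
  have hkey : ∀ y ∈ (extChartAt I c).target,
      |chartCoeff I o c y| * (β (σ y) * formRatio I vol o (σ y)) =
      ∑ i, fderiv ℝ (g i) y (EuclideanSpace.single i (1 : ℝ)) := fun y hy => by
    by_cases hyK : y ∈ extChartAt I c '' K
    · have hyi := hKint hyK
      have hs := mem_source_of_mem_interior hyi
      obtain ⟨Y, hY⟩ := exists_coordFields (I := I) hs
      have h1 := lieDerivTopForm_coord hvol X Y hyi hY
      have hcv := chartCoeff_extChartAt (I := I) vol hs
      have hco := chartCoeff_extChartAt (I := I) o hs
      rw [(extChartAt I c).right_inv hy] at hcv hco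
      have h2 : (fun i => Y i (σ y)) = coordBasis I hs := funext fun i => hY.self_of_nhds hs i
      have h3 := hL Y (σ y)
      rw [h2, ← hcv] at h3
      rw [formRatio_eq vol o (σ y) (coordBasis I hs), ← hcv, ← hco]
      have h4 : ∀ i, fderiv ℝ (g i) y (EuclideanSpace.single i (1 : ℝ)) = w y *
          fderiv ℝ (fun z => chartField I c X z i * chartCoeff I vol c z) y
            (EuclideanSpace.single i (1 : ℝ)) := fun i => by
        rw [(hgloc i y hyi).fderiv_eq, fderiv_const_mul ((hsm i y hyi).differentiableAt (by simp))]
        rfl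
      rw [Finset.sum_congr rfl fun i _ => h4 i, ← Finset.mul_sum, ← h1, h3]
      have h5 : |chartCoeff I o c y| = w y * chartCoeff I o c y := (sign_mul_self _).symm
      have h6 := chartCoeff_ne_zero ho hy
      rw [h5]
      field_simp
    · rw [hβ0 _ (hmem y hy hyK), Finset.sum_eq_zero fun i _ => by rw [hfd0 i y hyK]; rfl]
      simp
  rw [setIntegral_congr_fun (measurableSet_extChartAt_target c) hkey,
    setIntegral_eq_integral_of_forall_compl_eq_zero fun y hy => ?_,
    integral_finset_sum _ fun i _ => (integral_fderiv_eq_zero (hgsm i) (hgc i) _).1]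
  · exact Finset.sum_eq_zero fun i _ => (integral_fderiv_eq_zero (hgsm i) (hgc i) _).2
  · exact Finset.sum_eq_zero fun i _ => by
      rw [hfd0 i y fun h => hy (interior_subset (hKint h))]; rfl

end DivergenceTheorem

end CourantAlgebroid
end

noncomputable section

namespace CourantAlgebroid

variable {n : ℕ} {H : Type*} [TopologicalSpace H]
  {I : ModelWithCorners ℝ (EuclideanSpace ℝ (Fin n)) H}
  {M : Type*} [TopologicalSpace M] [ChartedSpace H M] [IsManifold I ∞ M]
  {F : Type*} [NormedAddCommGroup F] [NormedSpace ℝ F]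
  {E : M → Type*} [TopologicalSpace (TotalSpace F E)] [∀ x, TopologicalSpace (E x)]
  [∀ x, AddCommGroup (E x)] [∀ x, Module ℝ (E x)] [FiberBundle F E] [VectorBundle ℝ F E]
  [T2Space M] [FiniteDimensional ℝ F] [ContMDiffVectorBundle ∞ F E I]

section GlobalDivergence

variable {C : CourantAlgebroid I F E} {V : ∀ x, Submodule ℝ (E x)} {D : C.Connection}
  {o vol : TopForm I M} {K : Set M}

theorem Connection.contMDiff_divergence (D : C.Connection) (ψ : Cₛ^∞⟮I; F, E⟯) :
    ContMDiff I 𝓘(ℝ, ℝ) ∞ (D.divergence ψ) :=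
  (D.smoothFamily_divergence (X := fun _ => ψ) (C.weakSmooth_section ψ)).slice 0

theorem Connection.divergence_sum (D : C.Connection) {ι : Type*} (s : Finset ι)
    (ψ : ι → Cₛ^∞⟮I; F, E⟯) (x : M) :
    D.divergence (∑ i ∈ s, ψ i) x = ∑ i ∈ s, D.divergence (ψ i) x := by
  classical
  induction s using Finset.induction_on with
  | empty => simp [Connection.divergence]
  | insert a s ha ih =>
    rw [Finset.sum_insert ha, Finset.sum_insert ha, ← ih]
    simp [Connection.divergence, Finset.sum_add_distrib]

theorem IsLeviCivita.divergence_eq_zero (hvol : IsVolumeForm I vol) (hD : D.IsLeviCivita V vol)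
    {ψ : Cₛ^∞⟮I; F, E⟯} {x : M} (h : ∀ᶠ z in 𝓝 x, ψ z = 0) : D.divergence ψ x = 0 := by
  obtain ⟨Y, hY⟩ := exists_topForm_ne_zero hvol x
  have h1 := hD.divergence_eq ψ Y x
  rw [lieDerivTopForm_eq_zero] at h1
  · exact (mul_eq_zero.1 h1.symm).resolve_right hY
  · filter_upwards [h] with z hz
    change C.anchor z (ψ z) = 0
    rw [hz, map_zero]

variable [MeasurableSpace M] [BorelSpace M] [SigmaCompactSpace M]

/-- The divergence theorem for sections vanishing outside a compact subset of the interior. -/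
theorem integral_divergence (ho : IsVolumeForm I o) (hvol : IsVolumeForm I vol)
    (hD : D.IsLeviCivita V vol) (hK : IsCompact K) (hKi : K ⊆ I.interior M)
    {ψ : Cₛ^∞⟮I; F, E⟯} (hψ : ∀ x ∉ K, ψ x = 0) :
    ∫ x in K, D.divergence ψ x * formRatio I vol o x ∂(formMeasure I o) = 0 := by
  have := isLocallyFiniteMeasure_formMeasure ho
  have hzero : ∀ {K' : Set M} {φ : Cₛ^∞⟮I; F, E⟯}, IsClosed K' → (∀ x ∉ K', φ x = 0) →
      ∀ x ∉ K', D.divergence φ x = 0 := fun hK' hφ x hx =>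
    IsLeviCivita.divergence_eq_zero hvol hD (by
      filter_upwards [hK'.isOpen_compl.mem_nhds hx] with z hz using hφ z hz)
  rw [setIntegral_eq_integral_of_forall_compl_eq_zero fun x hx => by
    rw [hzero hK.isClosed hψ x hx, zero_mul]]
  set ρ := chartPartition I M with hρ
  have hsub : ρ.IsSubordinate fun c => (chartAt H c).source :=
    (SmoothPartitionOfUnity.exists_isSubordinate_chartAt_source I M).choose_spec
  have hfin := ρ.locallyFinite.finite_nonempty_inter_compact hK
  set s := hfin.toFinset with hs
  have hsum : ψ = ∑ c ∈ s, smulSection (ρ c) ψ := by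
    ext x
    have h1 : (∑ c ∈ s, smulSection (ρ c) ψ) x = (∑ c ∈ s, ρ c x) • ψ x := by
      rw [Finset.sum_smul]
      exact map_sum (evalAt (I := I) (F := F) (E := E) x) (fun c => smulSection (ρ c) ψ) s
    rw [h1]
    by_cases hx : x ∈ K
    · have h2 := ρ.sum_eq_one (Set.mem_univ x)
      rw [finsum_eq_sum_of_support_subset (s := s) _ (fun c hc => ?_)] at h2
      · rw [h2, one_smul]
      · simp only [hs, Set.Finite.coe_toFinset, Set.mem_setOf_eq]
        exact ⟨x, hc, hx⟩
    · rw [hψ x hx, smul_zero]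
  have hz : ∀ c, ∀ x ∉ K ∩ tsupport (ρ c), smulSection (ρ c) ψ x = 0 := fun c x hx => by
    change ρ c x • ψ x = 0
    by_cases hxK : x ∈ K
    · rw [image_eq_zero_of_notMem_tsupport fun h => hx ⟨hxK, h⟩, zero_smul]
    · rw [hψ x hxK, smul_zero]
  have hcK : ∀ c, IsCompact (K ∩ tsupport (ρ c)) := fun c => hK.inter_right (isClosed_tsupport _)
  have hint : ∀ x, D.divergence ψ x * formRatio I vol o x =
      ∑ c ∈ s, D.divergence (smulSection (ρ c) ψ) x * formRatio I vol o x := fun x => by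
    conv_lhs => rw [hsum]
    rw [D.divergence_sum, Finset.sum_mul]
  rw [integral_congr_ae (Filter.Eventually.of_forall hint), integral_finset_sum]
  · refine Finset.sum_eq_zero fun c _ => ?_
    refine integral_divergence_of_chart (X := C.anchorField (smulSection (ρ c) ψ)) (c := c) ho hvol
      (D.contMDiff_divergence _).continuous (hD.divergence_eq _) (hcK c)
      (Set.inter_subset_left.trans hKi) (Set.inter_subset_right.trans (hsub c)) (fun x hx => ?_)
      (hzero (hcK c).isClosed (hz c))
    change C.anchor x (smulSection (ρ c) ψ x) = 0
    rw [hz c x hx, map_zero]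
  · refine fun c _ => Continuous.integrable_of_hasCompactSupport
      ((D.contMDiff_divergence _).continuous.mul (contMDiff_formRatio hvol ho).continuous) ?_
    exact HasCompactSupport.intro (hcK c) fun x hx => by
      rw [hzero (hcK c).isClosed (hz c) x hx, zero_mul]

end GlobalDivergence

end CourantAlgebroid
end

noncomputable section

namespace CourantAlgebroid

variable {n : ℕ} {H : Type*} [TopologicalSpace H]
  {I : ModelWithCorners ℝ (EuclideanSpace ℝ (Fin n)) H}
  {M : Type*} [TopologicalSpace M] [ChartedSpace H M] [IsManifold I ∞ M]
  {F : Type*} [NormedAddCommGroup F] [NormedSpace ℝ F]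
  {E : M → Type*} [TopologicalSpace (TotalSpace F E)] [∀ x, TopologicalSpace (E x)]
  [∀ x, AddCommGroup (E x)] [∀ x, Module ℝ (E x)] [FiberBundle F E] [VectorBundle ℝ F E]
  [T2Space M] [FiniteDimensional ℝ F] [ContMDiffVectorBundle ∞ F E I]

/-! ## The first variation of the action -/

section FirstVariation

variable [MeasurableSpace M] [BorelSpace M]

/-- Differentiation under the integral over a compact set. -/
theorem hasDerivAt_integral_of_smoothFamily {μ : Measure M} [IsLocallyFiniteMeasure μ]
    {u : ℝ → M → ℝ} (hu : SmoothFamily I u) {K : Set M} (hK : IsCompact K) :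
    HasDerivAt (fun t => ∫ x in K, u t x ∂μ) (∫ x in K, deriv (fun s => u s x) 0 ∂μ) 0 := by
  have hc : ∀ t, Continuous (u t) := fun t => (hu.slice t).continuous
  have hd := hu.deriv_param.continuous
  obtain ⟨b, hb⟩ := ((isCompact_closedBall (0 : ℝ) 1).prod hK).exists_bound_of_continuousOn
    hd.continuousOn
  have : IsFiniteMeasure (μ.restrict K) := isFiniteMeasure_restrict.2 hK.measure_lt_top.ne
  exact (hasDerivAt_integral_of_dominated_loc_of_deriv_le (μ := μ.restrict K) (x₀ := (0 : ℝ))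
    (F := u) (F' := fun t x => deriv (fun s => u s x) t) (bound := fun _ => b)
    (Metric.ball_mem_nhds 0 one_pos)
    (Filter.Eventually.of_forall fun t => (hc t).measurable.aestronglyMeasurable)
    ((hc 0).continuousOn.integrableOn_compact hK)
    (hu.deriv_param.slice 0).continuous.measurable.aestronglyMeasurable
    ((ae_restrict_mem hK.measurableSet).mono fun x hx t ht =>
      hb (t, x) ⟨Metric.ball_subset_closedBall ht, hx⟩)
    (integrable_const b)
    (Filter.Eventually.of_forall fun x t _ => hu.hasDerivAt t x)).2

variable [SigmaCompactSpace M]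
variable {C : CourantAlgebroid I F E} {V : ∀ x, Submodule ℝ (E x)} {T A : ∀ x, E x →ₗ[ℝ] E x}
  {o vol : TopForm I M} {D : C.Connection} {p q : ℝ} {f : M → ℝ} {φ : ∀ x, V x →ₗ[ℝ] E x}
  {K : Set M}

theorem ehAction_eq (U : ∀ x, Submodule ℝ (E x)) (ε : ℝ) :
    C.ehAction o K U (fun x => Real.exp (ε * f x) • vol x) =
      ∫ x in K, C.ehScalar U (fun x => Real.exp (ε * f x) • vol x) x * Real.exp (ε * f x) *
        formRatio I vol o x ∂(formMeasure I o) := by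
  unfold ehAction integralTopForm
  congr 1
  funext x
  rw [formRatio_smul (fun x => Real.exp (ε * f x) • vol x),
    formRatio_smul vol o (fun x => Real.exp (ε * f x)), mul_assoc]

/-- The first variation of the generalized Einstein-Hilbert action. -/
theorem hasDerivAt_ehAction (ho : IsVolumeForm I o) (hvol : IsVolumeForm I vol)
    (hT : C.IsSplitting V T)
    (hD : D.IsLeviCivita V vol) (hp : p ≠ 1) (hq : q ≠ 1)
    (htr : ∀ x, ∑ i, C.metric x (T x (frameBasis I F E x i)) (C.dualFrame x i) = p - q)
    (hF : (finrank ℝ F : ℝ) = p + q) (hA : C.IsInfinitesimal T A)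
    (hφ : ∀ x (v : V x), A x v = φ x v) (hf : ContMDiff I 𝓘(ℝ, ℝ) ∞ f)
    (hK : IsCompact K) (hKi : K ⊆ I.interior M) (hAK : ∀ x ∉ K, A x = 0)
    (hfK : ∀ x ∉ K, f x = 0) :
    HasDerivAt (fun ε : ℝ => C.ehAction o K
        (graph V (fun x => ε • φ x)) (fun x => Real.exp (ε * f x) • vol x))
      (∫ x in K, firstVariation D V T A f x * formRatio I vol o x ∂(formMeasure I o)) 0 := by
  have := isLocallyFiniteMeasure_formMeasure ho
  obtain ⟨δ, hδ, B, hB⟩ := exists_inverse hA.smooth hK hAK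
  have hle : ∀ t, |δ * Real.sin t| ≤ δ := fun t => by
    rw [abs_mul, abs_of_pos hδ]
    exact mul_le_of_le_one_right hδ.le (Real.abs_sin_le_one t)
  have hε : ContDiff ℝ ∞ fun t => δ * Real.sin t := contDiff_const.mul Real.contDiff_sin
  have hε' : HasDerivAt (fun t => δ * Real.sin t) δ 0 := by
    simpa using (Real.hasDerivAt_sin 0).const_mul δ
  obtain ⟨R, X, hR, hX, hX0, hS, hR0, hder⟩ := exists_density_family (B := fun t => B (δ * Real.sin t))
    (ε := fun t => δ * Real.sin t) hvol hT hD hp hq htr hF hA hφ hf hε (by simp)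
    (fun t x v => (hB _ (hle t) x v).1) (fun t x v => (hB _ (hle t) x v).2) hK.isClosed hAK hfK
  have hrc : ContMDiff I 𝓘(ℝ, ℝ) ∞ (formRatio I vol o) := contMDiff_formRatio hvol ho
  set h := formRatio I vol o with hh
  set S : ℝ → ℝ := fun ε => C.ehAction o K
        (graph V (fun x => ε • φ x)) (fun x => Real.exp (ε * f x) • vol x) with hSdef
  set J := ∫ x in K, firstVariation D V T A f x * h x ∂(formMeasure I o) with hJ
  have hexp : SmoothFamily I fun t x => Real.exp (δ * Real.sin t * f x) :=
    Real.contDiff_exp.contMDiff.comp ((SmoothFamily.of_param hε).mul (.of_function hf))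
  have hdens : SmoothFamily I fun t x =>
      (R t x + C.canonicalScalar x) * Real.exp (δ * Real.sin t * f x) :=
    (hR.add (.of_function (contMDiff_canonicalScalar C))).mul hexp
  have hdiv := D.smoothFamily_divergence hX
  have hG : SmoothFamily I fun t x => ((R t x + C.canonicalScalar x) *
      Real.exp (δ * Real.sin t * f x) - D.divergence (X t) x) * h x :=
    (hdens.sub hdiv).mul (.of_function hrc)
  have hint : ∀ {g : M → ℝ}, Continuous g → IntegrableOn g K (formMeasure I o) :=
    fun hg => hg.continuousOn.integrableOn_compact hK
  have hSt : ∀ t, S (δ * Real.sin t) = ∫ x in K, ((R t x + C.canonicalScalar x) *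
      Real.exp (δ * Real.sin t * f x) - D.divergence (X t) x) * h x ∂(formMeasure I o) := fun t => by
    simp only [hSdef]
    rw [ehAction_eq]
    simp only [hS, sub_mul]
    refine Eq.trans ?_ (integral_sub
      (f := fun x => (R t x + C.canonicalScalar x) * Real.exp (δ * Real.sin t * f x) * h x)
      (g := fun x => D.divergence (X t) x * h x)
      (hint ((hdens.slice t).continuous.mul hrc.continuous))
      (hint ((hdiv.slice t).continuous.mul hrc.continuous))).symm
    rw [integral_divergence ho hvol hD hK hKi (hX0 t), sub_zero]
  have hpt : ∀ x, deriv (fun t => ((R t x + C.canonicalScalar x) *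
      Real.exp (δ * Real.sin t * f x) - D.divergence (X t) x) * h x) 0 =
      δ * (firstVariation D V T A f x * h x) := fun x => by
    have h1 : HasDerivAt (fun t => Real.exp (δ * Real.sin t * f x) - 1) (δ * f x) 0 := by
      simpa using ((hε'.mul_const (f x)).exp).sub_const 1
    have h2 : ContinuousAt (fun t => R t x + C.canonicalScalar x) 0 :=
      ((hR.hasDerivAt 0 x).continuousAt).add continuousAt_const
    have h3 := hasDerivAt_mul_of_zero h1 (by simp) h2
    have h4 := ((h3.add (hder x)).add_const (C.canonicalScalar x)).mul_const (h x)
    refine (HasDerivAt.congr_of_eventuallyEq (h4.congr_deriv ?_)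
      (Filter.Eventually.of_forall fun t => ?_)).deriv
    · rw [hR0, hε'.deriv, firstVariation]
      ring
    · simp only [Pi.add_apply]
      ring
  have h1 : HasDerivAt (fun t => S (δ * Real.sin t)) (δ * J) 0 := by
    have := hasDerivAt_integral_of_smoothFamily (μ := formMeasure I o) hG hK
    simp only [hpt, integral_const_mul] at this
    simpa only [hSt] using this
  have h2 : HasDerivAt (fun ε : ℝ => Real.arcsin (ε / δ)) (1 / δ) 0 := by
    have e1 : HasDerivAt Real.arcsin 1 (0 / δ) := by
      simpa using Real.hasDerivAt_arcsin (x := 0) (by norm_num) (by norm_num)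
    have e2 := e1.comp (0 : ℝ) ((hasDerivAt_id (0 : ℝ)).div_const δ)
    rw [one_mul] at e2
    exact e2
  have h3 : HasDerivAt (fun ε => S (δ * Real.sin (Real.arcsin (ε / δ)))) (δ * J * (1 / δ)) 0 := by
    have e0 : Real.arcsin (0 / δ) = 0 := by simp
    have e1 : HasDerivAt (fun t => S (δ * Real.sin t)) (δ * J) (Real.arcsin (0 / δ)) := by rwa [e0]
    exact e1.comp (0 : ℝ) h2
  have h4 : δ * J * (1 / δ) = J := by field_simp
  rw [h4] at h3
  refine h3.congr_of_eventuallyEq ?_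
  have : ∀ᶠ ε : ℝ in 𝓝 0, |ε| < δ := by
    have := Metric.ball_mem_nhds (0 : ℝ) hδ
    filter_upwards [this] with ε hε using by simpa using hε
  filter_upwards [this] with ε hε
  have e2 : |ε / δ| ≤ 1 := by
    rw [abs_div, abs_of_pos hδ]
    exact (div_le_one hδ).2 hε.le
  rw [Real.sin_arcsin (abs_le.1 e2).1 (abs_le.1 e2).2, mul_div_cancel₀ _ hδ.ne']

/-- A continuous nonnegative function with vanishing integral over a compact set outside which it is
zero vanishes. -/
theorem eq_zero_of_integral_eq_zero (ho : IsVolumeForm I o) {g : M → ℝ} (hg : Continuous g)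
    (h0 : ∀ x, 0 ≤ g x) (hK : IsCompact K) (hgK : ∀ x ∉ K, g x = 0)
    (h : ∫ x in K, g x ∂(formMeasure I o) = 0) (x : M) : g x = 0 := by
  have := isLocallyFiniteMeasure_formMeasure ho
  have := isOpenPosMeasure_formMeasure ho
  rw [setIntegral_eq_integral_of_forall_compl_eq_zero hgK] at h
  by_contra hx
  have := hg.integral_pos_of_hasCompactSupport_nonneg_nonzero (μ := formMeasure I o)
    (HasCompactSupport.intro hK hgK) h0 hx
  exact this.ne' h

end FirstVariation

end CourantAlgebroid
end

noncomputable section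

namespace CourantAlgebroid

variable {n : ℕ} {H : Type*} [TopologicalSpace H]
  {I : ModelWithCorners ℝ (EuclideanSpace ℝ (Fin n)) H}
  {M : Type*} [TopologicalSpace M] [ChartedSpace H M] [IsManifold I ∞ M]
  {F : Type*} [NormedAddCommGroup F] [NormedSpace ℝ F]
  {E : M → Type*} [TopologicalSpace (TotalSpace F E)] [∀ x, TopologicalSpace (E x)]
  [∀ x, AddCommGroup (E x)] [∀ x, Module ℝ (E x)] [FiberBundle F E] [VectorBundle ℝ F E]
  [T2Space M] [FiniteDimensional ℝ F] [ContMDiffVectorBundle ∞ F E I]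

/-! ## The equations of motion -/

section EquationsOfMotion

variable {C : CourantAlgebroid I F E} {V : ∀ x, Submodule ℝ (E x)} {T A : ∀ x, E x →ₗ[ℝ] E x}
  {o vol : TopForm I M} {D : C.Connection} {p q : ℝ}

theorem IsInfinitesimal.isVariation (hA : C.IsInfinitesimal T A) (hT : C.IsSplitting V T) :
    C.IsVariation V fun x => A x ∘ₗ (V x).subtype where
  mem_perp x v := by
    rw [hT.mem_perp_iff]
    change T x (A x v) = -A x v
    rw [hA.anti, (hT.mem_iff x v).1 v.2]
  smooth ψ hψ := (C.mkSection (fun x => A x (ψ x)) fun s => (hA.smooth ψ s).slice 0).contMDiff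

theorem isInfinitesimal_zero (C : CourantAlgebroid I F E) (T : ∀ x, E x →ₗ[ℝ] E x) :
    C.IsInfinitesimal T fun _ => 0 where
  smooth s := (C.weakSmooth_section (0 : Cₛ^∞⟮I; F, E⟯))
  skew x u v := by simp
  anti x v := by simp

/-- The infinitesimal variation `a (⟨·, ψ⟩ ψ' - ⟨·, ψ'⟩ ψ)`. -/
def rankTwo (C : CourantAlgebroid I F E) (a : M → ℝ) (ψ ψ' : Cₛ^∞⟮I; F, E⟯) (x : M) :
    E x →ₗ[ℝ] E x :=
  a x • ((C.metric x (ψ x)).smulRight (ψ' x) - (C.metric x (ψ' x)).smulRight (ψ x))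

theorem rankTwo_apply (a : M → ℝ) (ψ ψ' : Cₛ^∞⟮I; F, E⟯) (x : M) (v : E x) :
    C.rankTwo a ψ ψ' x v =
      a x • (C.metric x (ψ x) v • ψ' x - C.metric x (ψ' x) v • ψ x) := rfl

theorem isInfinitesimal_rankTwo {a : M → ℝ} (ha : ContMDiff I 𝓘(ℝ, ℝ) ∞ a)
    (hT : C.IsSplitting V T) {ψ ψ' : Cₛ^∞⟮I; F, E⟯} (hψ : ∀ x, T x (ψ x) = ψ x)
    (hψ' : ∀ x, T x (ψ' x) = -ψ' x) : C.IsInfinitesimal T (C.rankTwo a ψ ψ') where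
  smooth s := (WeakSmooth.smul (.of_function ha)
    ((WeakSmooth.smul (.of_function (C.metric_smooth ψ s)) (C.weakSmooth_section ψ')).sub
      (WeakSmooth.smul (.of_function (C.metric_smooth ψ' s)) (C.weakSmooth_section ψ))))
  skew x u v := by
    simp only [rankTwo_apply, map_smul, map_sub, LinearMap.smul_apply, LinearMap.sub_apply,
      smul_eq_mul]
    rw [C.metric_comm x u (ψ x), C.metric_comm x u (ψ' x)]
    ring
  anti x v := by
    simp only [rankTwo_apply, map_smul, map_sub]
    rw [hψ, hψ', ← hT.symm, ← hT.symm, hψ, hψ']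
    simp only [map_neg, LinearMap.neg_apply]
    module

theorem sum_ricciForm_rankTwo (a : M → ℝ) {ψ ψ' : Cₛ^∞⟮I; F, E⟯} (hT : C.IsSplitting V T)
    (hψ : ∀ x, T x (ψ x) = ψ x) (hψ' : ∀ x, T x (ψ' x) = -ψ' x) (x : M) :
    ∑ m, D.ricciForm x (frameBasis I F E x m) (C.rankTwo a ψ ψ' x (T x (C.dualFrame x m))) =
      2 * (a x * D.ricci ψ ψ' x) := by
  have h1 : ∀ (u w : E x), ∑ m, C.metric x u (C.dualFrame x m) *
      D.ricciForm x (frameBasis I F E x m) w = D.ricciForm x u w := fun u w => by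
    conv_rhs => rw [← C.sum_dualFrame_frame x u]
    simp only [map_sum, map_smul, LinearMap.sum_apply, LinearMap.smul_apply, smul_eq_mul]
  have h2 : ∀ m, D.ricciForm x (frameBasis I F E x m)
      (C.rankTwo a ψ ψ' x (T x (C.dualFrame x m))) =
      a x * (C.metric x (ψ x) (C.dualFrame x m) * D.ricciForm x (frameBasis I F E x m) (ψ' x) +
        C.metric x (ψ' x) (C.dualFrame x m) * D.ricciForm x (frameBasis I F E x m) (ψ x)) :=
    fun m => by
      rw [rankTwo_apply, ← hT.symm, ← hT.symm, hψ, hψ']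
      simp only [map_smul, map_sub, map_neg, LinearMap.neg_apply, smul_eq_mul]
      ring
  rw [Finset.sum_congr rfl fun m _ => h2 m, ← Finset.mul_sum, Finset.sum_add_distrib, h1, h1,
    D.ricciForm_symm x (ψ' x), D.ricciForm_apply]
  ring

theorem sum_ricciForm_eq_zero (hT : C.IsSplitting V T) (hA : C.IsInfinitesimal T A) {x : M}
    (h : ∀ u v : E x, T x u = u → T x v = -v → D.ricciForm x u v = 0) :
    ∑ m, D.ricciForm x (frameBasis I F E x m) (A x (T x (C.dualFrame x m))) = 0 := by
  have hc : ∀ u v, D.ricciForm x (T x u) v = D.ricciForm x u (T x v) := fun u v => by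
    have hm : ∀ u v : E x, D.ricciForm x (u + T x u) (v - T x v) = 0 := fun u v =>
      h _ _ (by rw [map_add, hT.invol, add_comm]) (by rw [map_sub, hT.invol, neg_sub])
    have h1 := hm u v
    have h2 := hm v u
    simp only [map_add, map_sub, LinearMap.add_apply] at h1 h2
    rw [D.ricciForm_symm x v u, D.ricciForm_symm x v (T x u), D.ricciForm_symm x (T x v) u,
      D.ricciForm_symm x (T x v) (T x u)] at h2
    linarith
  set B : E x →ₗ[ℝ] E x →ₗ[ℝ] ℝ := (D.ricciForm x).compl₂ (A x) with hB
  have h1 := sum_swap_self_adjoint (C := C) (T := T x) (hT.symm x) B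
  have h2 := sum_swap (C := C) x (B ∘ₗ T x)
  have h3 : ∀ m, (B ∘ₗ T x) (frameBasis I F E x m) (C.dualFrame x m) =
      -B (frameBasis I F E x m) (T x (C.dualFrame x m)) := fun m => by
    simp only [hB, LinearMap.comp_apply, LinearMap.compl₂_apply]
    rw [hc, hA.anti, map_neg]
  rw [Finset.sum_congr rfl fun m _ => h3 m, Finset.sum_neg_distrib] at h2
  have h4 := h1.symm.trans h2
  change ∑ m, B (frameBasis I F E x m) (T x (C.dualFrame x m)) = 0
  linarith

theorem contMDiff_scalarCurvature_genMetric (hT : C.IsSplitting V T) (D : C.Connection) :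
    ContMDiff I 𝓘(ℝ, ℝ) ∞ (D.scalarCurvature (C.genMetric V)) := by
  have h : D.scalarCurvature (C.genMetric V) =
      fun x => C.tr x ((D.ricciForm x).compl₂ (T x)) := funext fun x => by
    rw [hT.scalarCurvature_eq]
    rfl
  rw [h]
  refine C.contMDiff_tr fun s s' => (D.contMDiff_ricci s (hT.onSection s')).congr fun x => ?_
  rw [LinearMap.compl₂_apply, ← D.ricciForm_apply]
  rfl

variable [MeasurableSpace M] [BorelSpace M] [SigmaCompactSpace M]

/-- A function of the form `χ u²` vanishes if its integral does, so `u = 0` where `χ ≠ 0`. -/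
theorem eq_zero_of_variation (ho : IsVolumeForm I o) (hvol : IsVolumeForm I vol)
    {u : M → ℝ} (hu : Continuous u) (h : ∀ χ : C^∞⟮I, M; 𝓘(ℝ, ℝ), ℝ⟯, HasCompactSupport χ →
      tsupport χ ⊆ I.interior M → ∫ x in tsupport χ, (χ x * u x * formRatio I vol o x) * u x *
        formRatio I vol o x ∂(formMeasure I o) = 0) (x : M) : u x = 0 := by
  have hint : ∀ x ∈ I.interior M, u x = 0 := fun x hx => by
    obtain ⟨χ, h1, h2, h3, h4⟩ := exists_cutoff I
      ((I.isOpen_interior (M := M) (n := ∞) (by simp)).mem_nhds hx)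
    have h0 := h χ h3 h1
    have hr := (contMDiff_formRatio hvol ho).continuous
    have h5 := eq_zero_of_integral_eq_zero ho
      (g := fun x => (χ x * u x * formRatio I vol o x) * u x * formRatio I vol o x)
      ((((χ.contMDiff.continuous.mul hu).mul hr).mul hu).mul hr)
      (fun x => by
        have : (χ x * u x * formRatio I vol o x) * u x * formRatio I vol o x =
          χ x * (u x * formRatio I vol o x) ^ 2 := by ring
        rw [this]
        exact mul_nonneg (h4 x) (sq_nonneg _))
      h3 (fun x hx => by rw [image_eq_zero_of_notMem_tsupport hx]; ring) h0 x
    have h6 := formRatio_ne_zero hvol ho x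
    rw [h2.self_of_nhds] at h5
    by_contra h7
    have : 1 * u x * formRatio I vol o x * u x * formRatio I vol o x ≠ 0 := by positivity
    exact this h5
  exact congrFun (Continuous.ext_on (dense_interior (I := I)) hu continuous_const hint) x

theorem isExtremal_iff (ho : IsVolumeForm I o) (hvol : IsVolumeForm I vol)
    (hT : C.IsSplitting V T)
    (hD : D.IsLeviCivita V vol) (hp : p ≠ 1) (hq : q ≠ 1)
    (htr : ∀ x, ∑ i, C.metric x (T x (frameBasis I F E x i)) (C.dualFrame x i) = p - q)
    (hF : (finrank ℝ F : ℝ) = p + q) :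
    C.IsExtremal o V vol ↔ D.IsRicciCompatible V ∧
        ∀ x, D.scalarCurvature (C.genMetric V) x + C.canonicalScalar x = 0 := by
  have hrc := contMDiff_formRatio hvol ho
  have hR : ContMDiff I 𝓘(ℝ, ℝ) ∞
      fun x => D.scalarCurvature (C.genMetric V) x + C.canonicalScalar x :=
    (contMDiff_scalarCurvature_genMetric hT D).add (contMDiff_canonicalScalar C)
  constructor
  · intro hE
    have key : ∀ {A : ∀ x, E x →ₗ[ℝ] E x} (f : C^∞⟮I, M; 𝓘(ℝ, ℝ), ℝ⟯) {K : Set M},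
        C.IsInfinitesimal T A → IsCompact K → K ⊆ I.interior M → (∀ x ∉ K, A x = 0) →
        (∀ x ∉ K, f x = 0) → ∫ x in K, firstVariation D V T A f x * formRatio I vol o x
          ∂(formMeasure I o) = 0 := fun {A} f {K} hA hK hKi hAK hfK => by
      have h1 := hasDerivAt_ehAction (φ := fun x => A x ∘ₗ (V x).subtype) ho hvol hT hD hp hq htr hF
        hA (fun x v => rfl) f.contMDiff hK hKi hAK hfK
      have h2 := hE K hK hKi _ (hA.isVariation hT) (fun x hx => by rw [hAK x hx]; rfl) f hfK
      exact h1.unique h2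
    refine ⟨fun ψ ψ' hψ hψ' x => ?_, fun x => ?_⟩
    · have hψ1 : ∀ x, T x (ψ x) = ψ x := fun x => (hT.mem_iff x _).1 (hψ x)
      have hψ2 : ∀ x, T x (ψ' x) = -ψ' x := fun x => (hT.mem_perp_iff x _).1 (hψ' x)
      refine eq_zero_of_variation (u := D.ricci ψ ψ') ho hvol (D.contMDiff_ricci ψ ψ').continuous
        (fun χ h1 h2 => ?_) x
      have ha : ContMDiff I 𝓘(ℝ, ℝ) ∞ fun x => χ x * D.ricci ψ ψ' x * formRatio I vol o x :=
        (χ.contMDiff.mul (D.contMDiff_ricci ψ ψ')).mul hrc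
      have h3 := key (A := C.rankTwo (fun x => χ x * D.ricci ψ ψ' x * formRatio I vol o x) ψ ψ')
        (K := tsupport χ) ⟨fun _ => 0, contMDiff_const⟩ (isInfinitesimal_rankTwo ha hT hψ1 hψ2) h1 h2
        (fun x hx => by
          rw [rankTwo, image_eq_zero_of_notMem_tsupport hx]; simp) (fun x hx => rfl)
      have h4 : ∀ x, firstVariation D V T
          (C.rankTwo (fun x => χ x * D.ricci ψ ψ' x * formRatio I vol o x) ψ ψ') (fun _ => 0) x *
          formRatio I vol o x =
          4 * ((χ x * D.ricci ψ ψ' x * formRatio I vol o x) * D.ricci ψ ψ' x *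
            formRatio I vol o x) := fun x => by
        rw [firstVariation, sum_ricciForm_rankTwo _ hT hψ1 hψ2]
        ring
      have h5 := (integral_congr_ae (Filter.Eventually.of_forall h4)).symm.trans h3
      rw [integral_const_mul] at h5
      linarith
    · refine eq_zero_of_variation
        (u := fun x => D.scalarCurvature (C.genMetric V) x + C.canonicalScalar x) ho hvol
        hR.continuous (fun χ h1 h2 => ?_) x
      have h3 := key (A := fun x => 0) (K := tsupport χ) ⟨_, (χ.contMDiff.mul hR).mul hrc⟩
        (isInfinitesimal_zero C T) h1 h2 (fun x hx => rfl)
        (fun x hx => by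
          change χ x * _ * _ = 0
          rw [image_eq_zero_of_notMem_tsupport hx]; ring)
      refine Eq.trans (integral_congr_ae (Filter.Eventually.of_forall fun x => ?_)) h3
      simp [firstVariation]
  · rintro ⟨h1, h2⟩ K hK hKi φ hφ hφK f hfK
    obtain ⟨A, hA, hAφ, hA0⟩ := hφ.exists_isInfinitesimal hT
    have h3 := hasDerivAt_ehAction ho hvol hT hD hp hq htr hF hA hAφ f.contMDiff hK hKi
      (fun x hx => hA0 x (hφK x hx)) hfK
    have h4 : ∀ x, firstVariation D V T A f x * formRatio I vol o x = 0 := fun x => by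
      rw [firstVariation, h2, sum_ricciForm_eq_zero hT hA
        ((Connection.isRicciCompatible_iff hT hD).1 h1 x)]
      ring
    simpa only [h4, integral_zero] using h3

end EquationsOfMotion

end CourantAlgebroid
end

theorem corollary1 {n : ℕ} {H : Type*} [TopologicalSpace H]
    {I : ModelWithCorners ℝ (EuclideanSpace ℝ (Fin n)) H}
    {M : Type*} [TopologicalSpace M] [ChartedSpace H M] [IsManifold I ∞ M]
    [T2Space M] [SigmaCompactSpace M] [MeasurableSpace M] [BorelSpace M]
    {F : Type*} [NormedAddCommGroup F] [NormedSpace ℝ F] [FiniteDimensional ℝ F]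
    {E : M → Type*} [TopologicalSpace (TotalSpace F E)] [∀ x, TopologicalSpace (E x)]
    [∀ x, AddCommGroup (E x)] [∀ x, Module ℝ (E x)] [FiberBundle F E] [VectorBundle ℝ F E]
    [ContMDiffVectorBundle ∞ F E I]
    (C : CourantAlgebroid I F E)
    (p q : ℕ) (hsig : C.HasSignature p q) (hp : p ≠ 1) (hq : q ≠ 1)
    (o : TopForm I M) (ho : IsVolumeForm I o)
    (V : ∀ x, Submodule ℝ (E x)) (hV : C.IsGeneralizedMetric V)
    (vol : TopForm I M) (hvol : IsVolumeForm I vol)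
    (D : C.Connection) (hD : D.IsLeviCivita V vol) :
    (C.IsExtremal o V vol ↔
      D.IsRicciCompatible V ∧
        ∀ x, D.scalarCurvature (C.genMetric V) x + C.canonicalScalar x = 0) ∧
    (∀ D' : C.Connection, D'.IsLeviCivita V vol →
      (∀ ψ ψ' : Cₛ^∞⟮I; F, E⟯, (∀ x, ψ x ∈ V x) → (∀ x, ψ' x ∈ C.perp V x) →
        ∀ x, D'.ricci ψ ψ' x = D.ricci ψ ψ' x) ∧
      ∀ x, D'.scalarCurvature (C.genMetric V) x = D.scalarCurvature (C.genMetric V) x) := by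
  obtain ⟨T, hT⟩ := hV.exists_isSplitting
  have hdim : ∀ x, finrank ℝ (V x) = p ∧ finrank ℝ F = p + q := fun x =>
    CourantAlgebroid.finrank_eq_of_isGeneralizedMetric hsig hV x (hT.isCompl x)
  refine ⟨?_, fun D' hD' => ⟨fun ψ ψ' hψ hψ' x => hD.ricci_eq hvol hT hD' hψ hψ' x,
    fun x => hD.scalarCurvature_eq hvol hT hD' x⟩⟩
  rcases isEmpty_or_nonempty M with hM | ⟨⟨x₀⟩⟩
  · exact CourantAlgebroid.isExtremal_iff (p := finrank ℝ F + 5) (q := -5) ho hvol hT hD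
      (fun h => by linarith [(finrank ℝ F).cast_nonneg (α := ℝ)]) (by norm_num) (fun x => isEmptyElim x) (by ring)
  · have hF : (finrank ℝ F : ℝ) = p + q := by exact_mod_cast (hdim x₀).2
    refine CourantAlgebroid.isExtremal_iff (p := p) (q := q) ho hvol hT hD (by exact_mod_cast hp)
      (by exact_mod_cast hq) (fun x => ?_) hF
    rw [hT.sum_metric, (hdim x).1, hF]
    ring
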